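/- **Setting.** Let $T>0$, $\tfrac12<H<1$, and let $B=(B^1,\dots,B^k)$ be a $k$-dimensional fractional Brownian motion on $[0,T]$ with Hurst parameter $H$ on a complete probability space $(\Omega,\mathcal F,\mathbb P)$: the $B^j$ are independent centred Gaussian processes with $\mathbb E[B^j_sB^j_t]=\frac12(t^{2H}+s^{2H}-|t-s|^{2H})$ and a.s. continuous paths. Let $b:[0,T]\times\mathbb R^d\to\mathbb R^d$ and $\sigma:[0,T]\times\mathbb R^d\to\mathbb R^{d\times k}$ satisfy, for some $\beta,\delta\in(0,1]$ and $\alpha_0:=\min\{\frac12,\beta,\frac{\delta}{1+\delta}\}$, for all $s,t\in[0,T]$: * (H1) $\sigma$ is differentiable in $x$; there is $M_0>0$ with $|\sigma(t,x)-\sigma(s,y)|\le M_0(|t-s|^\beta+|x-y|)$ for all $x,y$; and for every $R\ge0$ there is $M_R>0$ with $|\nabla_x\sigma(t,y)-\nabla_x\sigma(s,z)|\le M_R(|t-s|^\beta+|y-z|^\delta)$ whenever $|y|,|z|\le R$. * (H2) there is $\mu\in(1-\alpha_0,1]$ such that for every $R\ge0$ there is $L_R>0$ with $|b(t,x)-b(s,y)|\le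 L_R(|t-s|^\mu+|x-y|)$ whenever $|x|,|y|\le R$; and there is $L_0>0$ with $|b(t,x)|\le L_0(1+|x|)$ for all $x$. Assume $\beta>1-H$, $\delta>(1-H)/H$ and $1-H<\alpha<\alpha_0$. For $t\le s$ the integral is the generalized Stieltjes (Zähle) integral $\int_t^s f\,dg=(-1)^\alpha\int_t^s D^\alpha_{t+}f(r)\,D^{1-\alpha}_{s-}g_{s-}(r)\,dr$, $(-1)^\alpha=e^{i\pi\alpha}$, where $$D^\alpha_{t+}f(r)=\tfrac1{\Gamma(1-\alpha)}\Big(\tfrac{f(r)}{(r-t)^\alpha}+\alpha\int_t^r\tfrac{f(r)-f(y)}{(r-y)^{\alpha+1}}dy\Big),$$ $$D^{1-\alpha}_{s-}g_{s-}(r)=\tfrac{e^{i\pi(1-\alpha)}}{\Gamma(\alpha)}\Big(\tfrac{g(r)-g(s)}{(s-r)^{1-\alpha}}+(1-\alpha)\int_r^s\tfrac{g(r)-g(y)}{(y-r)^{2-\alpha}}dy\Big),$$ and $\Lambda_\alpha(g)=\frac1{\Gamma(1-\alpha)}\sup_{0<r<s<T}|D^{1-\alpha}_{s-}g_{s-}(r)|$.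 Let $\mathcal K=\{K(t):t\in[0,T]\}$ be a family of nonempty closed subsets of $\mathbb R^d$. **Viability.** $\mathcal K$ is viable if for all $t\in[0,T]$ and $x\in K(t)$ there is a process $X=X^{t,x}$ on $[t,T]$ such that for a.e. $\omega$: $X(\omega,\cdot)\in C^{1-\alpha}([t,T];\mathbb R^d)$, $$X_s=x+\int_t^s b(r,X_r)\,dr+\int_t^s\sigma(r,X_r)\,dB_r,\qquad s\in[t,T],$$ and $X_s\in K(s)$ for all $s\in[t,T]$. **Contingency.** The pairs $(b(t,x),\sigma(t,x))$ are $(1-\alpha)$-fractional $B^H$-contingent to $K(t)$ at all $(t,x)$ with $t\in[0,T]$, $x\in K(t)$, if there are an event $\Omega_0$ of probability one and, for each $R>0$, a constant $\gamma_R\in(0,1)$ and random variables $H_R=c_R(\Lambda_\alpha(B))>0$, $\tilde H_R=\tilde c_R(\Lambda_\alpha(B))>0$ with $c_R,\tilde c_R:\mathbb R\to(0,\infty)$ measurable, all independent of $(t,x)$, such that for every $t\in[0,T]$ and $x\in K(t)$ there are a random variable $\bar h>0$ and a process $Q$ for which, for all $\omega\in\Omega_0$, all $s,\tau\in[t,(t+\bar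 h)\wedge T]$ and all $R>0$ with $R\ge|x|$, $$|Q(s)-Q(\tau)|\le H_R|s-\tau|^{1-\alpha},\qquad |Q(s)|\le\tilde H_R|s-t|^{1+\gamma_R},$$ $$x+(s-t)b(t,x)+\sigma(t,x)[B_s-B_t]+Q(s)\in K(s).$$ **Left-closedness.** $\mathcal K$ is left-closed if $t_n\to t$ with $0\le t_n<t\le T$, $y_n\in K(t_n)$ and $y_n\to y$ imply $y\in K(t)$ (automatic for a constant family $K(t)\equiv K$, and whenever the graph of $\mathcal K$ is closed). **Theorem.** $\mathcal K$ is viable if and only if $\mathcal K$ is left-closed and, at all $(t,x)$ with $t\in[0,T]$, $x\in K(t)$, the pair $(b(t,x),\sigma(t,x))$ is $(1-\alpha)$-fractional $B^H$-contingent to $K(t)$. In particular, for a left-closed family, viability and contingency are equivalent, and viability implies contingency for every family of nonempty closed sets. -/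

import Mathlib

open MeasureTheory ProbabilityTheory Set Filter Topology
open scoped Matrix

noncomputable section

namespace FracViability

/-! ### Fractional Brownian motion -/

/-- A real fractional Brownian motion on `[0,T]` with Hurst parameter `H`: a centred Gaussian
process with covariance `(t^{2H} + s^{2H} - |t-s|^{2H}) / 2` and almost surely continuous paths. -/
structure IsFBM {Ω : Type*} [MeasurableSpace Ω] (P : Measure Ω) (T H : ℝ)
    (B : ℝ → Ω → ℝ) : Prop where
  measurable : ∀ t ∈ Icc 0 T, Measurable (B t)
  gaussian : IsGaussianProcess (fun (t : Icc (0 : ℝ) T) ω => B t ω) P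
  centered : ∀ t ∈ Icc 0 T, ∫ ω, B t ω ∂P = 0
  covariance : ∀ s ∈ Icc 0 T, ∀ t ∈ Icc 0 T,
    ∫ ω, B s ω * B t ω ∂P = (t ^ (2 * H) + s ^ (2 * H) - |t - s| ^ (2 * H)) / 2
  continuous : ∀ᵐ ω ∂P, ContinuousOn (fun t => B t ω) (Icc 0 T)

/-- A `k`-dimensional fractional Brownian motion on `[0,T]`: the components are independent
(as processes) real fractional Brownian motions with the same Hurst parameter. -/
structure IsVectorFBM {Ω : Type*} [MeasurableSpace Ω] (P : Measure Ω) (T H : ℝ) {k : ℕ}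
    (B : ℝ → Ω → EuclideanSpace ℝ (Fin k)) : Prop where
  component : ∀ j, IsFBM P T H (fun t ω => B t ω j)
  indep : iIndepFun (fun (j : Fin k) ω (t : Icc (0 : ℝ) T) => B t ω j) P

/-! ### The generalized Stieltjes integral -/

/-- The left Weyl derivative `D_{t+}^α f` at `r ∈ (t, T)`. -/
def leftWeyl (α t : ℝ) (f : ℝ → ℝ) (r : ℝ) : ℝ :=
  1 / Real.Gamma (1 - α) *
    (f r / (r - t) ^ α + α * ∫ y in t..r, (f r - f y) / (r - y) ^ (α + 1))

/-- The right Weyl derivative `D_{s-}^{1-α} g_{s-}` at `r < s`, without the constant phase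
`e^{iπ(1-α)}`. -/
def rightWeyl {F : Type*} [NormedAddCommGroup F] [NormedSpace ℝ F]
    (α s : ℝ) (g : ℝ → F) (r : ℝ) : F :=
  (1 / Real.Gamma α) •
    ((1 / (s - r) ^ (1 - α)) • (g r - g s) +
      (1 - α) • ∫ y in r..s, (1 / (y - r) ^ (2 - α)) • (g r - g y))

/-- `Λ_α(g) = Γ(1-α)⁻¹ sup_{0<r<s<T} |D_{s-}^{1-α} g_{s-}(r)|`. -/
def Lam {k : ℕ} (α T : ℝ) (g : ℝ → EuclideanSpace ℝ (Fin k)) : ℝ :=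
  1 / Real.Gamma (1 - α) *
    sSup {v : ℝ | ∃ r s : ℝ, 0 < r ∧ r < s ∧ s < T ∧ v = ‖rightWeyl α s g r‖}

/-- The generalized Stieltjes integral
`∫_t^s f dg = (-1)^α ∫_t^s D_{t+}^α f(r) D_{s-}^{1-α} g_{s-}(r) dr` for scalar `f` and `g`.
The phase `e^{iπ(1-α)}` left out of `rightWeyl` and the factor `(-1)^α = e^{iπα}` multiply
to `-1`. -/
def stieltjes (α t s : ℝ) (f g : ℝ → ℝ) : ℝ :=
  - ∫ r in t..s, leftWeyl α t f r * rightWeyl α s g r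

/-- The integral `∫_t^s f dg` of a `d × k`-matrix valued `f` against an `ℝ^k`-valued `g`. -/
def vecStieltjes {d k : ℕ} (α t s : ℝ) (f : ℝ → Matrix (Fin d) (Fin k) ℝ)
    (g : ℝ → EuclideanSpace ℝ (Fin k)) : EuclideanSpace ℝ (Fin d) :=
  WithLp.toLp 2 fun i => ∑ j, stieltjes α t s (fun r => f r i j) (fun r => g r j)

/-! ### Assumptions on the coefficients -/

/-- The Euclidean (Frobenius) norm of a matrix. -/
def frob {d k : ℕ} (A : Matrix (Fin d) (Fin k) ℝ) : ℝ :=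
  Real.sqrt (∑ i, ∑ j, A i j ^ 2)

/-- The partial derivative `∂_{x_l} σ^{i,j}(t,x)`. -/
def partialSigma {d k : ℕ} (σ : ℝ → EuclideanSpace ℝ (Fin d) → Matrix (Fin d) (Fin k) ℝ)
    (t : ℝ) (x : EuclideanSpace ℝ (Fin d)) (l i : Fin d) (j : Fin k) : ℝ :=
  fderiv ℝ (fun y => σ t y i j) x (EuclideanSpace.single l 1)

/-- Assumption (H1) on `σ`, with exponents `β`, `δ`. -/
structure H1 {d k : ℕ} (T β δ : ℝ)
    (σ : ℝ → EuclideanSpace ℝ (Fin d) → Matrix (Fin d) (Fin k) ℝ) : Prop where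
  beta_pos : 0 < β
  beta_le : β ≤ 1
  delta_pos : 0 < δ
  delta_le : δ ≤ 1
  differentiable : ∀ t ∈ Icc 0 T, ∀ i j, Differentiable ℝ (fun x => σ t x i j)
  lipschitz : ∃ M₀ > 0, ∀ t ∈ Icc 0 T, ∀ s ∈ Icc 0 T, ∀ x y,
    frob (σ t x - σ s y) ≤ M₀ * (|t - s| ^ β + ‖x - y‖)
  gradient : ∀ R ≥ 0, ∃ M > 0, ∀ t ∈ Icc 0 T, ∀ s ∈ Icc 0 T, ∀ y z, ‖y‖ ≤ R → ‖z‖ ≤ R →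
    Real.sqrt (∑ l, ∑ i, ∑ j, (partialSigma σ t y l i j - partialSigma σ s z l i j) ^ 2) ≤
      M * (|t - s| ^ β + ‖y - z‖ ^ δ)

/-- `α₀ = min {1/2, β, δ/(1+δ)}`. -/
def alpha₀ (β δ : ℝ) : ℝ := min (1 / 2) (min β (δ / (1 + δ)))

/-- Assumption (H2) on `b`. -/
structure H2 {d : ℕ} (T β δ : ℝ)
    (b : ℝ → EuclideanSpace ℝ (Fin d) → EuclideanSpace ℝ (Fin d)) : Prop where
  holder : ∃ μ, 1 - alpha₀ β δ < μ ∧ μ ≤ 1 ∧ ∀ R ≥ 0, ∃ L > 0,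
    ∀ r ∈ Icc 0 T, ∀ s ∈ Icc 0 T, ∀ x y, ‖x‖ ≤ R → ‖y‖ ≤ R →
      ‖b r x - b s y‖ ≤ L * (|r - s| ^ μ + ‖x - y‖)
  growth : ∃ L₀ > 0, ∀ t ∈ Icc 0 T, ∀ x, ‖b t x‖ ≤ L₀ * (1 + ‖x‖)

/-! ### Solutions and viability -/

/-- `X ∈ C^{1-α}([t,T]; ℝ^d)` solves
`X_s = x + ∫_t^s b(r, X_r) dr + ∫_t^s σ(r, X_r) dg(r)` for `s ∈ [t,T]`. -/
structure IsSolution {d k : ℕ} (α T : ℝ)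
    (b : ℝ → EuclideanSpace ℝ (Fin d) → EuclideanSpace ℝ (Fin d))
    (σ : ℝ → EuclideanSpace ℝ (Fin d) → Matrix (Fin d) (Fin k) ℝ)
    (g : ℝ → EuclideanSpace ℝ (Fin k)) (t : ℝ) (x : EuclideanSpace ℝ (Fin d))
    (X : ℝ → EuclideanSpace ℝ (Fin d)) : Prop where
  holder : ∃ C : ℝ, ∀ s ∈ Icc t T, ∀ r ∈ Icc t T, ‖X s - X r‖ ≤ C * |s - r| ^ (1 - α)
  equation : ∀ s ∈ Icc t T,
    X s = x + (∫ r in t..s, b r (X r)) + vecStieltjes α t s (fun r => σ r (X r)) g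

/-- Viability: from every `t ∈ [0,T]` and `x ∈ K(t)` there starts a process which almost surely
is a `C^{1-α}` solution on `[t,T]` driven by `B` and satisfies `X_s ∈ K(s)` for all
`s ∈ [t,T]`. -/
def Viable {Ω : Type*} [MeasurableSpace Ω] (P : Measure Ω) {d k : ℕ} (α T : ℝ)
    (b : ℝ → EuclideanSpace ℝ (Fin d) → EuclideanSpace ℝ (Fin d))
    (σ : ℝ → EuclideanSpace ℝ (Fin d) → Matrix (Fin d) (Fin k) ℝ)
    (B : ℝ → Ω → EuclideanSpace ℝ (Fin k)) (K : ℝ → Set (EuclideanSpace ℝ (Fin d))) : Prop :=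
  ∀ t ∈ Icc 0 T, ∀ x ∈ K t, ∃ X : ℝ → Ω → EuclideanSpace ℝ (Fin d),
    (∀ s ∈ Icc t T, Measurable (X s)) ∧
    ∀ᵐ ω ∂P, IsSolution α T b σ (fun r => B r ω) t x (fun s => X s ω) ∧
      ∀ s ∈ Icc t T, X s ω ∈ K s

/-! ### Contingency -/

/-- The pair `(b(t,x), σ(t,x))` is `(1-α)`-fractional `B`-contingent to `K(t)` in `(t,x)`, on the
event `Ω₀` and with the constants `H_R = c R (Λ_α(B))`, `H̃_R = c' R (Λ_α(B))`, `γ_R = γ R`.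
Times are restricted to `[0,T]`, where `K` lives. -/
def ContingentAt {Ω : Type*} [MeasurableSpace Ω] {d k : ℕ} (α T : ℝ)
    (b : ℝ → EuclideanSpace ℝ (Fin d) → EuclideanSpace ℝ (Fin d))
    (σ : ℝ → EuclideanSpace ℝ (Fin d) → Matrix (Fin d) (Fin k) ℝ)
    (B : ℝ → Ω → EuclideanSpace ℝ (Fin k)) (K : ℝ → Set (EuclideanSpace ℝ (Fin d)))
    (Ω₀ : Set Ω) (c c' : ℝ → ℝ → ℝ) (γ : ℝ → ℝ)
    (t : ℝ) (x : EuclideanSpace ℝ (Fin d)) : Prop :=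
  ∃ (h : Ω → ℝ) (Q : ℝ → Ω → EuclideanSpace ℝ (Fin d)),
    Measurable h ∧ (∀ ω, 0 < h ω) ∧ (∀ s ∈ Icc t T, Measurable (Q s)) ∧
    ∀ ω ∈ Ω₀,
      (∀ R > 0, ‖x‖ ≤ R →
        ∀ s ∈ Icc t (min (t + h ω) T),
          (∀ τ ∈ Icc t (min (t + h ω) T),
            ‖Q s ω - Q τ ω‖ ≤ c R (Lam α T fun r => B r ω) * |s - τ| ^ (1 - α)) ∧
          ‖Q s ω‖ ≤ c' R (Lam α T fun r => B r ω) * |s - t| ^ (1 + γ R)) ∧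
      ∀ s ∈ Icc t (min (t + h ω) T),
        x + (s - t) • b t x + WithLp.toLp 2 (σ t x *ᵥ (B s ω - B t ω).ofLp) + Q s ω ∈ K s

/-- At every `(t,x)` with `t ∈ [0,T]`, `x ∈ K(t)`, the pair `(b(t,x), σ(t,x))` is
`(1-α)`-fractional `B`-contingent to `K(t)`; the exceptional null set and the constants do not
depend on `(t,x)`. -/
def Contingent {Ω : Type*} [MeasurableSpace Ω] (P : Measure Ω) {d k : ℕ} (α T : ℝ)
    (b : ℝ → EuclideanSpace ℝ (Fin d) → EuclideanSpace ℝ (Fin d))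
    (σ : ℝ → EuclideanSpace ℝ (Fin d) → Matrix (Fin d) (Fin k) ℝ)
    (B : ℝ → Ω → EuclideanSpace ℝ (Fin k)) (K : ℝ → Set (EuclideanSpace ℝ (Fin d))) : Prop :=
  ∃ (Ω₀ : Set Ω) (c c' : ℝ → ℝ → ℝ) (γ : ℝ → ℝ),
    (∀ᵐ ω ∂P, ω ∈ Ω₀) ∧
    (∀ R > 0, Measurable (c R) ∧ Measurable (c' R) ∧
      (∀ v, 0 < c R v ∧ 0 < c' R v) ∧ 0 < γ R ∧ γ R < 1) ∧
    ∀ t ∈ Icc 0 T, ∀ x ∈ K t, ContingentAt α T b σ B K Ω₀ c c' γ t x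

/-- The tube `K` is closed from the left: limits of points `yₙ ∈ K(uₙ)` along times `uₙ < t`
tending to `t` belong to `K(t)`. -/
def LeftClosed {d : ℕ} (T : ℝ) (K : ℝ → Set (EuclideanSpace ℝ (Fin d))) : Prop :=
  ∀ t ∈ Icc 0 T, ∀ (y : EuclideanSpace ℝ (Fin d)) (u : ℕ → ℝ)
    (v : ℕ → EuclideanSpace ℝ (Fin d)),
    (∀ n, u n ∈ Ico 0 t) → (∀ n, v n ∈ K (u n)) →
    Tendsto u atTop (𝓝 t) → Tendsto v atTop (𝓝 y) → y ∈ K t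

end FracViability

end

/-! The equation is solved path by path, so that viability becomes a property of a deterministic
flow. Probability enters only through measurability and through the fact that almost every path of
`B` is Hölder of some order above `1 - α` (`IsVectorFBM.ae_driver`).

The analytic core is the expansion `HolderOn.abs_stieltjes_sub_le`: for `f` Hölder of order `a > α`,
the integral over `[t,s]` differs from `f t * (g s - g t)` by at most a multiple of `Λ_α(g) (s -
t)^(a + 1 - α)`, and this exponent exceeds 1. The rules of calculus it rests on are not visible in
the definition of the integral, whose Weyl derivatives depend on both endpoints. They come by
approximation: for `C¹` functions the integral is `∫ f g'` (`HasC1Deriv.stieltjes_eq`, a fractional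
inversion resting on the beta integral), Steklov means keep the Hölder constants, and the integral
is continuous under pointwise convergence with uniform Hölder constants (`tendsto_stieltjes`).

Along a `(1-α)`-Hölder path the entries of `σ` are Hölder of order `expo α β δ`, and `α < α₀` makes
this larger than `α`. On an interval of length `ε` the right hand side of the equation then carries
a factor `ε ^ expo α β δ` in front of the Hölder constant of the path (`Regular.exists_incr_bound`,
`Regular.exists_incr_sub_bound`). Small `ε` gives existence, uniqueness and a flow that is locally
Lipschitz in the starting point, with constants depending only on a radius and a bound for `Λ_α(g)`.
The flow differs from one Euler step by `O((s - t)^(1 + gain))` (`Regular.exists_remainder_bound`).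

Contingency implies viability by a Nagumo argument (`Regular.flow_mem`): contingency puts a point of
the tube within `o(e)` of the flow after time `e`, the Lipschitz flow transports this error to the
final time, and left-closedness lets the construction pass through limit times. The solution so
found is measurable as a limit of Euler schemes.

Conversely, uniqueness identifies viable solutions with the flow. Invariance on a countable dense
subset of the graph of `K` holds off one null set and extends to the whole graph by continuity of
the flow (`Regular.ae_flow_mem_of_viable`). Contingency then holds with `Q` the flow minus the Euler
step. Left-closedness follows because solutions started just before `t` have hardly moved at time
`t`. -/

open MeasureTheory ProbabilityTheory Set Filter Topology
open scoped Matrix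

noncomputable section

namespace FracViability

/-! ### Global Hölder bounds and integrals with a power singularity -/

/-- `f` is Hölder continuous on the whole line, with constant `C` and exponent `a`. -/
def HolderC {F : Type*} [NormedAddCommGroup F] (C a : ℝ) (f : ℝ → F) : Prop :=
  ∀ x y, ‖f x - f y‖ ≤ C * |x - y| ^ a

section Holder

variable {F : Type*} [NormedAddCommGroup F] {C a : ℝ} {f : ℝ → F}

lemma HolderC.nonneg (h : HolderC C a f) : 0 ≤ C := by
  have := (norm_nonneg _).trans (h 1 0)
  simpa using this

lemma HolderC.continuous (h : HolderC C a f) (ha : 0 < a) : Continuous f := by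
  rw [continuous_iff_continuousAt]
  intro x
  rw [ContinuousAt, tendsto_iff_norm_sub_tendsto_zero]
  have h2 : Tendsto (fun y => C * |y - x| ^ a) (𝓝 x) (𝓝 0) := by
    have : Continuous fun y : ℝ => C * |y - x| ^ a :=
      continuous_const.mul ((continuous_id.sub continuous_const).abs.rpow_const
        (fun _ => Or.inr ha.le))
    have h3 := this.tendsto x
    simpa [Real.zero_rpow ha.ne'] using h3
  exact squeeze_zero (fun _ => norm_nonneg _) (fun y => h y x) h2

end Holder

/-- The oriented integral is a difference of two integrals over the whole line of `F` cut off to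
fixed planar sets, where measurability of partial integrals applies. -/
lemma measurable_intervalIntegral_right {F : ℝ → ℝ → ℝ}
    (hF : Measurable (Function.uncurry F)) (t : ℝ) :
    Measurable fun r => ∫ y in t..r, F r y := by
  have key : ∀ S : Set (ℝ × ℝ), MeasurableSet S →
      Measurable fun r => ∫ y, S.indicator (Function.uncurry F) (r, y) := fun S hS =>
    ((hF.indicator hS).stronglyMeasurable.integral_prod_right').measurable
  have h1 : MeasurableSet {p : ℝ × ℝ | t < p.2 ∧ p.2 ≤ p.1} :=
    (measurableSet_lt measurable_const measurable_snd).inter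
      (measurableSet_le measurable_snd measurable_fst)
  have h2 : MeasurableSet {p : ℝ × ℝ | p.1 < p.2 ∧ p.2 ≤ t} :=
    (measurableSet_lt measurable_fst measurable_snd).inter
      (measurableSet_le measurable_snd measurable_const)
  convert (key _ h1).sub (key _ h2) using 1
  ext r
  simp only [intervalIntegral, Pi.sub_apply]
  rw [← integral_indicator measurableSet_Ioc, ← integral_indicator measurableSet_Ioc]
  rfl

lemma measurable_intervalIntegral_left {F : ℝ → ℝ → ℝ}
    (hF : Measurable (Function.uncurry F)) (s : ℝ) :
    Measurable fun r => ∫ y in r..s, F r y := by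
  simp_rw [intervalIntegral.integral_symm s]
  exact (measurable_intervalIntegral_right hF s).neg

lemma intervalIntegrable_sub_rpow {e : ℝ} (he : -1 < e) (t r c : ℝ) :
    IntervalIntegrable (fun y => (c - y) ^ e) volume t r := by
  have := (intervalIntegral.intervalIntegrable_rpow' (a := c - t) (b := c - r) he).comp_sub_left c
  simpa using this

lemma intervalIntegrable_rpow_sub {e : ℝ} (he : -1 < e) (r s c : ℝ) :
    IntervalIntegrable (fun y => (y - c) ^ e) volume r s := by
  have := (intervalIntegral.intervalIntegrable_rpow' (a := r - c) (b := s - c) he).comp_sub_right c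
  simpa using this

lemma integral_sub_rpow {e : ℝ} (he : -1 < e) (t r : ℝ) :
    ∫ y in t..r, (r - y) ^ e = (r - t) ^ (e + 1) / (e + 1) := by
  rw [intervalIntegral.integral_comp_sub_left (fun y => y ^ e) r, integral_rpow (Or.inl he)]
  rw [sub_self, Real.zero_rpow (by linarith), sub_zero]

lemma integral_rpow_sub {e : ℝ} (he : -1 < e) (r s : ℝ) :
    ∫ y in r..s, (y - r) ^ e = (s - r) ^ (e + 1) / (e + 1) := by
  rw [intervalIntegral.integral_comp_sub_right (fun y => y ^ e) r, integral_rpow (Or.inl he)]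
  rw [sub_self, Real.zero_rpow (by linarith), sub_zero]

/-! ### Bounds, measurability and convergence of the Weyl derivatives -/

section Weyl

variable {α a l C t r s : ℝ}

lemma leftWeyl_integrand_bound {f : ℝ → ℝ} (hf : HolderC C a f) {y : ℝ} (hy : y < r) :
    ‖(f r - f y) / (r - y) ^ (α + 1)‖ ≤ C * (r - y) ^ (a - α - 1) := by
  have h0 : 0 < r - y := sub_pos.2 hy
  have := hf r y
  rw [abs_of_pos h0] at this
  rw [norm_div, Real.norm_of_nonneg (Real.rpow_nonneg h0.le _), div_le_iff₀ (by positivity),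
    mul_assoc, ← Real.rpow_add h0]
  rwa [show a - α - 1 + (α + 1) = a by ring]

lemma rightWeyl_integrand_bound {F : Type*} [NormedAddCommGroup F] [NormedSpace ℝ F]
    {g : ℝ → F} (hg : HolderC C l g) {y : ℝ} (hy : r < y) :
    ‖(1 / (y - r) ^ (2 - α)) • (g r - g y)‖ ≤ C * (y - r) ^ (l - 2 + α) := by
  have h0 : 0 < y - r := sub_pos.2 hy
  have := hg r y
  rw [abs_sub_comm, abs_of_pos h0] at this
  rw [norm_smul, norm_div, norm_one, Real.norm_of_nonneg (Real.rpow_nonneg h0.le _), one_div,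
    ← Real.rpow_neg h0.le]
  calc _ ≤ (y - r) ^ (-(2 - α)) * (C * (y - r) ^ l) := by gcongr
    _ = C * ((y - r) ^ (-(2 - α)) * (y - r) ^ l) := by ring
    _ = _ := by rw [← Real.rpow_add h0]; congr 2; ring

/-- Only the boundary term is singular at `t`, like `(r - t) ^ (-α)`, which is integrable. The
integral term is finite because `a > α`. -/
lemma leftWeyl_bound {f : ℝ → ℝ} (hf : HolderC C a f) (hα : 0 < α) (hα1 : α < 1) (ha : α < a)
    (hr : t < r) :
    |leftWeyl α t f r| ≤ 1 / Real.Gamma (1 - α) *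
      (|f r| * (r - t) ^ (-α) + α * (C * ((r - t) ^ (a - α) / (a - α)))) := by
  have h0 : 0 < r - t := sub_pos.2 hr
  have hG : 0 < Real.Gamma (1 - α) := Real.Gamma_pos_of_pos (by linarith)
  rw [leftWeyl, abs_mul, abs_of_pos (one_div_pos.2 hG)]
  gcongr
  refine (abs_add_le _ _).trans (add_le_add ?_ ?_)
  · rw [abs_div, abs_of_nonneg (Real.rpow_nonneg h0.le α), Real.rpow_neg h0.le, div_eq_mul_inv]
  · rw [abs_mul, abs_of_pos hα]
    gcongr
    have h1 : ∫ y in t..r, C * (r - y) ^ (a - α - 1) = C * ((r - t) ^ (a - α) / (a - α)) := by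
      rw [intervalIntegral.integral_const_mul, integral_sub_rpow (by linarith)]
      simp
    rw [← h1, ← Real.norm_eq_abs]
    apply intervalIntegral.norm_integral_le_of_norm_le hr.le
    · filter_upwards [compl_mem_ae_iff.2 (measure_singleton r)] with y hy hy2
      exact leftWeyl_integrand_bound hf (lt_of_le_of_ne hy2.2 hy)
    · exact (intervalIntegrable_sub_rpow (by linarith) _ _ _).const_mul C

/-- The condition `l > 1 - α` makes every exponent `l - 1 + α` positive, so the right derivative is
bounded up to `r = s`. -/
lemma rightWeyl_bound {F : Type*} [NormedAddCommGroup F] [NormedSpace ℝ F]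
    {g : ℝ → F} (hg : HolderC C l g) (hα : 0 < α) (hα1 : α < 1) (hl : 1 - α < l) (hr : r < s) :
    ‖rightWeyl α s g r‖ ≤ 1 / Real.Gamma α * (C * (s - r) ^ (l - 1 + α) +
      (1 - α) * (C * ((s - r) ^ (l - 1 + α) / (l - 1 + α)))) := by
  have h0 : 0 < s - r := sub_pos.2 hr
  have hG : 0 < Real.Gamma α := Real.Gamma_pos_of_pos (by linarith)
  rw [rightWeyl, norm_smul, Real.norm_of_nonneg (one_div_pos.2 hG).le]
  gcongr
  refine (norm_add_le _ _).trans (add_le_add ?_ ?_)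
  · have := hg r s
    rw [abs_sub_comm, abs_of_pos h0] at this
    rw [norm_smul, norm_div, norm_one, Real.norm_of_nonneg (Real.rpow_nonneg h0.le _), one_div,
      ← Real.rpow_neg h0.le]
    calc _ ≤ (s - r) ^ (-(1 - α)) * (C * (s - r) ^ l) := by gcongr
      _ = C * ((s - r) ^ (-(1 - α)) * (s - r) ^ l) := by ring
      _ = _ := by rw [← Real.rpow_add h0]; congr 2; ring
  · rw [norm_smul, Real.norm_of_nonneg (by linarith)]
    refine mul_le_mul_of_nonneg_left ?_ (by linarith)
    have h1 : ∫ y in r..s, C * (y - r) ^ (l - 2 + α) =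
        C * ((s - r) ^ (l - 1 + α) / (l - 1 + α)) := by
      rw [intervalIntegral.integral_const_mul, integral_rpow_sub (by linarith),
        show l - 2 + α + 1 = l - 1 + α by ring]
    rw [← h1]
    apply intervalIntegral.norm_integral_le_of_norm_le hr.le
    · exact Eventually.of_forall fun y hy => rightWeyl_integrand_bound hg hy.1
    · exact (intervalIntegrable_rpow_sub (by linarith) _ _ _).const_mul C

lemma measurable_leftWeyl {f : ℝ → ℝ} (hf : Measurable f) : Measurable (leftWeyl α t f) := by
  unfold leftWeyl
  refine Measurable.const_mul (Measurable.add (by fun_prop) (Measurable.const_mul ?_ _)) _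
  apply measurable_intervalIntegral_right (F := fun r y => (f r - f y) / (r - y) ^ (α + 1))
  unfold Function.uncurry
  fun_prop

lemma measurable_rightWeyl {g : ℝ → ℝ} (hg : Measurable g) : Measurable (rightWeyl α s g) := by
  unfold rightWeyl
  simp only [smul_eq_mul]
  refine Measurable.const_mul (Measurable.add (by fun_prop) (Measurable.const_mul ?_ _)) _
  apply measurable_intervalIntegral_left (F := fun r y => 1 / (y - r) ^ (2 - α) * (g r - g y))
  unfold Function.uncurry
  fun_prop

lemma tendsto_leftWeyl {f : ℝ → ℝ} {fn : ℕ → ℝ → ℝ} (hfn : ∀ n, HolderC C a (fn n))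
    (hlim : ∀ x, Tendsto (fun n => fn n x) atTop (𝓝 (f x))) (ha0 : 0 < a) (ha : α < a)
    (hr : t < r) :
    Tendsto (fun n => leftWeyl α t (fn n) r) atTop (𝓝 (leftWeyl α t f r)) := by
  unfold leftWeyl
  refine Tendsto.const_mul _ (Tendsto.add ((hlim r).div_const _) (Tendsto.const_mul _ ?_))
  apply intervalIntegral.tendsto_integral_filter_of_dominated_convergence
    (fun y => C * (r - y) ^ (a - α - 1))
  · refine Eventually.of_forall fun n => Measurable.aestronglyMeasurable ?_
    have := ((hfn n).continuous ha0).measurable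
    fun_prop
  · refine Eventually.of_forall fun n => ?_
    filter_upwards [compl_mem_ae_iff.2 (measure_singleton r)] with y hy hy2
    rw [uIoc_of_le hr.le] at hy2
    exact leftWeyl_integrand_bound (hfn n) (lt_of_le_of_ne hy2.2 hy)
  · exact (intervalIntegrable_sub_rpow (by linarith) _ _ _).const_mul C
  · exact Eventually.of_forall fun y _ => ((hlim r).sub (hlim y)).div_const _

lemma tendsto_rightWeyl {g : ℝ → ℝ} {gn : ℕ → ℝ → ℝ} (hgn : ∀ n, HolderC C l (gn n))
    (hlim : ∀ x, Tendsto (fun n => gn n x) atTop (𝓝 (g x))) (hl0 : 0 < l) (hl : 1 - α < l)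
    (hr : r < s) :
    Tendsto (fun n => rightWeyl α s (gn n) r) atTop (𝓝 (rightWeyl α s g r)) := by
  unfold rightWeyl
  refine Tendsto.const_smul (Tendsto.add (((hlim r).sub (hlim s)).const_smul _)
    (Tendsto.const_smul ?_ _)) _
  apply intervalIntegral.tendsto_integral_filter_of_dominated_convergence
    (fun y => C * (y - r) ^ (l - 2 + α))
  · refine Eventually.of_forall fun n => Measurable.aestronglyMeasurable ?_
    have := ((hgn n).continuous hl0).measurable
    fun_prop
  · refine Eventually.of_forall fun n => Eventually.of_forall fun y hy => ?_
    rw [uIoc_of_le hr.le] at hy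
    exact rightWeyl_integrand_bound (hgn n) hy.1
  · exact (intervalIntegrable_rpow_sub (by linarith) _ _ _).const_mul C
  · exact Eventually.of_forall fun y _ => ((hlim r).sub (hlim y)).const_smul _

/-- Dominated convergence twice: inside each Weyl derivative, and in the outer integral with
majorant `(r - t) ^ (-α)` times a constant plus a constant. Pointwise convergence suffices because
the Hölder constants do not depend on `n`. -/
theorem tendsto_stieltjes {f g : ℝ → ℝ} {fn gn : ℕ → ℝ → ℝ} {D : ℝ}
    (hfn : ∀ n, HolderC C a (fn n)) (hflim : ∀ x, Tendsto (fun n => fn n x) atTop (𝓝 (f x)))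
    (hgn : ∀ n, HolderC D l (gn n)) (hglim : ∀ x, Tendsto (fun n => gn n x) atTop (𝓝 (g x)))
    (hα : 0 < α) (hα1 : α < 1) (ha : α < a) (hl : 1 - α < l) (hts : t ≤ s) :
    Tendsto (fun n => stieltjes α t s (fn n) (gn n)) atTop (𝓝 (stieltjes α t s f g)) := by
  obtain ⟨M, hM⟩ : ∃ M, ∀ n, |fn n t| ≤ M := by
    obtain ⟨M, hM⟩ := (hflim t).abs.bddAbove_range
    exact ⟨M, fun n => hM ⟨n, rfl⟩⟩
  have hC : 0 ≤ C := (hfn 0).nonneg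
  have hD : 0 ≤ D := (hgn 0).nonneg
  have hG : 0 < Real.Gamma (1 - α) := Real.Gamma_pos_of_pos (by linarith)
  have hG' : 0 < Real.Gamma α := Real.Gamma_pos_of_pos (by linarith)
  set M1 := M + C * (s - t) ^ a
  set B1 := fun r => 1 / Real.Gamma (1 - α) *
      (M1 * (r - t) ^ (-α) + α * (C * ((s - t) ^ (a - α) / (a - α))))
  set B2 := 1 / Real.Gamma α * (D * (s - t) ^ (l - 1 + α) +
      (1 - α) * (D * ((s - t) ^ (l - 1 + α) / (l - 1 + α))))
  unfold stieltjes
  apply Tendsto.neg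
  have hne : ∀ᵐ r : ℝ, r ≠ s := compl_mem_ae_iff.2 (measure_singleton s)
  apply intervalIntegral.tendsto_integral_filter_of_dominated_convergence
    (fun r => B1 r * B2)
  · refine Eventually.of_forall fun n => Measurable.aestronglyMeasurable ?_
    exact (measurable_leftWeyl ((hfn n).continuous (by linarith)).measurable).mul
      (measurable_rightWeyl ((hgn n).continuous (by linarith)).measurable)
  · refine Eventually.of_forall fun n => ?_
    filter_upwards [hne] with r hrs hr
    rw [uIoc_of_le hts] at hr
    have hrs' : r < s := lt_of_le_of_ne hr.2 hrs
    have h1 : 0 < r - t := sub_pos.2 hr.1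
    have h2 : 0 < s - r := sub_pos.2 hrs'
    have ha' : 0 < a - α := sub_pos.2 ha
    have hl' : 0 < l - 1 + α := by linarith
    have hα1' : 0 < 1 - α := by linarith
    rw [norm_mul]
    have hB2 : ‖rightWeyl α s (gn n) r‖ ≤ B2 := by
      refine (rightWeyl_bound (hgn n) hα hα1 hl hrs').trans ?_
      simp only [B2]
      have : s - r ≤ s - t := by linarith [hr.1]
      gcongr
    have hB1 : ‖leftWeyl α t (fn n) r‖ ≤ B1 r := by
      refine (leftWeyl_bound (hfn n) hα hα1 ha hr.1).trans ?_
      simp only [B1]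
      gcongr
      · have h3 := hfn n r t
        have h4 : ‖fn n r‖ ≤ ‖fn n t‖ + ‖fn n r - fn n t‖ := by
          have := norm_add_le (fn n t) (fn n r - fn n t)
          simpa using this
        refine h4.trans (add_le_add (hM n) (h3.trans ?_))
        rw [abs_of_pos h1]
        gcongr
        · linarith
    exact mul_le_mul hB1 hB2 (norm_nonneg _) ((norm_nonneg _).trans hB1)
  · refine IntervalIntegrable.mul_const (IntervalIntegrable.const_mul (IntervalIntegrable.add
      ?_ intervalIntegrable_const) _) _
    exact (intervalIntegrable_rpow_sub (by linarith) _ _ _).const_mul _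
  · filter_upwards [hne] with r hrs hr
    rw [uIoc_of_le hts] at hr
    exact (tendsto_leftWeyl hfn hflim (by linarith) ha hr.1).mul
      (tendsto_rightWeyl hgn hglim (by linarith) hl (lt_of_le_of_ne hr.2 hrs))

end Weyl

/-! ### The generalized Stieltjes integral of continuously differentiable functions -/

/-- A scaled beta integral with parameters `1 - α` and `α`. They sum to 1, so the power of `u - v`
disappears and the value does not depend on the interval. -/
lemma integral_beta_kernel {α v u : ℝ} (hα : 0 < α) (hα1 : α < 1) (hvu : v < u) :
    ∫ r in v..u, (r - v) ^ (-α) * (u - r) ^ (α - 1) = Real.Gamma α * Real.Gamma (1 - α) := by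
  have h1 : ∫ r in v..u, (r - v) ^ (-α) * (u - r) ^ (α - 1) =
      ∫ x in (0 : ℝ)..(u - v), x ^ (-α) * ((u - v) - x) ^ (α - 1) := by
    have := intervalIntegral.integral_comp_sub_right (a := v) (b := u)
      (fun x => x ^ (-α) * ((u - v) - x) ^ (α - 1)) v
    rw [sub_self] at this
    rw [← this]
    congr 1
    ext r
    congr 2
    ring
  have h0 : 0 < u - v := sub_pos.2 hvu
  rw [h1]
  have h2 := Complex.betaIntegral_scaled ((1 - α : ℝ) : ℂ) (α : ℂ) h0
  rw [Complex.betaIntegral_eq_Gamma_mul_div _ _ (by simpa using hα1) (by simpa using hα)] at h2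
  apply Complex.ofReal_injective
  rw [← intervalIntegral.integral_ofReal]
  have h3 : ∫ x in (0 : ℝ)..(u - v), ((x ^ (-α) * ((u - v) - x) ^ (α - 1) : ℝ) : ℂ) =
      ∫ x in (0 : ℝ)..(u - v), (x : ℂ) ^ (((1 - α : ℝ) : ℂ) - 1) *
        (((u - v : ℝ) : ℂ) - x) ^ ((α : ℂ) - 1) := by
    apply intervalIntegral.integral_congr
    intro x hx
    rw [uIcc_of_le h0.le] at hx
    simp only
    rw [Complex.ofReal_mul, Complex.ofReal_cpow hx.1, Complex.ofReal_cpow (by linarith [hx.2])]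
    congr 2 <;> push_cast <;> ring
  have h4 : ((1 - α : ℝ) : ℂ) + α = 1 := by push_cast; ring
  rw [h3, h2, Complex.Gamma_ofReal, Complex.Gamma_ofReal, h4]
  simp [mul_comm]

/-- A non-integrable function has integral 0 by convention, and the value just computed is positive.
-/
lemma intervalIntegrable_beta_kernel {α v u : ℝ} (hα : 0 < α) (hα1 : α < 1) (hvu : v < u) :
    IntervalIntegrable (fun r => (r - v) ^ (-α) * (u - r) ^ (α - 1)) volume v u := by
  apply intervalIntegral.intervalIntegrable_of_integral_ne_zero
  rw [integral_beta_kernel hα hα1 hvu]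
  exact (mul_pos (Real.Gamma_pos_of_pos hα) (Real.Gamma_pos_of_pos (by linarith))).ne'

/-! ### Fubini's theorem over a triangle -/

lemma integral_triangle_aux {F : ℝ → ℝ → ℝ} {t s : ℝ} (r : ℝ) :
    ∫ v, {p : ℝ × ℝ | t < p.2 ∧ p.2 < p.1 ∧ p.1 < s}.indicator (Function.uncurry F) (r, v) =
      (Ioo t s).indicator (fun r => ∫ v in t..r, F r v) r := by
  by_cases hr : r ∈ Ioo t s
  · rw [indicator_of_mem hr, intervalIntegral.integral_of_le hr.1.le, integral_Ioc_eq_integral_Ioo,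
      ← integral_indicator measurableSet_Ioo]
    congr 1
    ext v
    simp only [indicator, mem_ofPred_eq, mem_Ioo, hr.2, and_true, Function.uncurry]
  · rw [indicator_of_notMem hr]
    rw [integral_eq_zero_of_ae]
    refine Eventually.of_forall fun v => indicator_of_notMem ?_ _
    rintro ⟨h1, h2, h3⟩
    exact hr ⟨h1.trans h2, h3⟩

lemma integral_triangle_aux' {F : ℝ → ℝ → ℝ} {t s : ℝ} (v : ℝ) :
    ∫ r, {p : ℝ × ℝ | t < p.2 ∧ p.2 < p.1 ∧ p.1 < s}.indicator (Function.uncurry F) (r, v) =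
      (Ioo t s).indicator (fun v => ∫ r in v..s, F r v) v := by
  by_cases hr : v ∈ Ioo t s
  · rw [indicator_of_mem hr, intervalIntegral.integral_of_le hr.2.le, integral_Ioc_eq_integral_Ioo,
      ← integral_indicator measurableSet_Ioo]
    congr 1
    ext v
    simp only [indicator, mem_ofPred_eq, mem_Ioo, hr.1, true_and, Function.uncurry]
  · rw [indicator_of_notMem hr]
    rw [integral_eq_zero_of_ae]
    refine Eventually.of_forall fun r => indicator_of_notMem ?_ _
    rintro ⟨h1, h2, h3⟩
    exact hr ⟨h1, h2.trans h3⟩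

lemma integral_triangle_swap {F : ℝ → ℝ → ℝ} {t s : ℝ} (hts : t ≤ s)
    (hF : Integrable ({p : ℝ × ℝ | t < p.2 ∧ p.2 < p.1 ∧ p.1 < s}.indicator (Function.uncurry F))
      (volume.prod volume)) :
    ∫ r in t..s, ∫ v in t..r, F r v = ∫ v in t..s, ∫ r in v..s, F r v := by
  have h := integral_integral_swap
    (f := fun r v => {p : ℝ × ℝ | t < p.2 ∧ p.2 < p.1 ∧ p.1 < s}.indicator
      (Function.uncurry F) (r, v)) hF
  simp_rw [integral_triangle_aux, integral_triangle_aux'] at h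
  rwa [integral_indicator measurableSet_Ioo, integral_indicator measurableSet_Ioo,
    ← integral_Ioc_eq_integral_Ioo, ← integral_Ioc_eq_integral_Ioo,
    ← intervalIntegral.integral_of_le hts, ← intervalIntegral.integral_of_le hts] at h

lemma intervalIntegrable_triangle {F : ℝ → ℝ → ℝ} {t s : ℝ} (hts : t ≤ s)
    (hF : Integrable ({p : ℝ × ℝ | t < p.2 ∧ p.2 < p.1 ∧ p.1 < s}.indicator (Function.uncurry F))
      (volume.prod volume)) :
    IntervalIntegrable (fun r => ∫ v in t..r, F r v) volume t s := by
  have h := hF.integral_prod_left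
  simp_rw [integral_triangle_aux] at h
  rw [integrable_indicator_iff measurableSet_Ioo] at h
  rw [intervalIntegrable_iff_integrableOn_Ioo_of_le hts]
  exact h

/-- Integrability over a triangle, for a function dominated by `w v * |r - v| ^ e`. -/
lemma integrable_triangle {F : ℝ → ℝ → ℝ} (hF : Measurable (Function.uncurry F)) {t s e : ℝ}
    {w : ℝ → ℝ} (hts : t ≤ s) (he : -1 < e) (hw : IntervalIntegrable w volume t s)
    (hb : ∀ v r, t < v → v < r → r < s → |F r v| ≤ w v * (r - v) ^ e) :
    Integrable ({p : ℝ × ℝ | t < p.2 ∧ p.2 < p.1 ∧ p.1 < s}.indicator (Function.uncurry F))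
      (volume.prod volume) := by
  have hS : MeasurableSet {p : ℝ × ℝ | t < p.2 ∧ p.2 < p.1 ∧ p.1 < s} :=
    (measurableSet_lt measurable_const measurable_snd).inter
      ((measurableSet_lt measurable_snd measurable_fst).inter
        (measurableSet_lt measurable_fst measurable_const))
  have h1 : Integrable ((Ioo t s).indicator w) :=
    (integrable_indicator_iff measurableSet_Ioo).2
      ((intervalIntegrable_iff_integrableOn_Ioo_of_le hts).1 hw)
  have h2 : Integrable ((Ioo 0 (s - t)).indicator fun z : ℝ => z ^ e) :=
    (integrable_indicator_iff measurableSet_Ioo).2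
      ((intervalIntegrable_iff_integrableOn_Ioo_of_le (by linarith)).1
        (intervalIntegral.intervalIntegrable_rpow' he))
  -- The majorant is the integrand of the convolution of `w` cut off to `(t,s)` with `z ^ e` cut off
  -- to `(0, s - t)`, both integrable.
  refine Integrable.mono' (h1.convolution_integrand (ContinuousLinearMap.mul ℝ ℝ) h2)
    (hF.indicator hS).aestronglyMeasurable (Eventually.of_forall ?_)
  rintro ⟨r, v⟩
  by_cases h : (r, v) ∈ {p : ℝ × ℝ | t < p.2 ∧ p.2 < p.1 ∧ p.1 < s}
  · rw [indicator_of_mem h]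
    obtain ⟨h3, h4, h5⟩ := h
    simp only [ContinuousLinearMap.mul_apply'] at *
    rw [indicator_of_mem (show v ∈ Ioo t s from ⟨h3, h4.trans h5⟩),
      indicator_of_mem (show r - v ∈ Ioo 0 (s - t) from ⟨by linarith, by linarith⟩)]
    exact hb v r h3 h4 h5
  · rw [indicator_of_notMem h, norm_zero]
    simp only [ContinuousLinearMap.mul_apply']
    by_cases h3 : v ∈ Ioo t s
    · by_cases h4 : r - v ∈ Ioo 0 (s - t)
      · by_cases h5 : r < s
        · exact absurd ⟨h3.1, by linarith [h4.1], h5⟩ h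
        · rw [indicator_of_mem h3, indicator_of_mem h4]
          refine mul_nonneg ?_ (Real.rpow_nonneg h4.1.le _)
          -- Here the point lies outside the triangle, but the majorant still has to be nonnegative.
          -- The sign of `w v` is read off from `hb` at the midpoint of `v` and `s`.
          have h6 := (abs_nonneg _).trans (hb v ((v + s) / 2) h3.1 (by linarith [h3.2])
            (by linarith [h3.2]))
          have h7 : 0 < ((v + s) / 2 - v) ^ e := Real.rpow_pos_of_pos (by linarith [h3.2]) _
          exact nonneg_of_mul_nonneg_left h6 h7
      · rw [indicator_of_notMem h4, mul_zero]
    · rw [indicator_of_notMem h3, zero_mul]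

/-- `f` has the bounded continuous derivative `f'`. -/
structure HasC1Deriv (f f' : ℝ → ℝ) : Prop where
  hasDerivAt : ∀ x, HasDerivAt f (f' x) x
  cont : Continuous f'
  bdd : ∃ M, ∀ x, |f' x| ≤ M

namespace HasC1Deriv

variable {f f' g g' : ℝ → ℝ} {α t r s u : ℝ}

lemma holder (h : HasC1Deriv f f') : ∃ M, HolderC M 1 f := by
  obtain ⟨M, hM⟩ := h.bdd
  refine ⟨M, fun x y => ?_⟩
  have := Convex.norm_image_sub_le_of_norm_hasDerivWithin_le (f := f) (f' := f') (s := univ)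
    (C := M) (fun x _ => (h.hasDerivAt x).hasDerivWithinAt) (fun x _ => hM x) convex_univ
    (mem_univ y) (mem_univ x)
  simpa using this

lemma continuous (h : HasC1Deriv f f') : Continuous f :=
  continuous_iff_continuousAt.2 fun x => (h.hasDerivAt x).continuousAt

lemma intervalIntegrable_mul_rpow_sub (h : HasC1Deriv f f') {e : ℝ} (he : -1 < e) (a b c : ℝ) :
    IntervalIntegrable (fun y => f' y * (y - c) ^ e) volume a b :=
  (intervalIntegrable_rpow_sub he a b c).continuousOn_mul h.cont.continuousOn

lemma intervalIntegrable_mul_sub_rpow (h : HasC1Deriv f f') {e : ℝ} (he : -1 < e) (a b c : ℝ) :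
    IntervalIntegrable (fun y => f' y * (c - y) ^ e) volume a b :=
  (intervalIntegrable_sub_rpow he a b c).continuousOn_mul h.cont.continuousOn

/-- Integration by parts with the primitive `(f r - f y) (r - y) ^ (-α)`, which vanishes at `y = r`
because `f` is Lipschitz. The result is the Riemann–Liouville form of the derivative. -/
lemma leftWeyl_eq (h : HasC1Deriv f f') (hα1 : α < 1) (hr : t < r) :
    leftWeyl α t f r = 1 / Real.Gamma (1 - α) *
      (f t * (r - t) ^ (-α) + ∫ v in t..r, f' v * (r - v) ^ (-α)) := by
  obtain ⟨M, hM⟩ := h.holder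
  have h0 : 0 < r - t := sub_pos.2 hr
  set F := fun y => (f r - f y) * (r - y) ^ (-α) with hF
  have hFc : ContinuousOn F (Icc t r) := by
    intro y hy
    rcases hy.2.lt_or_eq with hyr | rfl
    · refine ContinuousAt.continuousWithinAt ?_
      refine (continuous_const.sub h.continuous).continuousAt.mul ?_
      exact (continuous_const.sub continuous_id).continuousAt.rpow_const
        (Or.inl (sub_pos.2 hyr).ne')
    · have hFy : F y = 0 := by simp [hF]
      rw [ContinuousWithinAt, hFy]
      have h2 : Tendsto (fun z => M * |y - z| ^ (1 - α)) (𝓝[Icc t y] y) (𝓝 0) := by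
        have : Continuous fun z : ℝ => M * |y - z| ^ (1 - α) :=
          continuous_const.mul ((continuous_const.sub continuous_id).abs.rpow_const
            (fun _ => Or.inr (by linarith)))
        have h3 := (this.tendsto y).mono_left (nhdsWithin_le_nhds (s := Icc t y))
        have h4 : (1 - α) ≠ 0 := by linarith
        simpa [Real.zero_rpow h4] using h3
      refine squeeze_zero_norm' ?_ h2
      filter_upwards [self_mem_nhdsWithin] with z hz
      rcases hz.2.lt_or_eq with hzy | rfl
      · have h4 : 0 < y - z := sub_pos.2 hzy
        have h5 := hM y z
        rw [abs_of_pos h4] at h5 ⊢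
        rw [hF, norm_mul, Real.norm_of_nonneg (Real.rpow_nonneg h4.le _), sub_eq_add_neg 1 α,
          Real.rpow_add h4, ← mul_assoc]
        gcongr
      · rw [hFy, norm_zero]
        exact mul_nonneg hM.nonneg (by positivity)
  have hint1 := h.intervalIntegrable_mul_sub_rpow (show -1 < -α by linarith) t r r
  have hint1n : IntervalIntegrable (fun y => -(f' y * (r - y) ^ (-α))) volume t r := hint1.neg
  have hint2 : IntervalIntegrable (fun y => (f r - f y) / (r - y) ^ (α + 1)) volume t r := by
    refine ((intervalIntegrable_sub_rpow (show -1 < 1 - α - 1 by linarith) t r r).const_mul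
      M).mono_fun' ?_ ?_
    · have := h.continuous.measurable
      exact Measurable.aestronglyMeasurable (by fun_prop)
    · rw [uIoc_of_le hr.le]
      have hne : ∀ᵐ y ∂(volume.restrict (Ioc t r)), y ≠ r :=
        ae_restrict_of_ae (compl_mem_ae_iff.2 (measure_singleton r))
      filter_upwards [hne, ae_restrict_mem measurableSet_Ioc] with y hy hy2
      exact leftWeyl_integrand_bound hM (lt_of_le_of_ne hy2.2 hy)
  have hd : ∀ y ∈ Ioo t r, HasDerivAt F
      (-(f' y * (r - y) ^ (-α)) + α * ((f r - f y) / (r - y) ^ (α + 1))) y := by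
    intro y hy
    have h4 : 0 < r - y := sub_pos.2 hy.2
    have h5 := ((hasDerivAt_const y (f r)).sub (h.hasDerivAt y)).mul
      (((hasDerivAt_const y r).sub (hasDerivAt_id y)).rpow_const (p := -α) (Or.inl h4.ne'))
    have h6 : HasDerivAt F ((0 - f' y) * (r - y) ^ (-α) +
        (f r - f y) * ((0 - 1) * -α * (r - y) ^ (-α - 1))) y := h5
    refine h6.congr_deriv ?_
    rw [show -α - 1 = -(α + 1) by ring, Real.rpow_neg h4.le (α + 1), div_eq_mul_inv]
    ring
  have key := intervalIntegral.integral_eq_sub_of_hasDerivAt_of_le hr.le hFc hd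
    (hint1.neg.add (hint2.const_mul α))
  rw [intervalIntegral.integral_add hint1n (hint2.const_mul α),
    intervalIntegral.integral_neg, intervalIntegral.integral_const_mul] at key
  have hFr : F r = 0 := by simp [hF]
  have hFt : F t = (f r - f t) * (r - t) ^ (-α) := rfl
  rw [hFr, hFt] at key
  rw [leftWeyl, div_eq_mul_inv (f r), ← Real.rpow_neg h0.le]
  congr 1
  linear_combination key

/-- The mirror image of `leftWeyl_eq`, with primitive `(g r - g y) (y - r) ^ (α - 1)`. The boundary
term at `s` cancels, so only `g'` remains. -/
lemma rightWeyl_eq (h : HasC1Deriv g g') (hα : 0 < α) (hr : r < s) :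
    rightWeyl α s g r = -(1 / Real.Gamma α * ∫ u in r..s, g' u * (u - r) ^ (α - 1)) := by
  obtain ⟨M, hM⟩ := h.holder
  have h0 : 0 < s - r := sub_pos.2 hr
  set F := fun y => (g r - g y) * (y - r) ^ (α - 1) with hF
  have hFc : ContinuousOn F (Icc r s) := by
    intro y hy
    rcases hy.1.lt_or_eq with hyr | rfl
    · refine ContinuousAt.continuousWithinAt ?_
      refine (continuous_const.sub h.continuous).continuousAt.mul ?_
      exact (continuous_id.sub continuous_const).continuousAt.rpow_const
        (Or.inl (sub_pos.2 hyr).ne')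
    · have hFy : F r = 0 := by simp [hF]
      rw [ContinuousWithinAt, hFy]
      have h2 : Tendsto (fun z => M * |r - z| ^ α) (𝓝[Icc r s] r) (𝓝 0) := by
        have : Continuous fun z : ℝ => M * |r - z| ^ α :=
          continuous_const.mul ((continuous_const.sub continuous_id).abs.rpow_const
            (fun _ => Or.inr (by linarith)))
        have h3 := (this.tendsto r).mono_left (nhdsWithin_le_nhds (s := Icc r s))
        simpa [Real.zero_rpow hα.ne'] using h3
      refine squeeze_zero_norm' ?_ h2
      filter_upwards [self_mem_nhdsWithin] with z hz
      rcases hz.1.lt_or_eq with hzy | rfl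
      · have h4 : 0 < z - r := sub_pos.2 hzy
        have h5 := hM r z
        rw [abs_sub_comm, abs_of_pos h4] at h5 ⊢
        rw [hF, norm_mul, Real.norm_of_nonneg (Real.rpow_nonneg h4.le _)]
        calc _ ≤ M * (z - r) ^ (1 : ℝ) * (z - r) ^ (α - 1) := by gcongr
          _ = M * (z - r) ^ α := by rw [mul_assoc, ← Real.rpow_add h4]; congr 2; ring
      · rw [hFy, norm_zero]
        exact mul_nonneg hM.nonneg (by positivity)
  have hint1 := h.intervalIntegrable_mul_rpow_sub (show -1 < α - 1 by linarith) r s r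
  have hint1n : IntervalIntegrable (fun y => -(g' y * (y - r) ^ (α - 1))) volume r s := hint1.neg
  have hint2 : IntervalIntegrable (fun y => (1 / (y - r) ^ (2 - α)) • (g r - g y))
      volume r s := by
    refine ((intervalIntegrable_rpow_sub (show -1 < 1 - 2 + α by linarith) r s r).const_mul
      M).mono_fun' ?_ ?_
    · have := h.continuous.measurable
      exact Measurable.aestronglyMeasurable (by fun_prop)
    · rw [uIoc_of_le hr.le]
      filter_upwards [ae_restrict_mem measurableSet_Ioc] with y hy
      exact rightWeyl_integrand_bound hM hy.1
  have hd : ∀ y ∈ Ioo r s, HasDerivAt F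
      (-(g' y * (y - r) ^ (α - 1)) + (-(1 - α)) * ((1 / (y - r) ^ (2 - α)) • (g r - g y))) y := by
    intro y hy
    have h4 : 0 < y - r := sub_pos.2 hy.1
    have h5 := ((hasDerivAt_const y (g r)).sub (h.hasDerivAt y)).mul
      (((hasDerivAt_id y).sub (hasDerivAt_const y r)).rpow_const (p := α - 1) (Or.inl h4.ne'))
    have h6 : HasDerivAt F ((0 - g' y) * (y - r) ^ (α - 1) +
        (g r - g y) * ((1 - 0) * (α - 1) * (y - r) ^ (α - 1 - 1))) y := h5
    refine h6.congr_deriv ?_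
    rw [smul_eq_mul, show α - 1 - 1 = -(2 - α) by ring, Real.rpow_neg h4.le (2 - α), one_div]
    ring
  have key := intervalIntegral.integral_eq_sub_of_hasDerivAt_of_le hr.le hFc hd
    (hint1.neg.add (hint2.const_mul (-(1 - α))))
  rw [intervalIntegral.integral_add hint1n (hint2.const_mul _),
    intervalIntegral.integral_neg, intervalIntegral.integral_const_mul] at key
  have hFr : F r = 0 := by simp [hF]
  have hFs : F s = (g r - g s) * (s - r) ^ (α - 1) := rfl
  rw [hFr, hFs] at key
  rw [rightWeyl, one_div ((s - r) ^ (1 - α)), ← Real.rpow_neg h0.le, neg_sub, ← mul_neg,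
    smul_eq_mul, smul_eq_mul, smul_eq_mul]
  congr 1
  linear_combination -key

/-- Fractional inversion: the Riemann–Liouville integral of the Weyl derivative of `f` is `f`. -/
lemma integral_leftWeyl_mul (h : HasC1Deriv f f') (hα : 0 < α) (hα1 : α < 1) (htu : t < u) :
    ∫ r in t..u, leftWeyl α t f r * (u - r) ^ (α - 1) = Real.Gamma α * f u := by
  obtain ⟨M, hM⟩ := h.bdd
  have hΓ : 0 < Real.Gamma (1 - α) := Real.Gamma_pos_of_pos (by linarith)
  have hfm := h.cont.measurable
  -- integrate first in the inner variable
  set S : Set (ℝ × ℝ) := {p : ℝ × ℝ | t < p.2 ∧ p.2 < p.1 ∧ p.1 < u}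
  set F : ℝ → ℝ → ℝ := fun r v => f' v * (r - v) ^ (-α) * (u - r) ^ (α - 1) with hFdef
  have hFint : Integrable (S.indicator (Function.uncurry F)) (volume.prod volume) := by
    -- reflect both variables so that the weight sits on the inner variable
    set F' : ℝ → ℝ → ℝ := fun v r => F (t + u - r) (t + u - v)
    have hF'm : Measurable (Function.uncurry F') := by
      simp only [F', hFdef]; fun_prop
    have h1 : Integrable (S.indicator (Function.uncurry F')) (volume.prod volume) := by
      refine integrable_triangle (e := -α) (w := fun r => M * (r - t) ^ (α - 1)) hF'm htu.le
        (by linarith) ((intervalIntegrable_rpow_sub (by linarith) _ _ _).const_mul M) ?_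
      intro r v hr hv hu
      simp only [F', hFdef]
      rw [abs_mul, abs_mul, abs_of_nonneg (Real.rpow_nonneg (by linarith) _),
        abs_of_nonneg (Real.rpow_nonneg (by linarith) _),
        show t + u - r - (t + u - v) = v - r by ring, show u - (t + u - r) = r - t by ring]
      have h5 : 0 ≤ (v - r) ^ (-α) := Real.rpow_nonneg (by linarith) _
      have h6 : 0 ≤ (r - t) ^ (α - 1) := Real.rpow_nonneg (by linarith) _
      calc _ ≤ M * (v - r) ^ (-α) * (r - t) ^ (α - 1) := by gcongr; exact hM _
        _ = _ := by ring
    have h2 := h1.swap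
    have hmp : MeasurePreserving (fun p : ℝ × ℝ => (t + u - p.1, t + u - p.2))
        (volume.prod volume) (volume.prod volume) :=
      (Measure.measurePreserving_sub_left volume (t + u)).prod (Measure.measurePreserving_sub_left volume (t + u))
    have h3 := hmp.integrable_comp_of_integrable h2
    convert h3 using 1
    ext ⟨r, v⟩
    simp only [Function.comp, Prod.swap, indicator, S, mem_ofPred_eq, Function.uncurry, F']
    have : (t < v ∧ v < r ∧ r < u) ↔ (t < t + u - r ∧ t + u - r < t + u - v ∧ t + u - v < u) := by
      constructor <;> rintro ⟨h1, h2, h3⟩ <;> refine ⟨?_, ?_, ?_⟩ <;> linarith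
    simp only [this, sub_sub_cancel]
  have hswap := integral_triangle_swap htu.le hFint
  -- After the swap the inner integral is the beta kernel, a constant, and what remains is `∫ f' = f
  -- u - f t`. The boundary term of `leftWeyl_eq` restores `f t`.
  have hinner : ∫ v in t..u, ∫ r in v..u, F r v =
      ∫ v in t..u, f' v * (Real.Gamma α * Real.Gamma (1 - α)) := by
    apply intervalIntegral.integral_congr_ae
    filter_upwards [compl_mem_ae_iff.2 (measure_singleton u)] with v hv hv2
    rw [uIoc_of_le htu.le] at hv2
    rw [← integral_beta_kernel hα hα1 (lt_of_le_of_ne hv2.2 hv),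
      ← intervalIntegral.integral_const_mul]
    simp only [hFdef, mul_assoc]
  rw [hinner, intervalIntegral.integral_mul_const,
    intervalIntegral.integral_eq_sub_of_hasDerivAt (fun x _ => h.hasDerivAt x)
      (h.cont.intervalIntegrable _ _)] at hswap
  have hsplit : ∫ r in t..u, leftWeyl α t f r * (u - r) ^ (α - 1) =
      ∫ r in t..u, 1 / Real.Gamma (1 - α) *
        (f t * ((r - t) ^ (-α) * (u - r) ^ (α - 1)) + ∫ v in t..r, F r v) := by
    apply intervalIntegral.integral_congr_ae
    refine Eventually.of_forall fun r hr => ?_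
    rw [uIoc_of_le htu.le] at hr
    rw [h.leftWeyl_eq hα1 hr.1]
    simp only [hFdef, intervalIntegral.integral_mul_const]
    ring
  rw [hsplit, intervalIntegral.integral_const_mul, intervalIntegral.integral_add
    ((intervalIntegrable_beta_kernel hα hα1 htu).const_mul _)
    (intervalIntegrable_triangle htu.le hFint), hswap, intervalIntegral.integral_const_mul,
    integral_beta_kernel hα hα1 htu]
  field_simp
  ring

/-- For `C¹` functions the generalized Stieltjes integral is the Riemann–Stieltjes integral. -/
theorem stieltjes_eq (hf : HasC1Deriv f f') (hg : HasC1Deriv g g') (hα : 0 < α) (hα1 : α < 1)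
    (hts : t ≤ s) : stieltjes α t s f g = ∫ u in t..s, f u * g' u := by
  obtain ⟨A, hA⟩ := hf.holder
  obtain ⟨M, hM⟩ := hg.bdd
  have hΓ : 0 < Real.Gamma α := Real.Gamma_pos_of_pos hα
  have hΓ' : 0 < Real.Gamma (1 - α) := Real.Gamma_pos_of_pos (by linarith)
  set F : ℝ → ℝ → ℝ := fun u r => leftWeyl α t f r * (g' u * (u - r) ^ (α - 1)) with hF
  have hFm : Measurable (Function.uncurry F) := by
    have h1 := measurable_leftWeyl (α := α) (t := t) hf.continuous.measurable
    have h2 := hg.cont.measurable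
    simp only [hF]
    fun_prop
  obtain ⟨N, hN⟩ : ∃ N, ∀ r ∈ Icc t s, |f r| ≤ N := by
    obtain ⟨N, hN⟩ := (isCompact_Icc (a := t) (b := s)).exists_bound_of_continuousOn
      hf.continuous.continuousOn
    exact ⟨N, hN⟩
  have hFint : Integrable ({p : ℝ × ℝ | t < p.2 ∧ p.2 < p.1 ∧ p.1 < s}.indicator
      (Function.uncurry F)) (volume.prod volume) := by
    refine integrable_triangle (e := α - 1) (w := fun r => 1 / Real.Gamma (1 - α) *
      (N * (r - t) ^ (-α) + α * (A * ((s - t) ^ (1 - α) / (1 - α)))) * M) hFm hts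
        (by linarith) ?_ ?_
    · refine IntervalIntegrable.mul_const (IntervalIntegrable.const_mul (IntervalIntegrable.add
        ?_ intervalIntegrable_const) _) _
      exact (intervalIntegrable_rpow_sub (by linarith) _ _ _).const_mul _
    · intro r u hr hu hus
      have h1 := leftWeyl_bound hA hα hα1 hα1 hr
      have h2 : |leftWeyl α t f r| ≤ 1 / Real.Gamma (1 - α) *
          (N * (r - t) ^ (-α) + α * (A * ((s - t) ^ (1 - α) / (1 - α)))) := by
        refine h1.trans ?_
        have h3 := hN r ⟨hr.le, by linarith⟩
        have h4 := hA.nonneg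
        have h5 : r - t ≤ s - t := by linarith
        have h6 : 0 < r - t := by linarith
        have h7 : 0 < 1 - α := by linarith
        gcongr
      simp only [hF]
      rw [abs_mul, abs_mul, abs_of_nonneg (Real.rpow_nonneg (by linarith) _), ← mul_assoc]
      have h8 := (abs_nonneg _).trans h2
      have h9 : 0 ≤ (u - r) ^ (α - 1) := Real.rpow_nonneg (by linarith) _
      gcongr
      exact hM u
  -- With the right derivative written through `g'`, exchanging the integrals leaves `leftWeyl`
  -- against `(u - r) ^ (α - 1)`, to which fractional inversion applies.
  have h1 : stieltjes α t s f g = 1 / Real.Gamma α * ∫ r in t..s, ∫ u in r..s, F u r := by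
    rw [stieltjes, ← intervalIntegral.integral_const_mul, ← intervalIntegral.integral_neg]
    apply intervalIntegral.integral_congr_ae
    filter_upwards [compl_mem_ae_iff.2 (measure_singleton s)] with r hr hr2
    rw [uIoc_of_le hts] at hr2
    rw [hg.rightWeyl_eq hα (lt_of_le_of_ne hr2.2 hr)]
    simp only [hF, intervalIntegral.integral_const_mul]
    ring
  rw [h1, ← integral_triangle_swap hts hFint, ← intervalIntegral.integral_const_mul]
  apply intervalIntegral.integral_congr_ae
  refine Eventually.of_forall fun u hu => ?_
  rw [uIoc_of_le hts] at hu
  have h2 : ∫ r in t..u, F u r =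
      g' u * ∫ r in t..u, leftWeyl α t f r * (u - r) ^ (α - 1) := by
    rw [← intervalIntegral.integral_const_mul]
    congr 1
    ext r
    simp only [hF]
    ring
  rw [h2, hf.integral_leftWeyl_mul hα hα1 hu.1]
  field_simp

end HasC1Deriv

/-! ### Steklov means and the algebra of the generalized Stieltjes integral -/

/-- The Steklov mean of `f` over `[x, x + 1/(n+1)]`. -/
def steklov (n : ℕ) (f : ℝ → ℝ) (x : ℝ) : ℝ := ∫ u in (0 : ℝ)..1, f (x + u / (n + 1))

section Steklov

variable {C a : ℝ} {f : ℝ → ℝ}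

/-- A mean of translates keeps the constant `C` itself. This uniformity in `n` is what
`tendsto_stieltjes` requires. -/
lemma HolderC.holder_steklov (hf : HolderC C a f) (ha : 0 < a) (n : ℕ) :
    HolderC C a (steklov n f) := by
  intro x y
  have hc := hf.continuous ha
  unfold steklov
  rw [← intervalIntegral.integral_sub
    (Continuous.intervalIntegrable (by fun_prop) _ _)
    (Continuous.intervalIntegrable (by fun_prop) _ _)]
  have := intervalIntegral.norm_integral_le_of_norm_le_const (a := (0 : ℝ)) (b := 1)
    (C := C * |x - y| ^ a) (f := fun u => f (x + u / (n + 1)) - f (y + u / (n + 1)))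
    (fun u _ => by simpa using hf (x + u / (n + 1)) (y + u / (n + 1)))
  simpa using this

lemma HolderC.tendsto_steklov (hf : HolderC C a f) (ha : 0 < a) (x : ℝ) :
    Tendsto (fun n => steklov n f x) atTop (𝓝 (f x)) := by
  have hc := hf.continuous ha
  rw [tendsto_iff_norm_sub_tendsto_zero]
  have h1 : Tendsto (fun n : ℕ => C * (1 / ((n : ℝ) + 1)) ^ a) atTop (𝓝 0) := by
    have := (tendsto_one_div_add_atTop_nhds_zero_nat (𝕜 := ℝ)).rpow_const (p := a) (Or.inr ha.le)
    rw [Real.zero_rpow ha.ne'] at this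
    simpa using this.const_mul C
  refine squeeze_zero (fun _ => norm_nonneg _) (fun n => ?_) h1
  have h2 : steklov n f x - f x =
      ∫ u in (0 : ℝ)..1, (f (x + u / (n + 1)) - f x) := by
    rw [intervalIntegral.integral_sub (Continuous.intervalIntegrable (by fun_prop) _ _)
      (Continuous.intervalIntegrable (by fun_prop) _ _)]
    simp [steklov]
  rw [h2]
  have := intervalIntegral.norm_integral_le_of_norm_le_const (a := (0 : ℝ)) (b := 1)
    (C := C * (1 / ((n : ℝ) + 1)) ^ a) (f := fun u => f (x + u / (n + 1)) - f x)
    (fun u hu => by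
      rw [uIoc_of_le zero_le_one] at hu
      refine (hf _ _).trans ?_
      have h3 := hf.nonneg
      have h4 : 0 ≤ u / ((n : ℝ) + 1) := div_nonneg hu.1.le (by positivity)
      rw [add_sub_cancel_left, abs_of_nonneg h4]
      gcongr
      exact hu.2)
  simpa using this

/-- After a change of variables the mean is `n + 1` times a difference of two values of a primitive
of `f`. -/
lemma hasC1Deriv_steklov (hf : HolderC C a f) (ha : 0 < a) (n : ℕ) :
    HasC1Deriv (steklov n f) (fun x => (n + 1) * (f (x + 1 / (n + 1)) - f x)) := by
  have hc := hf.continuous ha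
  have hn : (0 : ℝ) < n + 1 := by positivity
  have heq : steklov n f = fun x =>
      (n + 1) * ((∫ v in (0 : ℝ)..x + 1 / (n + 1), f v) - ∫ v in (0 : ℝ)..x, f v) := by
    ext x
    rw [intervalIntegral.integral_interval_sub_left (hc.intervalIntegrable _ _)
      (hc.intervalIntegrable _ _), steklov]
    have := intervalIntegral.integral_comp_add_div (a := (0 : ℝ)) (b := 1) f hn.ne' x
    rw [this]
    simp
  refine ⟨fun x => ?_, by fun_prop, ?_⟩
  · rw [heq]
    have h1 : ∀ y, HasDerivAt (fun y => ∫ v in (0 : ℝ)..y, f v) (f y) y := fun y =>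
      intervalIntegral.integral_hasDerivAt_right (hc.intervalIntegrable _ _)
        (hc.stronglyMeasurableAtFilter _ _) hc.continuousAt
    exact (((h1 _).comp_add_const x (1 / ((n : ℝ) + 1))).sub (h1 x)).const_mul _
  · refine ⟨(n + 1) * (C * (1 / ((n : ℝ) + 1)) ^ a), fun x => ?_⟩
    rw [abs_mul, abs_of_pos hn]
    gcongr
    have := hf (x + 1 / (n + 1)) x
    rwa [add_sub_cancel_left, abs_of_pos (by positivity)] at this

end Steklov

/-! ### Additivity and linearity by approximation with Steklov means -/

section Algebra

variable {α a l C C' D t r s : ℝ} {f f' g : ℝ → ℝ}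

/-- The generalized integral is a limit of ordinary integrals, in which the endpoints and `f` enter
in the usual way. Each rule below is the classical rule followed by uniqueness of limits. -/
lemma tendsto_integral_steklov (hf : HolderC C a f) (hg : HolderC D l g) (hα : 0 < α)
    (hα1 : α < 1) (ha : α < a) (hl : 1 - α < l) (hts : t ≤ s) :
    Tendsto (fun n : ℕ => ∫ u in t..s,
        steklov n f u * ((n + 1) * (g (u + 1 / (n + 1)) - g u))) atTop
      (𝓝 (stieltjes α t s f g)) := by
  have h := tendsto_stieltjes (fun n => hf.holder_steklov (hα.trans ha) n)
    (hf.tendsto_steklov (hα.trans ha)) (fun n => hg.holder_steklov (by linarith) n)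
    (hg.tendsto_steklov (by linarith)) hα hα1 ha hl hts
  refine h.congr fun n => ?_
  exact (hasC1Deriv_steklov hf (hα.trans ha) n).stieltjes_eq
    (hasC1Deriv_steklov hg (by linarith) n) hα hα1 hts

lemma intervalIntegrable_steklov (hf : HolderC C a f) (hg : HolderC D l g) (ha : 0 < a)
    (hl : 0 < l) (n : ℕ) (t s : ℝ) :
    IntervalIntegrable (fun u => steklov n f u * ((n + 1) * (g (u + 1 / (n + 1)) - g u)))
      volume t s :=
  ((hasC1Deriv_steklov hf ha n).continuous.mul
    (hasC1Deriv_steklov hg hl n).cont).intervalIntegrable _ _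

/-- Not immediate from the definition: the left derivative on `[r,s]` restarts at `r` and the right
derivative on `[t,r]` stops at `r`, so the three integrands are unrelated pointwise. -/
theorem HolderC.stieltjes_add_adjacent (hf : HolderC C a f) (hg : HolderC D l g) (hα : 0 < α)
    (hα1 : α < 1) (ha : α < a) (hl : 1 - α < l) (htr : t ≤ r) (hrs : r ≤ s) :
    stieltjes α t r f g + stieltjes α r s f g = stieltjes α t s f g := by
  refine tendsto_nhds_unique ((tendsto_integral_steklov hf hg hα hα1 ha hl htr).add
    (tendsto_integral_steklov hf hg hα hα1 ha hl hrs)) ?_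
  refine (tendsto_integral_steklov hf hg hα hα1 ha hl (htr.trans hrs)).congr fun n => ?_
  exact (intervalIntegral.integral_add_adjacent_intervals
    (intervalIntegrable_steklov hf hg (by linarith) (by linarith) n _ _)
    (intervalIntegrable_steklov hf hg (by linarith) (by linarith) n _ _)).symm

theorem HolderC.stieltjes_sub (hf : HolderC C a f) (hf' : HolderC C' a f') (hg : HolderC D l g)
    (hα : 0 < α) (hα1 : α < 1) (ha : α < a) (hl : 1 - α < l) (hts : t ≤ s) :
    stieltjes α t s (fun x => f x - f' x) g = stieltjes α t s f g - stieltjes α t s f' g := by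
  have hs : HolderC (C + C') a (fun x => f x - f' x) := fun x y => by
    have h1 : f x - f' x - (f y - f' y) = (f x - f y) - (f' x - f' y) := by ring
    rw [h1, add_mul]
    exact (norm_sub_le _ _).trans (add_le_add (hf x y) (hf' x y))
  have ha0 : 0 < a := by linarith
  refine tendsto_nhds_unique (tendsto_integral_steklov hs hg hα hα1 ha hl hts)
    (((tendsto_integral_steklov hf hg hα hα1 ha hl hts).sub
    (tendsto_integral_steklov hf' hg hα hα1 ha hl hts)).congr fun n => ?_)
  rw [← intervalIntegral.integral_sub
    (intervalIntegrable_steklov hf hg (by linarith) (by linarith) n _ _)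
    (intervalIntegrable_steklov hf' hg (by linarith) (by linarith) n _ _)]
  have hc := hf.continuous ha0
  have hc' := hf'.continuous ha0
  congr 1
  ext u
  rw [← sub_mul]
  congr 1
  unfold steklov
  rw [intervalIntegral.integral_sub (Continuous.intervalIntegrable (by fun_prop) _ _)
    (Continuous.intervalIntegrable (by fun_prop) _ _)]

theorem HolderC.stieltjes_const (hg : HolderC D l g) (hα : 0 < α) (hα1 : α < 1)
    (hl : 1 - α < l) (hts : t ≤ s) (c : ℝ) :
    stieltjes α t s (fun _ => c) g = c * (g s - g t) := by
  have hl0 : 0 < l := by linarith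
  have hf : HolderC 0 1 (fun _ : ℝ => c) := fun x y => by simp
  refine tendsto_nhds_unique (tendsto_integral_steklov hf hg hα hα1 hα1 hl hts) ?_
  refine Tendsto.congr (fun n => ?_) (((hg.tendsto_steklov hl0 s).sub
    (hg.tendsto_steklov hl0 t)).const_mul c)
  have h := hasC1Deriv_steklov hg hl0 n
  rw [← intervalIntegral.integral_eq_sub_of_hasDerivAt (fun x _ => h.hasDerivAt x)
    (h.cont.intervalIntegrable _ _), ← intervalIntegral.integral_const_mul]
  simp only [steklov, intervalIntegral.integral_const, sub_zero, one_smul]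

end Algebra

/-! ### Functions that are Hölder continuous on an interval -/

/-- `f` is Hölder continuous on `[t,s]`, with constant `C` and exponent `a`. -/
def HolderOn {F : Type*} [NormedAddCommGroup F] (C a t s : ℝ) (f : ℝ → F) : Prop :=
  ∀ x ∈ Icc t s, ∀ y ∈ Icc t s, ‖f x - f y‖ ≤ C * |x - y| ^ a

/-- The retraction of the line onto `[t,s]`. -/
def clamp (t s x : ℝ) : ℝ := max t (min s x)

lemma clamp_mem {t s : ℝ} (h : t ≤ s) (x : ℝ) : clamp t s x ∈ Icc t s :=
  ⟨le_max_left _ _, max_le h (min_le_left _ _)⟩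

lemma clamp_of_mem {t s x : ℝ} (hx : x ∈ Icc t s) : clamp t s x = x := by
  rw [clamp, min_eq_right hx.2, max_eq_right hx.1]

lemma abs_clamp_sub_le (t s x y : ℝ) : |clamp t s x - clamp t s y| ≤ |x - y| :=
  (abs_max_sub_max_le_max _ _ _ _).trans (max_le (by simp)
    ((abs_min_sub_min_le_max _ _ _ _).trans (max_le (by simp) le_rfl)))

section HolderOn

variable {F : Type*} [NormedAddCommGroup F] {C a l t s t' s' : ℝ} {f : ℝ → F}

lemma HolderOn.mono (h : HolderOn C a t s f) (h1 : t ≤ t') (h2 : s' ≤ s) :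
    HolderOn C a t' s' f :=
  fun x hx y hy => h x ⟨h1.trans hx.1, hx.2.trans h2⟩ y ⟨h1.trans hy.1, hy.2.trans h2⟩

lemma HolderOn.mono_const {C' : ℝ} (h : HolderOn C a t s f) (hC : C ≤ C') :
    HolderOn C' a t s f :=
  fun x hx y hy => (h x hx y hy).trans (by gcongr)

lemma HolderOn.abs_const (h : HolderOn C a t s f) : HolderOn |C| a t s f :=
  h.mono_const (le_abs_self C)

/-- Precomposing with a retraction extends a function to the line without losing the Hölder bound.
On a one-point interval a Hölder constant may be negative, so nonnegativity is assumed here and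
later uses pass to `|C|`. -/
lemma HolderOn.comp_clamp (h : HolderOn C a t s f) (hC : 0 ≤ C) (ha : 0 < a) (hts : t ≤ s) :
    HolderC C a (fun x => f (clamp t s x)) := fun x y =>
  (h _ (clamp_mem hts x) _ (clamp_mem hts y)).trans 
    (mul_le_mul_of_nonneg_left
      (Real.rpow_le_rpow (abs_nonneg _) (abs_clamp_sub_le t s x y) ha.le) hC)

lemma HolderOn.exists_holderC (h : HolderOn C a t s f) (ha : 0 < a) (hts : t ≤ s) :
    ∃ f' : ℝ → F, HolderC |C| a f' ∧ ∀ x ∈ Icc t s, f' x = f x :=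
  ⟨_, h.abs_const.comp_clamp (abs_nonneg C) ha hts, fun x hx => by rw [clamp_of_mem hx]⟩

lemma HolderOn.continuousOn (h : HolderOn C a t s f) (ha : 0 < a) : ContinuousOn f (Icc t s) := by
  rcases lt_or_ge s t with hst | hts
  · rw [Icc_eq_empty (not_le.2 hst)]
    exact continuousOn_empty f
  · obtain ⟨f', hf', he⟩ := h.exists_holderC ha hts
    exact (hf'.continuous ha).continuousOn.congr fun x hx => (he x hx).symm

end HolderOn

lemma leftWeyl_congr {α t s r : ℝ} {f f' : ℝ → ℝ} (h : ∀ x ∈ Icc t s, f x = f' x)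
    (hr : r ∈ Ioc t s) : leftWeyl α t f r = leftWeyl α t f' r := by
  unfold leftWeyl
  rw [h r ⟨hr.1.le, hr.2⟩]
  congr 3
  apply intervalIntegral.integral_congr
  intro y hy
  rw [uIcc_of_le hr.1.le] at hy
  simp only
  rw [h y ⟨hy.1, hy.2.trans hr.2⟩]

lemma rightWeyl_congr {F : Type*} [NormedAddCommGroup F] [NormedSpace ℝ F] {α t s r : ℝ}
    {g g' : ℝ → F} (h : ∀ x ∈ Icc t s, g x = g' x) (hr : r ∈ Icc t s) :
    rightWeyl α s g r = rightWeyl α s g' r := by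
  unfold rightWeyl
  rw [h r hr, h s ⟨hr.1.trans hr.2, le_rfl⟩]
  congr 3
  apply intervalIntegral.integral_congr
  intro y hy
  rw [uIcc_of_le hr.2] at hy
  simp only
  rw [h y ⟨hr.1.trans hy.1, hy.2⟩]

lemma stieltjes_congr {α t s : ℝ} {f f' g g' : ℝ → ℝ} (hts : t ≤ s)
    (hf : ∀ x ∈ Icc t s, f x = f' x) (hg : ∀ x ∈ Icc t s, g x = g' x) :
    stieltjes α t s f g = stieltjes α t s f' g' := by
  unfold stieltjes
  congr 1
  apply intervalIntegral.integral_congr_ae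
  refine Eventually.of_forall fun r hr => ?_
  rw [uIoc_of_le hts] at hr
  rw [leftWeyl_congr hf hr, rightWeyl_congr hg ⟨hr.1.le, hr.2⟩]

/-! ### Integral estimates on an interval in terms of the right Weyl derivative -/

section Local

variable {α a l C C' D t r s Λ : ℝ} {f f' g : ℝ → ℝ}

theorem HolderOn.stieltjes_add_adjacent (hf : HolderOn C a t s f) (hg : HolderOn D l t s g)
    (hα : 0 < α) (hα1 : α < 1) (ha : α < a) (hl : 1 - α < l) (htr : t ≤ r) (hrs : r ≤ s) :
    stieltjes α t r f g + stieltjes α r s f g = stieltjes α t s f g := by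
  obtain ⟨F, hF, hFe⟩ := hf.exists_holderC (hα.trans ha) (htr.trans hrs)
  obtain ⟨G, hG, hGe⟩ := hg.exists_holderC (by linarith) (htr.trans hrs)
  have h := hF.stieltjes_add_adjacent hG hα hα1 ha hl htr hrs
  rwa [stieltjes_congr htr (fun x hx => hFe x ⟨hx.1, hx.2.trans hrs⟩)
    (fun x hx => hGe x ⟨hx.1, hx.2.trans hrs⟩), stieltjes_congr hrs
    (fun x hx => hFe x ⟨htr.trans hx.1, hx.2⟩) (fun x hx => hGe x ⟨htr.trans hx.1, hx.2⟩),
    stieltjes_congr (htr.trans hrs) hFe hGe] at h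

theorem HolderOn.stieltjes_sub (hf : HolderOn C a t s f) (hf' : HolderOn C' a t s f')
    (hg : HolderOn D l t s g) (hα : 0 < α) (hα1 : α < 1) (ha : α < a) (hl : 1 - α < l)
    (hts : t ≤ s) :
    stieltjes α t s (fun x => f x - f' x) g = stieltjes α t s f g - stieltjes α t s f' g := by
  obtain ⟨F, hF, hFe⟩ := hf.exists_holderC (hα.trans ha) hts
  obtain ⟨F', hF', hFe'⟩ := hf'.exists_holderC (hα.trans ha) hts
  obtain ⟨G, hG, hGe⟩ := hg.exists_holderC (by linarith) hts
  have h := hF.stieltjes_sub hF' hG hα hα1 ha hl hts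
  rwa [stieltjes_congr hts (f' := fun x => f x - f' x)
    (fun x hx => by simp only [hFe x hx, hFe' x hx]) hGe,
    stieltjes_congr hts hFe hGe, stieltjes_congr hts hFe' hGe] at h

theorem HolderOn.stieltjes_const (hg : HolderOn D l t s g) (hα : 0 < α) (hα1 : α < 1)
    (hl : 1 - α < l) (hts : t ≤ s) (c : ℝ) :
    stieltjes α t s (fun _ => c) g = c * (g s - g t) := by
  obtain ⟨G, hG, hGe⟩ := hg.exists_holderC (by linarith) hts
  have h := hG.stieltjes_const hα hα1 hl hts c
  rwa [stieltjes_congr hts (fun _ _ => rfl) hGe, hGe s ⟨hts, le_rfl⟩, hGe t ⟨le_rfl, hts⟩] at h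

/-- The remainder of the first order expansion of the generalized Stieltjes integral. -/
theorem HolderOn.abs_stieltjes_sub_le (hf : HolderOn C a t s f) (hg : HolderOn D l t s g)
    (hC : 0 ≤ C) (hα : 0 < α) (hα1 : α < 1) (ha : α < a) (hl : 1 - α < l) (hts : t ≤ s)
    (hΛ : ∀ r ∈ Ioo t s, |rightWeyl α s g r| ≤ Real.Gamma (1 - α) * Λ) :
    |stieltjes α t s f g - f t * (g s - g t)| ≤
      a / (a - α) / (a - α + 1) * C * Λ * (s - t) ^ (a + (1 - α)) := by
  have hG : 0 < Real.Gamma (1 - α) := Real.Gamma_pos_of_pos (by linarith)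
  have hcst : HolderOn C a t s (fun _ => f t) := fun x hx y hy => by
    simp only [sub_self, norm_zero]; positivity
  have hcl := hf.comp_clamp hC (hα.trans ha) hts
  have ha' : 0 < a - α := sub_pos.2 ha
  -- The subtracted term is the integral of the constant `f t`. The new integrand vanishes at `t`,
  -- so its left derivative is `O((r - t) ^ (a - α))` instead of singular.
  rw [← hg.stieltjes_const hα hα1 hl hts (f t), ← hf.stieltjes_sub hcst hg hα hα1 ha hl hts]
  set F := fun x => f (clamp t s x) - f t with hFdef
  have hF : HolderC C a F := fun x y => by simpa [hFdef] using hcl x y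
  have hFt : F t = 0 := by simp [hFdef, clamp_of_mem (left_mem_Icc.2 hts)]
  rw [stieltjes_congr hts (f' := F) (g' := g)
    (fun x hx => by simp only [hFdef, clamp_of_mem hx]) (fun _ _ => rfl), stieltjes, abs_neg]
  have h1 : ∀ r ∈ Ioo t s, ‖leftWeyl α t F r * rightWeyl α s g r‖ ≤
      a / (a - α) * C * Λ * (r - t) ^ (a - α) := by
    intro r hr
    have h0 : 0 < r - t := sub_pos.2 hr.1
    have h2 : |leftWeyl α t F r| ≤
        1 / Real.Gamma (1 - α) * (a / (a - α) * C * (r - t) ^ (a - α)) := by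
      refine (leftWeyl_bound hF hα hα1 ha hr.1).trans ?_
      have h3 := hF r t
      rw [hFt, sub_zero, abs_of_pos h0, Real.norm_eq_abs] at h3
      have h4 : |F r| * (r - t) ^ (-α) ≤ C * (r - t) ^ (a - α) := by
        rw [sub_eq_add_neg a α, Real.rpow_add h0, ← mul_assoc]
        gcongr
      have h5 : C * (r - t) ^ (a - α) + α * (C * ((r - t) ^ (a - α) / (a - α))) =
          a / (a - α) * C * (r - t) ^ (a - α) := by
        field_simp
        ring
      rw [← h5]
      gcongr
    rw [norm_mul]
    calc _ ≤ 1 / Real.Gamma (1 - α) * (a / (a - α) * C * (r - t) ^ (a - α)) *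
          (Real.Gamma (1 - α) * Λ) := by
          apply mul_le_mul h2 (hΛ r hr) (abs_nonneg _)
          exact (abs_nonneg _).trans h2
      _ = _ := by field_simp
  have h2 : ∫ r in t..s, a / (a - α) * C * Λ * (r - t) ^ (a - α) =
      a / (a - α) / (a - α + 1) * C * Λ * (s - t) ^ (a + (1 - α)) := by
    rw [intervalIntegral.integral_const_mul, integral_rpow_sub (by linarith),
      show a - α + 1 = a + (1 - α) by ring]
    ring
  rw [← h2, ← Real.norm_eq_abs]
  apply intervalIntegral.norm_integral_le_of_norm_le hts
  · filter_upwards [compl_mem_ae_iff.2 (measure_singleton s)] with r hr hr2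
    exact h1 r ⟨hr2.1, lt_of_le_of_ne hr2.2 hr⟩
  · exact (intervalIntegrable_rpow_sub (by linarith) _ _ _).const_mul _

/-- The increments of the integrator are controlled by its right Weyl derivative. -/
theorem HolderOn.abs_sub_le_of_rightWeyl (hg : HolderOn D l t s g) (hα : 0 < α) (hα1 : α < 1)
    (hl : 1 - α < l) (hts : t ≤ s)
    (hΛ : ∀ r ∈ Ioo t s, |rightWeyl α s g r| ≤ Real.Gamma (1 - α) * Λ) :
    |g s - g t| ≤ 1 / (1 - α) * Λ * (s - t) ^ (1 - α) := by
  have hG : 0 < Real.Gamma (1 - α) := Real.Gamma_pos_of_pos (by linarith)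
  -- An increment of `g` is the integral of the constant 1, whose left derivative is a multiple of
  -- `(r - t) ^ (-α)`.
  have h0 := hg.stieltjes_const hα hα1 hl hts 1
  rw [one_mul] at h0
  rw [← h0, stieltjes, abs_neg, ← Real.norm_eq_abs]
  have h2 : ∫ r in t..s, Λ * (r - t) ^ (-α) = 1 / (1 - α) * Λ * (s - t) ^ (1 - α) := by
    rw [intervalIntegral.integral_const_mul, integral_rpow_sub (by linarith),
      show -α + 1 = 1 - α by ring]
    ring
  rw [← h2]
  apply intervalIntegral.norm_integral_le_of_norm_le hts
  · filter_upwards [compl_mem_ae_iff.2 (measure_singleton s)] with r hr hr2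
    have h0 : 0 < r - t := sub_pos.2 hr2.1
    have h3 : leftWeyl α t (fun _ => (1 : ℝ)) r = 1 / Real.Gamma (1 - α) * (r - t) ^ (-α) := by
      rw [leftWeyl, Real.rpow_neg h0.le]
      simp
    rw [h3, norm_mul, Real.norm_of_nonneg (by positivity)]
    calc _ ≤ 1 / Real.Gamma (1 - α) * (r - t) ^ (-α) * (Real.Gamma (1 - α) * Λ) := by
          gcongr
          exact hΛ r ⟨hr2.1, lt_of_le_of_ne hr2.2 hr⟩
      _ = _ := by field_simp
  · exact (intervalIntegrable_rpow_sub (by linarith) _ _ _).const_mul _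

end Local

/-! ### Vector valued integrators -/

/-- `g` is Hölder continuous on `[0,T]` of some order larger than `1 - α`, and `Λ_α(g) ≤ Λ`. -/
structure Driver {k : ℕ} (α T Λ : ℝ) (g : ℝ → EuclideanSpace ℝ (Fin k)) : Prop where
  holder : ∃ l D, 1 - α < l ∧ HolderOn D l 0 T g
  lam : Lam α T g ≤ Λ

lemma abs_apply_le_norm {k : ℕ} (v : EuclideanSpace ℝ (Fin k)) (j : Fin k) : |v j| ≤ ‖v‖ :=
  PiLp.norm_apply_le v j

lemma norm_le_sum_abs {k : ℕ} (v : EuclideanSpace ℝ (Fin k)) : ‖v‖ ≤ ∑ j, |v j| := by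
  rw [EuclideanSpace.norm_eq]
  apply Real.sqrt_le_iff.2 ⟨Finset.sum_nonneg fun _ _ => abs_nonneg _, ?_⟩
  simpa using Finset.sum_sq_le_sq_sum_of_nonneg (s := Finset.univ) (f := fun j => |v j|)
    fun _ _ => abs_nonneg _

lemma norm_le_of_abs_apply_le {k : ℕ} {v : EuclideanSpace ℝ (Fin k)} {c : ℝ}
    (h : ∀ j, |v j| ≤ c) : ‖v‖ ≤ k * c := by
  refine (norm_le_sum_abs v).trans ((Finset.sum_le_sum fun j _ => h j).trans ?_)
  simp

section Driver

variable {k d : ℕ} {α a T Λ C C' t r s : ℝ} {g : ℝ → EuclideanSpace ℝ (Fin k)}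

lemma HolderOn.apply {D l : ℝ} (h : HolderOn D l t s g) (j : Fin k) :
    HolderOn D l t s (fun x => g x j) := fun x hx y hy =>
  (abs_apply_le_norm (g x - g y) j).trans (h x hx y hy)

lemma Driver.exists_holderOn_apply (hg : Driver α T Λ g) (ht : 0 ≤ t) (hs : s ≤ T) :
    ∃ l D, 1 - α < l ∧ ∀ j, HolderOn D l t s (fun x => g x j) := by
  obtain ⟨l, D, hl, h⟩ := hg.holder
  exact ⟨l, D, hl, fun j => (h.mono ht hs).apply j⟩

lemma Driver.norm_rightWeyl_le_of_lt (hg : Driver α T Λ g) (hα : 0 < α) (hα1 : α < 1)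
    (hr : 0 < r) (hrs : r < s) (hs : s < T) :
    ‖rightWeyl α s g r‖ ≤ Real.Gamma (1 - α) * Λ := by
  have hG : 0 < Real.Gamma (1 - α) := Real.Gamma_pos_of_pos (by linarith)
  have hG' : 0 < Real.Gamma α := Real.Gamma_pos_of_pos hα
  have hlam := hg.lam
  rw [Lam, one_div, inv_mul_le_iff₀ hG] at hlam
  -- The set under the supremum must be shown bounded, since `sSup` of an unbounded set is 0 and
  -- `Lam` would then carry no information. The bound comes from `l > 1 - α`.
  refine le_trans (le_csSup ?_ ?_) hlam
  swap
  · exact ⟨r, s, hr, hrs, hs, rfl⟩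
  obtain ⟨l, D, hl, h⟩ := hg.holder
  obtain ⟨G, hGh, hGe⟩ := h.exists_holderC (by linarith) (by linarith)
  refine ⟨1 / Real.Gamma α * (|D| * T ^ (l - 1 + α) +
      (1 - α) * (|D| * (T ^ (l - 1 + α) / (l - 1 + α)))), ?_⟩
  rintro v ⟨r, s, hr, hrs, hs, rfl⟩
  rw [← rightWeyl_congr (g := G) (fun x hx => hGe x ⟨hr.le.trans hx.1, hx.2.trans hs.le⟩)
    ⟨le_rfl, hrs.le⟩]
  refine (rightWeyl_bound hGh hα hα1 hl hrs).trans ?_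
  have h1 : 0 < s - r := sub_pos.2 hrs
  have h2 : s - r ≤ T := by linarith
  have h3 : 0 < l - 1 + α := by linarith
  have h4 : 0 < 1 - α := by linarith
  gcongr

/-- The supremum in `Lam` runs over `s < T` only. The bound passes to `s = T` because the right
derivative at fixed `r` is continuous from the left in `s`. -/
lemma Driver.norm_rightWeyl_le (hg : Driver α T Λ g) (hα : 0 < α) (hα1 : α < 1)
    (hr : 0 < r) (hrs : r < s) (hs : s ≤ T) :
    ‖rightWeyl α s g r‖ ≤ Real.Gamma (1 - α) * Λ := by
  rcases hs.lt_or_eq with hs | rfl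
  · exact hg.norm_rightWeyl_le_of_lt hα hα1 hr hrs hs
  obtain ⟨l, D, hl, h⟩ := hg.holder
  obtain ⟨G, hGh, hGe⟩ := h.exists_holderC (by linarith) (by linarith)
  have hGc := hGh.continuous (by linarith)
  have h1 : Tendsto (fun s' => rightWeyl α s' G r) (𝓝[<] s) (𝓝 (rightWeyl α s G r)) := by
    unfold rightWeyl
    refine Tendsto.const_smul (Tendsto.add ?_ (Tendsto.const_smul ?_ _)) _
    · refine Tendsto.smul ?_ ?_
      · refine Tendsto.div tendsto_const_nhds ?_ (Real.rpow_pos_of_pos (sub_pos.2 hrs) _).ne'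
        exact ((continuousAt_id.sub continuousAt_const).rpow_const
          (Or.inl (sub_pos.2 hrs).ne')).tendsto.mono_left nhdsWithin_le_nhds
      · exact ((continuous_const.sub hGc).tendsto s).mono_left nhdsWithin_le_nhds
    · have hint : IntegrableOn (fun y => (1 / (y - r) ^ (2 - α)) • (G r - G y)) (uIcc r s) := by
        rw [uIcc_of_le hrs.le, integrableOn_Icc_iff_integrableOn_Ioc,
          ← intervalIntegrable_iff_integrableOn_Ioc_of_le hrs.le]
        refine ((intervalIntegrable_rpow_sub (show -1 < l - 2 + α by linarith) r s r).const_mul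
          |D|).mono_fun' ?_ ?_
        · exact (((measurable_id.sub_const r).pow_const _).const_div 1
            ).aestronglyMeasurable.smul (continuous_const.sub hGc).aestronglyMeasurable
        · rw [uIoc_of_le hrs.le]
          filter_upwards [ae_restrict_mem measurableSet_Ioc] with y hy
          exact rightWeyl_integrand_bound hGh hy.1
      have hc := intervalIntegral.continuousOn_primitive_interval hint s right_mem_uIcc
      refine hc.mono_left ?_
      rw [uIcc_of_le hrs.le, ← nhdsWithin_Ico_eq_nhdsLT hrs]
      exact nhdsWithin_mono _ Ico_subset_Icc_self
  rw [← rightWeyl_congr (g := G) (fun x hx => hGe x ⟨hr.le.trans hx.1, hx.2⟩)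
    ⟨le_rfl, hrs.le⟩]
  refine le_of_tendsto h1.norm ?_
  filter_upwards [Ioo_mem_nhdsLT hrs] with s' hs'
  rw [rightWeyl_congr (g := G) (fun x hx => hGe x ⟨hr.le.trans hx.1, hx.2.trans hs'.2.le⟩)
    ⟨le_rfl, hs'.1.le⟩]
  exact hg.norm_rightWeyl_le_of_lt hα hα1 hr hs'.1 hs'.2

/-- The right derivative of a coordinate is the coordinate of the right derivative. Moving the
projection through the integral requires the integrability `hint`. -/
lemma Driver.abs_rightWeyl_apply_le (hg : Driver α T Λ g) (hα : 0 < α) (hα1 : α < 1)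
    (hr : 0 < r) (hrs : r < s) (hs : s ≤ T) (j : Fin k) :
    |rightWeyl α s (fun x => g x j) r| ≤ Real.Gamma (1 - α) * Λ := by
  obtain ⟨l, D, hl, h⟩ := hg.holder
  obtain ⟨G, hGh, hGe⟩ := h.exists_holderC (by linarith) (by linarith)
  have hGc := hGh.continuous (by linarith)
  have hint : IntervalIntegrable (fun y => (1 / (y - r) ^ (2 - α)) • (G r - G y)) volume r s := by
    refine ((intervalIntegrable_rpow_sub (show -1 < l - 2 + α by linarith) r s r).const_mul
      |D|).mono_fun' ?_ ?_
    · exact (((measurable_id.sub_const r).pow_const _).const_div 1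
        ).aestronglyMeasurable.smul (continuous_const.sub hGc).aestronglyMeasurable
    · rw [uIoc_of_le hrs.le]
      filter_upwards [ae_restrict_mem measurableSet_Ioc] with y hy
      exact rightWeyl_integrand_bound hGh hy.1
  have h1 : rightWeyl α s (fun x => G x j) r = (rightWeyl α s G r) j := by
    have h2 := (EuclideanSpace.proj j : EuclideanSpace ℝ (Fin k) →L[ℝ] ℝ
      ).intervalIntegral_comp_comm hint
    simp only [rightWeyl, PiLp.smul_apply, PiLp.add_apply, PiLp.sub_apply]
    exact congrArg _ (congrArg₂ _ rfl (congrArg _ h2))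
  have h3 : ∀ x ∈ Icc r s, G x = g x := fun x hx => hGe x ⟨hr.le.trans hx.1, hx.2.trans hs⟩
  rw [← rightWeyl_congr (g := fun x => G x j) (fun x hx => by simp only [h3 x hx])
    ⟨le_rfl, hrs.le⟩, h1, rightWeyl_congr h3 ⟨le_rfl, hrs.le⟩]
  exact (abs_apply_le_norm _ j).trans (hg.norm_rightWeyl_le hα hα1 hr hrs hs)

lemma Driver.nonneg (hg : Driver α T Λ g) (hα1 : α < 1) : 0 ≤ Λ := by
  have hG : 0 < Real.Gamma (1 - α) := Real.Gamma_pos_of_pos (by linarith)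
  refine le_trans ?_ hg.lam
  refine mul_nonneg (by positivity) (Real.sSup_nonneg ?_)
  rintro v ⟨r, s, -, -, -, rfl⟩
  exact norm_nonneg _

theorem Driver.norm_sub_le (hg : Driver α T Λ g) (hα : 0 < α) (hα1 : α < 1)
    (ht : 0 ≤ t) (hts : t ≤ s) (hs : s ≤ T) :
    ‖g s - g t‖ ≤ k * (1 / (1 - α) * Λ) * (s - t) ^ (1 - α) := by
  obtain ⟨l, D, hl, h⟩ := hg.exists_holderOn_apply ht hs
  rw [mul_assoc]
  refine norm_le_of_abs_apply_le fun j => ?_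
  exact (h j).abs_sub_le_of_rightWeyl hα hα1 hl hts fun r hr =>
    hg.abs_rightWeyl_apply_le hα hα1 (ht.trans_lt hr.1) hr.2 hs j

/-- All entries of a matrix valued function are Hölder continuous on `[t,s]`. -/
def EntryHolder (C a t s : ℝ) (f : ℝ → Matrix (Fin d) (Fin k) ℝ) : Prop :=
  ∀ i j, HolderOn C a t s (fun x => f x i j)

lemma EntryHolder.mono {f : ℝ → Matrix (Fin d) (Fin k) ℝ} {t' s' : ℝ}
    (h : EntryHolder C a t s f) (h1 : t ≤ t') (h2 : s' ≤ s) : EntryHolder C a t' s' f :=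
  fun i j => (h i j).mono h1 h2

lemma Driver.vecStieltjes_add_adjacent (hg : Driver α T Λ g)
    {f : ℝ → Matrix (Fin d) (Fin k) ℝ} (hf : EntryHolder C a t s f)
    (hα : 0 < α) (hα1 : α < 1) (ha : α < a) (ht : 0 ≤ t) (htr : t ≤ r) (hrs : r ≤ s)
    (hs : s ≤ T) :
    vecStieltjes α t r f g + vecStieltjes α r s f g = vecStieltjes α t s f g := by
  obtain ⟨l, D, hl, h⟩ := hg.exists_holderOn_apply ht hs
  ext i
  simp only [vecStieltjes, PiLp.add_apply]
  rw [← Finset.sum_add_distrib]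
  exact Finset.sum_congr rfl fun j _ =>
    (hf i j).stieltjes_add_adjacent (h j) hα hα1 ha hl htr hrs

lemma Driver.vecStieltjes_sub (hg : Driver α T Λ g)
    {f f' : ℝ → Matrix (Fin d) (Fin k) ℝ} (hf : EntryHolder C a t s f)
    (hf' : EntryHolder C' a t s f') (hα : 0 < α) (hα1 : α < 1) (ha : α < a) (ht : 0 ≤ t)
    (hts : t ≤ s) (hs : s ≤ T) :
    vecStieltjes α t s (fun x => f x - f' x) g =
      vecStieltjes α t s f g - vecStieltjes α t s f' g := by
  obtain ⟨l, D, hl, h⟩ := hg.exists_holderOn_apply ht hs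
  ext i
  simp only [vecStieltjes, PiLp.sub_apply]
  rw [← Finset.sum_sub_distrib]
  exact Finset.sum_congr rfl fun j _ =>
    (hf i j).stieltjes_sub (hf' i j) (h j) hα hα1 ha hl hts

lemma vecStieltjes_congr {f f' : ℝ → Matrix (Fin d) (Fin k) ℝ} (hts : t ≤ s)
    (h : ∀ x ∈ Icc t s, f x = f' x) : vecStieltjes α t s f g = vecStieltjes α t s f' g := by
  ext i
  simp only [vecStieltjes]
  exact Finset.sum_congr rfl fun j _ =>
    stieltjes_congr hts (fun x hx => by rw [h x hx]) (fun _ _ => rfl)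

/-- The constant in the first order expansion of the generalized Stieltjes integral. -/
def youngConst (d k : ℕ) (α a : ℝ) : ℝ := d * (k * (a / (a - α) / (a - α + 1)))

lemma youngConst_nonneg (d k : ℕ) {α a : ℝ} (hα : 0 < α) (ha : α < a) :
    0 ≤ youngConst d k α a := by
  have : 0 < a - α := sub_pos.2 ha
  have : 0 < a := hα.trans ha
  unfold youngConst
  positivity

/-- The scalar expansion summed over entries. Since `a > α`, the exponent `a + (1 - α)` is larger
than 1. -/
theorem Driver.norm_vecStieltjes_sub_le (hg : Driver α T Λ g)
    {f : ℝ → Matrix (Fin d) (Fin k) ℝ} (hf : EntryHolder C a t s f) (hC : 0 ≤ C)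
    (hα : 0 < α) (hα1 : α < 1) (ha : α < a) (ht : 0 ≤ t) (hts : t ≤ s) (hs : s ≤ T) :
    ‖vecStieltjes α t s f g - WithLp.toLp 2 (f t *ᵥ (g s - g t).ofLp)‖ ≤
      youngConst d k α a * C * Λ * (s - t) ^ (a + (1 - α)) := by
  obtain ⟨l, D, hl, h⟩ := hg.exists_holderOn_apply ht hs
  rw [youngConst, mul_assoc, mul_assoc, mul_assoc]
  refine norm_le_of_abs_apply_le fun i => ?_
  have h1 : (vecStieltjes α t s f g - WithLp.toLp 2 (f t *ᵥ (g s - g t).ofLp)) i =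
      ∑ j, (stieltjes α t s (fun r => f r i j) (fun r => g r j) -
        f t i j * (g s j - g t j)) := by
    rw [Finset.sum_sub_distrib]
    rfl
  rw [h1]
  refine (Finset.abs_sum_le_sum_abs _ _).trans ?_
  have h2 : ∀ j ∈ (Finset.univ : Finset (Fin k)), |stieltjes α t s (fun r => f r i j)
      (fun r => g r j) - f t i j * (g s j - g t j)| ≤
      a / (a - α) / (a - α + 1) * C * Λ * (s - t) ^ (a + (1 - α)) := fun j _ =>
    (hf i j).abs_stieltjes_sub_le (h j) hC hα hα1 ha hl hts fun r hr =>
      hg.abs_rightWeyl_apply_le hα hα1 (ht.trans_lt hr.1) hr.2 hs j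
  refine (Finset.sum_le_sum h2).trans (le_of_eq ?_)
  simp only [Finset.sum_const, Finset.card_univ, Fintype.card_fin, nsmul_eq_mul]
  ring

lemma norm_toLp_mulVec_le {A : Matrix (Fin d) (Fin k) ℝ} {c : ℝ} (hA : ∀ i j, |A i j| ≤ c)
    (v : EuclideanSpace ℝ (Fin k)) : ‖WithLp.toLp 2 (A *ᵥ v.ofLp)‖ ≤ d * (k * (c * ‖v‖)) := by
  refine norm_le_of_abs_apply_le fun i => ?_
  have h1 : (WithLp.toLp 2 (A *ᵥ v.ofLp)) i = ∑ j, A i j * v j := rfl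
  rw [h1]
  refine (Finset.abs_sum_le_sum_abs _ _).trans ?_
  have h2 : ∀ j ∈ (Finset.univ : Finset (Fin k)), |A i j * v j| ≤ c * ‖v‖ := fun j _ => by
    rw [abs_mul]
    exact mul_le_mul (hA i j) (abs_apply_le_norm v j) (abs_nonneg _)
      ((abs_nonneg _).trans (hA i j))
  refine (Finset.sum_le_sum h2).trans (le_of_eq ?_)
  simp

end Driver

/-! ### Regularity of the coefficients along Hölder continuous paths -/

/-- The time exponent of the coefficients along `(1-α)`-Hölder continuous paths. -/
def expo (α β δ : ℝ) : ℝ := min β (δ * (1 - α))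

/-- The estimates on the coefficients used in the pathwise theory. -/
structure Regular {d k : ℕ} (T α β δ μ : ℝ)
    (b : ℝ → EuclideanSpace ℝ (Fin d) → EuclideanSpace ℝ (Fin d))
    (σ : ℝ → EuclideanSpace ℝ (Fin d) → Matrix (Fin d) (Fin k) ℝ) : Prop where
  T_pos : 0 < T
  α_pos : 0 < α
  α_lt : α < 1 / 2
  β_pos : 0 < β
  β_le : β ≤ 1
  δ_pos : 0 < δ
  δ_le : δ ≤ 1
  μ_pos : 0 < μ
  α_lt_expo : α < expo α β δ
  sigma_lip : ∃ M ≥ 0, ∀ t ∈ Icc 0 T, ∀ s ∈ Icc 0 T, ∀ x y, ∀ i j,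
    |σ t x i j - σ s y i j| ≤ M * (|t - s| ^ β + ‖x - y‖)
  sigma_growth : ∃ S ≥ 0, ∀ t ∈ Icc 0 T, ∀ x, ∀ i j, |σ t x i j| ≤ S * (1 + ‖x‖)
  sigma_four : ∀ R, ∃ M ≥ 0, ∀ t ∈ Icc 0 T, ∀ s ∈ Icc 0 T, ∀ x y x' y',
    ‖x‖ ≤ R → ‖y‖ ≤ R → ‖x'‖ ≤ R → ‖y'‖ ≤ R → ∀ i j,
    |σ t x i j - σ t y i j - (σ s x' i j - σ s y' i j)| ≤
      M * ‖x - y - (x' - y')‖ + M * (|t - s| ^ β + ‖x - x'‖ ^ δ + ‖y - y'‖ ^ δ) * ‖x' - y'‖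
  b_growth : ∃ L ≥ 0, ∀ t ∈ Icc 0 T, ∀ x, ‖b t x‖ ≤ L * (1 + ‖x‖)
  b_holder : ∀ R, ∃ L ≥ 0, ∀ t ∈ Icc 0 T, ∀ s ∈ Icc 0 T, ∀ x y, ‖x‖ ≤ R → ‖y‖ ≤ R →
    ‖b t x - b s y‖ ≤ L * (|t - s| ^ μ + ‖x - y‖)

/-- The increment over `[r,s]` of the right hand side of the equation along `X`. -/
def incr {d k : ℕ} (α : ℝ)
    (b : ℝ → EuclideanSpace ℝ (Fin d) → EuclideanSpace ℝ (Fin d))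
    (σ : ℝ → EuclideanSpace ℝ (Fin d) → Matrix (Fin d) (Fin k) ℝ)
    (g : ℝ → EuclideanSpace ℝ (Fin k)) (X : ℝ → EuclideanSpace ℝ (Fin d)) (r s : ℝ) :
    EuclideanSpace ℝ (Fin d) :=
  (∫ u in r..s, b u (X u)) + vecStieltjes α r s (fun u => σ u (X u)) g

/-- Used to bring all time exponents down to a common one: lowering an exponent by at most 1 costs a
single factor `W`. -/
lemma rpow_le_mul_rpow {x W a q : ℝ} (hx : 0 ≤ x) (hxW : x ≤ W) (hW : 1 ≤ W) (ha : 0 < a)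
    (haq : a ≤ q) (hq : q ≤ a + 1) : x ^ q ≤ W * x ^ a := by
  rcases hx.eq_or_lt with rfl | hx
  · rw [Real.zero_rpow (by linarith), Real.zero_rpow ha.ne', mul_zero]
  · calc x ^ q = x ^ (q - a) * x ^ a := by rw [← Real.rpow_add hx]; congr 1; ring
      _ ≤ W ^ (q - a) * x ^ a := by
        gcongr
      _ ≤ W ^ (1 : ℝ) * x ^ a := by
        have : q - a ≤ 1 := by linarith
        gcongr
      _ = W * x ^ a := by rw [Real.rpow_one]

lemma HolderOn.norm_le {F : Type*} [NormedAddCommGroup F] {C p τ τ' ε : ℝ} {X : ℝ → F}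
    (h : HolderOn C p τ τ' X) (hC : 0 ≤ C) (hp : 0 ≤ p) (hε : τ' - τ ≤ ε) {u : ℝ}
    (hu : u ∈ Icc τ τ') : ‖X u‖ ≤ ‖X τ‖ + C * ε ^ p := by
  have h1 := h u hu τ ⟨le_rfl, hu.1.trans hu.2⟩
  rw [abs_of_nonneg (sub_nonneg.2 hu.1)] at h1
  have h2 : ‖X u‖ ≤ ‖X τ‖ + ‖X u - X τ‖ := by
    have := norm_add_le (X τ) (X u - X τ)
    simpa using this
  refine h2.trans (add_le_add le_rfl (h1.trans ?_))
  have h3 : 0 ≤ u - τ := sub_nonneg.2 hu.1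
  have h4 : u - τ ≤ ε := by linarith [hu.2]
  gcongr

namespace Regular

variable {d k : ℕ} {T α β δ μ Λ C t r s S τ τ' ε : ℝ}
  {b : ℝ → EuclideanSpace ℝ (Fin d) → EuclideanSpace ℝ (Fin d)}
  {σ : ℝ → EuclideanSpace ℝ (Fin d) → Matrix (Fin d) (Fin k) ℝ}
  {g : ℝ → EuclideanSpace ℝ (Fin k)} {X X' : ℝ → EuclideanSpace ℝ (Fin d)}

lemma α_lt_one (h : Regular T α β δ μ b σ) : α < 1 := by linarith [h.α_lt]

lemma one_sub_pos (h : Regular T α β δ μ b σ) : 0 < 1 - α := by linarith [h.α_lt]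

lemma expo_pos (h : Regular T α β δ μ b σ) : 0 < expo α β δ := h.α_pos.trans h.α_lt_expo

lemma expo_le (h : Regular T α β δ μ b σ) : expo α β δ ≤ 1 - α :=
  (min_le_right _ _).trans (mul_le_of_le_one_left h.one_sub_pos.le h.δ_le)

lemma continuousOn_b (h : Regular T α β δ μ b σ) (hX : HolderOn C (1 - α) τ τ' X)
    (hτ : 0 ≤ τ) (hτ' : τ' ≤ T) : ContinuousOn (fun u => b u (X u)) (Icc τ τ') := by
  have hXc := hX.continuousOn h.one_sub_pos
  obtain ⟨R, hR⟩ := isCompact_Icc.exists_bound_of_continuousOn hXc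
  obtain ⟨L, hL, hb⟩ := h.b_holder R
  intro u hu
  rw [ContinuousWithinAt, tendsto_iff_norm_sub_tendsto_zero]
  have h1 : Tendsto (fun v => L * (|v - u| ^ μ + ‖X v - X u‖)) (𝓝[Icc τ τ'] u) (𝓝 0) := by
    have h2 : Tendsto (fun v => |v - u| ^ μ) (𝓝[Icc τ τ'] u) (𝓝 0) := by
      have : Continuous fun v : ℝ => |v - u| ^ μ :=
        (continuous_id.sub continuous_const).abs.rpow_const (fun _ => Or.inr h.μ_pos.le)
      have h3 := (this.tendsto u).mono_left (nhdsWithin_le_nhds (s := Icc τ τ'))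
      simpa [Real.zero_rpow h.μ_pos.ne'] using h3
    have h3 := tendsto_iff_norm_sub_tendsto_zero.1 (hXc u hu)
    simpa using (h2.add h3).const_mul L
  refine squeeze_zero' (Eventually.of_forall fun _ => norm_nonneg _) ?_ h1
  filter_upwards [self_mem_nhdsWithin] with v hv
  exact hb v ⟨hτ.trans hv.1, hv.2.trans hτ'⟩ u ⟨hτ.trans hu.1, hu.2.trans hτ'⟩ _ _ (hR v hv)
    (hR u hu)

lemma intervalIntegrable_b (h : Regular T α β δ μ b σ) (hX : HolderOn C (1 - α) τ τ' X)
    (hτ : 0 ≤ τ) (hτ' : τ' ≤ T) (hr : τ ≤ r) (hrs : r ≤ s) (hs : s ≤ τ') :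
    IntervalIntegrable (fun u => b u (X u)) volume r s := by
  apply ContinuousOn.intervalIntegrable
  rw [uIcc_of_le hrs]
  exact (h.continuousOn_b hX hτ hτ').mono (Icc_subset_Icc hr hs)

/-- The constant is affine in the Hölder constant `C` of the path, and `M` is chosen before the
path. This lets `C` be absorbed on short intervals. -/
lemma entryHolder_sigma (h : Regular T α β δ μ b σ) : ∃ M ≥ 0, ∀ {C τ τ' W : ℝ}
    {X : ℝ → EuclideanSpace ℝ (Fin d)}, 0 ≤ C → HolderOn C (1 - α) τ τ' X → 0 ≤ τ → τ' ≤ T →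
    1 ≤ W → τ' - τ ≤ W →
    EntryHolder (M * (1 + C) * W) (expo α β δ) τ τ' (fun u => σ u (X u)) := by
  obtain ⟨M, hM, hσ⟩ := h.sigma_lip
  refine ⟨M, hM, fun {C τ τ' W X} hC hX hτ hτ' hW hW' i j u hu v hv => ?_⟩
  have h0 : |u - v| ≤ W := by
    rw [abs_le]; constructor <;> linarith [hu.1, hu.2, hv.1, hv.2]
  have h1 := rpow_le_mul_rpow (abs_nonneg (u - v)) h0 hW h.expo_pos
    (min_le_left β (δ * (1 - α))) (by linarith [h.β_le, h.expo_pos])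
  have h2 := rpow_le_mul_rpow (abs_nonneg (u - v)) h0 hW h.expo_pos
    h.expo_le (by linarith [h.α_pos, h.expo_pos])
  refine (hσ u ⟨hτ.trans hu.1, hu.2.trans hτ'⟩ v ⟨hτ.trans hv.1, hv.2.trans hτ'⟩ _ _ i j).trans ?_
  calc _ ≤ M * (W * |u - v| ^ expo α β δ + C * (W * |u - v| ^ expo α β δ)) := by
        gcongr
        exact (hX u hu v hv).trans (by gcongr)
    _ = _ := by ring

lemma exists_entryHolder (h : Regular T α β δ μ b σ) (hX : HolderOn C (1 - α) τ τ' X)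
    (hτ : 0 ≤ τ) (hτ' : τ' ≤ T) :
    ∃ A, EntryHolder A (expo α β δ) τ τ' (fun u => σ u (X u)) := by
  obtain ⟨M, -, hM⟩ := h.entryHolder_sigma
  exact ⟨_, hM (abs_nonneg C) hX.abs_const hτ hτ' (W := 1 + T) (by linarith [h.T_pos])
    (by linarith)⟩

lemma incr_add (h : Regular T α β δ μ b σ) (hg : Driver α T Λ g)
    (hX : HolderOn C (1 - α) t S X) (ht : 0 ≤ t) (hS : S ≤ T) (hr : t ≤ r) (hrs : r ≤ s)
    {u : ℝ} (hsu : s ≤ u) (hu : u ≤ S) :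
    incr α b σ g X r s + incr α b σ g X s u = incr α b σ g X r u := by
  obtain ⟨A, hA⟩ := h.exists_entryHolder hX ht hS
  unfold incr
  rw [← intervalIntegral.integral_add_adjacent_intervals
    (h.intervalIntegrable_b hX ht hS hr hrs (hsu.trans hu))
    (h.intervalIntegrable_b hX ht hS (hr.trans hrs) hsu hu),
    ← hg.vecStieltjes_add_adjacent (hA.mono hr hu) h.α_pos h.α_lt_one h.α_lt_expo (ht.trans hr)
      hrs hsu (hu.trans hS)]
  abel

lemma incr_congr (hrs : r ≤ s) (he : ∀ u ∈ Icc r s, X u = X' u) :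
    incr α b σ g X r s = incr α b σ g X' r s := by
  unfold incr
  rw [vecStieltjes_congr (f' := fun u => σ u (X' u)) hrs (fun u hu => by rw [he u hu])]
  congr 1
  apply intervalIntegral.integral_congr
  intro u hu
  rw [uIcc_of_le hrs] at hu
  simp only [he u hu]

lemma incr_self : incr α b σ g X r r = 0 := by
  ext i
  simp [incr, vecStieltjes, stieltjes]

/-- Growth estimate for the right hand side of the equation. -/
lemma exists_incr_bound (h : Regular T α β δ μ b σ) (Λ : ℝ) :
    ∃ D ≥ 0, ∀ {g : ℝ → EuclideanSpace ℝ (Fin k)} {C τ τ' ε : ℝ}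
      {X : ℝ → EuclideanSpace ℝ (Fin d)}, Driver α T Λ g → 0 ≤ C → HolderOn C (1 - α) τ τ' X →
      0 ≤ τ → τ' ≤ T → τ' - τ ≤ ε → 0 ≤ ε → ε ≤ 1 → ∀ r s, τ ≤ r → r ≤ s → s ≤ τ' →
      ‖incr α b σ g X r s‖ ≤
        D * (ε ^ expo α β δ * C + (1 + ‖X τ‖)) * (s - r) ^ (1 - α) := by
  obtain ⟨M, hM, hσ⟩ := h.entryHolder_sigma
  obtain ⟨S, hS, hσS⟩ := h.sigma_growth
  obtain ⟨L, hL, hbL⟩ := h.b_growth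
  set a := expo α β δ with ha
  set Y := youngConst d k α a
  have hY : 0 ≤ Y := youngConst_nonneg d k h.α_pos h.α_lt_expo
  have hα1 := h.one_sub_pos
  -- `E` adds up the drift, the diffusion frozen at time `r`, and the remainder of the expansion. It
  -- uses `|Λ|` because `Λ` is known to be nonnegative only once a driver is given.
  set E := L + d * (k * (S * (k * (1 / (1 - α) * |Λ|)))) + Y * M * |Λ| with hE
  have hE0 : 0 ≤ E := by positivity
  refine ⟨2 * E, by positivity, fun {g C τ τ' ε X} hg hC hX hτ hτ' hε hε0 hε1 r s hr hrs hs => ?_⟩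
  have hΛ := hg.nonneg h.α_lt_one
  rw [abs_of_nonneg hΛ] at hE
  have hsr0 : 0 ≤ s - r := sub_nonneg.2 hrs
  have hsr1 : s - r ≤ 1 := by linarith
  have hsrε : s - r ≤ ε := by linarith
  set N := ‖X τ‖ + C * ε ^ (1 - α) with hN
  have hNX : ∀ u ∈ Icc τ τ', ‖X u‖ ≤ N := fun u hu => hX.norm_le hC hα1.le hε hu
  have hεa0 : 0 ≤ ε ^ a := by positivity
  have hεa1 : ε ^ a ≤ 1 := Real.rpow_le_one hε0 hε1 h.expo_pos.le
  have hεp : ε ^ (1 - α) ≤ ε ^ a := by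
    have := rpow_le_mul_rpow hε0 hε1 le_rfl h.expo_pos h.expo_le
      (by linarith [h.α_pos, h.expo_pos])
    rwa [one_mul] at this
  have hN0 : 0 ≤ N := by positivity
  have h1 : ‖∫ u in r..s, b u (X u)‖ ≤ L * (1 + N) * (s - r) ^ (1 - α) := by
    have h2 := intervalIntegral.norm_integral_le_of_norm_le_const (a := r) (b := s)
      (f := fun u => b u (X u)) (C := L * (1 + N)) (fun u hu => by
        rw [uIoc_of_le hrs] at hu
        have hu' : u ∈ Icc τ τ' := ⟨hr.trans hu.1.le, hu.2.trans hs⟩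
        refine (hbL u ⟨hτ.trans hu'.1, hu'.2.trans hτ'⟩ _).trans ?_
        have := hNX u hu'
        gcongr)
    refine h2.trans ?_
    rw [abs_of_nonneg hsr0]
    gcongr
    have := rpow_le_mul_rpow (q := 1) hsr0 hsr1 le_rfl hα1 (by linarith [h.α_pos])
      (by linarith [h.α_lt])
    rwa [Real.rpow_one, one_mul] at this
  have h2 : ‖vecStieltjes α r s (fun u => σ u (X u)) g -
      WithLp.toLp 2 (σ r (X r) *ᵥ (g s - g r).ofLp)‖ ≤
      Y * M * Λ * (1 + C) * ε ^ a * (s - r) ^ (1 - α) := by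
    have h3 := hg.norm_vecStieltjes_sub_le
      ((hσ hC hX hτ hτ' le_rfl (hε.trans hε1)).mono hr hs) (by positivity) h.α_pos h.α_lt_one
      h.α_lt_expo (hτ.trans hr) hrs (hs.trans hτ')
    refine h3.trans ?_
    rw [Real.rpow_add_of_nonneg hsr0 h.expo_pos.le hα1.le]
    calc _ = Y * M * Λ * (1 + C) * (s - r) ^ a * (s - r) ^ (1 - α) := by ring
      _ ≤ _ := by
        have := h.expo_pos
        gcongr
  have h3 : ‖WithLp.toLp 2 (σ r (X r) *ᵥ (g s - g r).ofLp)‖ ≤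
      d * (k * (S * (k * (1 / (1 - α) * Λ)))) * (1 + N) * (s - r) ^ (1 - α) := by
    have hr' : r ∈ Icc τ τ' := ⟨hr, hrs.trans hs⟩
    have h4 := norm_toLp_mulVec_le (A := σ r (X r)) (c := S * (1 + N)) (fun i j =>
      (hσS r ⟨hτ.trans hr'.1, hr'.2.trans hτ'⟩ _ i j).trans (by have := hNX r hr'; gcongr))
      (g s - g r)
    refine h4.trans ?_
    have h5 := hg.norm_sub_le h.α_pos h.α_lt_one (hτ.trans hr) hrs (hs.trans hτ')
    calc _ ≤ (d : ℝ) * (k * (S * (1 + N) * (k * (1 / (1 - α) * Λ) * (s - r) ^ (1 - α)))) := by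
          gcongr
      _ = _ := by ring
  have h4 : ‖incr α b σ g X r s‖ ≤ ‖∫ u in r..s, b u (X u)‖ +
      (‖vecStieltjes α r s (fun u => σ u (X u)) g -
        WithLp.toLp 2 (σ r (X r) *ᵥ (g s - g r).ofLp)‖ +
        ‖WithLp.toLp 2 (σ r (X r) *ᵥ (g s - g r).ofLp)‖) := by
    refine (norm_add_le _ _).trans (add_le_add le_rfl ?_)
    have := norm_add_le (vecStieltjes α r s (fun u => σ u (X u)) g -
      WithLp.toLp 2 (σ r (X r) *ᵥ (g s - g r).ofLp))
      (WithLp.toLp 2 (σ r (X r) *ᵥ (g s - g r).ofLp))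
    rwa [sub_add_cancel] at this
  refine h4.trans ((add_le_add h1 (add_le_add h2 h3)).trans ?_)
  rw [← add_mul, ← add_mul]
  gcongr
  have hN1 : 1 + N ≤ 1 + ‖X τ‖ + ε ^ a * C := by
    rw [hN]; nlinarith
  calc L * (1 + N) + (Y * M * Λ * (1 + C) * ε ^ a +
        d * (k * (S * (k * (1 / (1 - α) * Λ)))) * (1 + N))
      = (L + d * (k * (S * (k * (1 / (1 - α) * Λ))))) * (1 + N) +
        Y * M * Λ * (ε ^ a + ε ^ a * C) := by ring
    _ ≤ E * (1 + N) + E * (1 + ε ^ a * C) := by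
        have e1 : L + d * (k * (S * (k * (1 / (1 - α) * Λ)))) ≤ E := by
          rw [hE]; linarith [show 0 ≤ Y * M * Λ by positivity]
        have e2 : Y * M * Λ ≤ E := by
          rw [hE]; linarith [show 0 ≤ L + d * (k * (S * (k * (1 / (1 - α) * Λ)))) by positivity]
        gcongr
    _ ≤ E * (1 + ‖X τ‖ + ε ^ a * C) + E * (1 + ‖X τ‖ + ε ^ a * C) := by
        have e3 : 1 + ε ^ a * C ≤ 1 + ‖X τ‖ + ε ^ a * C := by linarith [norm_nonneg (X τ)]
        gcongr
    _ = _ := by ring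

/-- Lipschitz estimate for the right hand side of the equation. -/
lemma exists_incr_sub_bound (h : Regular T α β δ μ b σ) (Λ R A : ℝ) (hA : 0 ≤ A) :
    ∃ D ≥ 0, ∀ {g : ℝ → EuclideanSpace ℝ (Fin k)} {C τ τ' ε : ℝ}
      {X X' : ℝ → EuclideanSpace ℝ (Fin d)}, Driver α T Λ g → 0 ≤ C →
      HolderOn A (1 - α) τ τ' X → HolderOn A (1 - α) τ τ' X' →
      (∀ u ∈ Icc τ τ', ‖X u‖ ≤ R) → (∀ u ∈ Icc τ τ', ‖X' u‖ ≤ R) →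
      HolderOn C (1 - α) τ τ' (fun u => X u - X' u) →
      0 ≤ τ → τ' ≤ T → τ' - τ ≤ ε → 0 ≤ ε → ε ≤ 1 → ∀ r s, τ ≤ r → r ≤ s → s ≤ τ' →
      ‖incr α b σ g X r s - incr α b σ g X' r s‖ ≤
        D * (ε ^ expo α β δ * C + ‖X τ - X' τ‖) * (s - r) ^ (1 - α) := by
  obtain ⟨M₁, -, hσh⟩ := h.entryHolder_sigma
  obtain ⟨M₀, hM₀, hσl⟩ := h.sigma_lip
  obtain ⟨M, hM, hσ⟩ := h.sigma_four R
  obtain ⟨L, hL, hbL⟩ := h.b_holder R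
  set a := expo α β δ with ha
  set Y := youngConst d k α a
  have hY : 0 ≤ Y := youngConst_nonneg d k h.α_pos h.α_lt_expo
  have hα1 := h.one_sub_pos
  set B := M * (1 + 2 * A ^ δ) with hB
  have hB0 : 0 ≤ B := by positivity
  set E := L + d * (k * (M₀ * (k * (1 / (1 - α) * |Λ|)))) + Y * |Λ| * (M + B) with hE
  have hE0 : 0 ≤ E := by positivity
  refine ⟨2 * E, by positivity,
    fun {g C τ τ' ε X X'} hg hC hX hX' hXR hXR' hZ hτ hτ' hε hε0 hε1 r s hr hrs hs => ?_⟩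
  have hΛ := hg.nonneg h.α_lt_one
  rw [abs_of_nonneg hΛ] at hE
  have hsr0 : 0 ≤ s - r := sub_nonneg.2 hrs
  have hsr1 : s - r ≤ 1 := by linarith
  have hsrε : s - r ≤ ε := by linarith
  set N := ‖X τ - X' τ‖ + C * ε ^ (1 - α) with hN
  have hNX : ∀ u ∈ Icc τ τ', ‖X u - X' u‖ ≤ N := fun u hu => hZ.norm_le hC hα1.le hε hu
  have hεa0 : 0 ≤ ε ^ a := by positivity
  have hεa1 : ε ^ a ≤ 1 := Real.rpow_le_one hε0 hε1 h.expo_pos.le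
  have hεp : ε ^ (1 - α) ≤ ε ^ a := by
    have := rpow_le_mul_rpow hε0 hε1 le_rfl h.expo_pos h.expo_le
      (by linarith [h.α_pos, h.expo_pos])
    rwa [one_mul] at this
  have hN0 : 0 ≤ N := by positivity
  have hmem : ∀ u ∈ Icc τ τ', u ∈ Icc 0 T := fun u hu => ⟨hτ.trans hu.1, hu.2.trans hτ'⟩
  -- The four-point estimate makes the difference of coefficients Hölder with a constant linear in
  -- the Hölder constant `C` and the sup bound `N` of `X - X'`. The powers `‖X u - X v‖ ^ δ` are
  -- where the exponent `δ * (1 - α)` arises.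
  have hcoef : EntryHolder (M * C + B * N) a τ τ' (fun u => σ u (X u) - σ u (X' u)) := by
    intro i j u hu v hv
    have h0 : |u - v| ≤ 1 := by
      rw [abs_le]; constructor <;> linarith [hu.1, hu.2, hv.1, hv.2]
    have e1 := rpow_le_mul_rpow (abs_nonneg (u - v)) h0 le_rfl h.expo_pos
      (min_le_left β (δ * (1 - α))) (by linarith [h.β_le, h.expo_pos])
    have e2 := rpow_le_mul_rpow (abs_nonneg (u - v)) h0 le_rfl h.expo_pos
      h.expo_le (by linarith [h.α_pos, h.expo_pos])
    have e3 := rpow_le_mul_rpow (abs_nonneg (u - v)) h0 le_rfl h.expo_pos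
      (min_le_right β (δ * (1 - α))) (by
        have : δ * (1 - α) ≤ 1 * 1 := by
          have := h.δ_le
          have := h.α_pos
          gcongr
          linarith
        linarith [h.expo_pos])
    rw [one_mul] at e1 e2 e3
    have e4 : ∀ {V : ℝ → EuclideanSpace ℝ (Fin d)}, HolderOn A (1 - α) τ τ' V →
        ‖V u - V v‖ ^ δ ≤ A ^ δ * |u - v| ^ a := fun {V} hV => by
      have hδ := h.δ_pos
      calc ‖V u - V v‖ ^ δ ≤ (A * |u - v| ^ (1 - α)) ^ δ := by
            have := hV u hu v hv
            gcongr
        _ = A ^ δ * |u - v| ^ (δ * (1 - α)) := by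
            rw [Real.mul_rpow hA (by positivity), ← Real.rpow_mul (abs_nonneg _), mul_comm δ]
        _ ≤ _ := by gcongr
    refine (hσ u (hmem u hu) v (hmem v hv) _ _ _ _ (hXR u hu) (hXR' u hu) (hXR v hv)
      (hXR' v hv) i j).trans ?_
    calc _ ≤ M * (C * |u - v| ^ a) + M * (|u - v| ^ a + A ^ δ * |u - v| ^ a +
          A ^ δ * |u - v| ^ a) * N := by
          have e5 := (hZ u hu v hv).trans (mul_le_mul_of_nonneg_left e2 hC)
          have e6 := e4 hX
          have e7 := e4 hX'
          have e8 := hNX v hv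
          gcongr
      _ = _ := by rw [hB]; ring
  have h1 : ‖∫ u in r..s, (b u (X u) - b u (X' u))‖ ≤ L * N * (s - r) ^ (1 - α) := by
    have h2 := intervalIntegral.norm_integral_le_of_norm_le_const (a := r) (b := s)
      (f := fun u => b u (X u) - b u (X' u)) (C := L * N) (fun u hu => by
        rw [uIoc_of_le hrs] at hu
        have hu' : u ∈ Icc τ τ' := ⟨hr.trans hu.1.le, hu.2.trans hs⟩
        refine (hbL u (hmem u hu') u (hmem u hu') _ _ (hXR u hu') (hXR' u hu')).trans ?_
        have := hNX u hu'
        rw [sub_self, abs_zero, Real.zero_rpow h.μ_pos.ne', zero_add]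
        gcongr)
    refine h2.trans ?_
    rw [abs_of_nonneg hsr0]
    gcongr
    have := rpow_le_mul_rpow (q := 1) hsr0 hsr1 le_rfl hα1 (by linarith [h.α_pos])
      (by linarith [h.α_lt])
    rwa [Real.rpow_one, one_mul] at this
  have h2 : ‖vecStieltjes α r s (fun u => σ u (X u) - σ u (X' u)) g -
      WithLp.toLp 2 ((σ r (X r) - σ r (X' r)) *ᵥ (g s - g r).ofLp)‖ ≤
      Y * Λ * (M * C + B * N) * ε ^ a * (s - r) ^ (1 - α) := by
    have h3 := hg.norm_vecStieltjes_sub_le (hcoef.mono hr hs) (by positivity) h.α_pos h.α_lt_one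
      h.α_lt_expo (hτ.trans hr) hrs (hs.trans hτ')
    refine h3.trans ?_
    rw [Real.rpow_add_of_nonneg hsr0 h.expo_pos.le hα1.le]
    calc _ = Y * Λ * (M * C + B * N) * (s - r) ^ a * (s - r) ^ (1 - α) := by ring
      _ ≤ _ := by
        have := h.expo_pos
        gcongr
  have h3 : ‖WithLp.toLp 2 ((σ r (X r) - σ r (X' r)) *ᵥ (g s - g r).ofLp)‖ ≤
      d * (k * (M₀ * (k * (1 / (1 - α) * Λ)))) * N * (s - r) ^ (1 - α) := by
    have hr' : r ∈ Icc τ τ' := ⟨hr, hrs.trans hs⟩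
    have h4 := norm_toLp_mulVec_le (A := σ r (X r) - σ r (X' r)) (c := M₀ * N) (fun i j => by
      refine (hσl r (hmem r hr') r (hmem r hr') _ _ i j).trans ?_
      have := hNX r hr'
      rw [sub_self, abs_zero, Real.zero_rpow h.β_pos.ne', zero_add]
      gcongr) (g s - g r)
    refine h4.trans ?_
    have h5 := hg.norm_sub_le h.α_pos h.α_lt_one (hτ.trans hr) hrs (hs.trans hτ')
    calc _ ≤ (d : ℝ) * (k * (M₀ * N * (k * (1 / (1 - α) * Λ) * (s - r) ^ (1 - α)))) := by
          gcongr
      _ = _ := by ring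
  have h4 : ‖incr α b σ g X r s - incr α b σ g X' r s‖ ≤
      ‖∫ u in r..s, (b u (X u) - b u (X' u))‖ +
      (‖vecStieltjes α r s (fun u => σ u (X u) - σ u (X' u)) g -
        WithLp.toLp 2 ((σ r (X r) - σ r (X' r)) *ᵥ (g s - g r).ofLp)‖ +
        ‖WithLp.toLp 2 ((σ r (X r) - σ r (X' r)) *ᵥ (g s - g r).ofLp)‖) := by
    have e1 : incr α b σ g X r s - incr α b σ g X' r s =
        (∫ u in r..s, (b u (X u) - b u (X' u))) +
        vecStieltjes α r s (fun u => σ u (X u) - σ u (X' u)) g := by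
      rw [intervalIntegral.integral_sub (h.intervalIntegrable_b hX hτ hτ' hr hrs hs)
        (h.intervalIntegrable_b hX' hτ hτ' hr hrs hs),
        hg.vecStieltjes_sub ((hσh hA hX hτ hτ' le_rfl (hε.trans hε1)).mono hr hs)
          ((hσh hA hX' hτ hτ' le_rfl (hε.trans hε1)).mono hr hs) h.α_pos h.α_lt_one h.α_lt_expo
          (hτ.trans hr) hrs (hs.trans hτ')]
      unfold incr
      abel
    rw [e1]
    refine (norm_add_le _ _).trans (add_le_add le_rfl ?_)
    have := norm_add_le (vecStieltjes α r s (fun u => σ u (X u) - σ u (X' u)) g -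
      WithLp.toLp 2 ((σ r (X r) - σ r (X' r)) *ᵥ (g s - g r).ofLp))
      (WithLp.toLp 2 ((σ r (X r) - σ r (X' r)) *ᵥ (g s - g r).ofLp))
    rwa [sub_add_cancel] at this
  refine h4.trans ((add_le_add h1 (add_le_add h2 h3)).trans ?_)
  rw [← add_mul, ← add_mul]
  gcongr
  have hN1 : N ≤ ‖X τ - X' τ‖ + ε ^ a * C := by
    rw [hN]; nlinarith
  calc L * N + (Y * Λ * (M * C + B * N) * ε ^ a +
        d * (k * (M₀ * (k * (1 / (1 - α) * Λ)))) * N)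
      = (L + d * (k * (M₀ * (k * (1 / (1 - α) * Λ)))) + Y * Λ * B * ε ^ a) * N +
        Y * Λ * M * (ε ^ a * C) := by ring
    _ ≤ E * N + E * (ε ^ a * C) := by
        have e1 : L + d * (k * (M₀ * (k * (1 / (1 - α) * Λ)))) + Y * Λ * B * ε ^ a ≤ E := by
          have e3 : Y * Λ * B * ε ^ a ≤ Y * Λ * B := mul_le_of_le_one_right (by positivity) hεa1
          rw [hE]; linarith [show 0 ≤ Y * Λ * M by positivity]
        have e2 : Y * Λ * M ≤ E := by
          rw [hE]; linarith [show 0 ≤ L + d * (k * (M₀ * (k * (1 / (1 - α) * Λ)))) by positivity,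
            show 0 ≤ Y * Λ * B by positivity]
        gcongr
    _ ≤ E * (‖X τ - X' τ‖ + ε ^ a * C) + E * (‖X τ - X' τ‖ + ε ^ a * C) := by
        have e3 : ε ^ a * C ≤ ‖X τ - X' τ‖ + ε ^ a * C := by
          linarith [norm_nonneg (X τ - X' τ)]
        gcongr
    _ = _ := by ring

end Regular

/-! ### Solutions of the equation driven by a fixed path -/

/-- If a Hölder bound with constant `C` always improves to `C / 2 + D`, then it holds with
constant `2 * D`. -/
lemma HolderOn.absorb {F : Type*} [NormedAddCommGroup F] {a τ τ' C₀ D : ℝ} {X : ℝ → F}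
    (hD : 0 ≤ D) (h0 : HolderOn C₀ a τ τ' X)
    (step : ∀ C ≥ 0, HolderOn C a τ τ' X → HolderOn (C / 2 + D) a τ τ' X) :
    HolderOn (2 * D) a τ τ' X := by
  -- `2 * D` is the fixed point of `C ↦ C / 2 + D`, and the excess over it is halved at each step.
  have key : ∀ n : ℕ, HolderOn (2 * D + |C₀| * (1 / 2) ^ n) a τ τ' X := by
    intro n
    induction n with
    | zero => exact h0.mono_const (by simp; linarith [le_abs_self C₀])
    | succ n ih =>
      refine (step _ (by positivity) ih).mono_const (le_of_eq ?_)
      rw [pow_succ]; ring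
  intro u hu v hv
  have h1 : Tendsto (fun n : ℕ => (2 * D + |C₀| * (1 / 2) ^ n) * |u - v| ^ a) atTop
      (𝓝 ((2 * D + |C₀| * 0) * |u - v| ^ a)) :=
    (((tendsto_pow_atTop_nhds_zero_of_lt_one (by norm_num) (by norm_num)).const_mul _).const_add
      _).mul_const _
  have h2 := ge_of_tendsto' h1 fun n => key n u hu v hv
  simpa using h2

/-- It suffices to check a Hölder bound on ordered pairs. -/
lemma holderOn_of_le {F : Type*} [NormedAddCommGroup F] {C a τ τ' : ℝ} {X : ℝ → F}
    (h : ∀ r s, τ ≤ r → r ≤ s → s ≤ τ' → ‖X s - X r‖ ≤ C * (s - r) ^ a) :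
    HolderOn C a τ τ' X := by
  intro u hu v hv
  rcases le_total u v with huv | hvu
  · rw [norm_sub_rev, abs_sub_comm, abs_of_nonneg (sub_nonneg.2 huv)]
    exact h u v hu.1 huv hv.2
  · rw [abs_of_nonneg (sub_nonneg.2 hvu)]
    exact h v u hv.1 hvu hu.2

/-- Chooses the interval length on which the Hölder constant appears with factor at most `1/2`. -/
lemma exists_small_rpow (D : ℝ) {a : ℝ} (ha : 0 < a) :
    ∃ ε > 0, ε ≤ 1 ∧ D * ε ^ a ≤ 1 / 2 := by
  have h1 : Tendsto (fun ε : ℝ => D * ε ^ a) (𝓝[>] 0) (𝓝 0) := by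
    have : Continuous fun ε : ℝ => D * ε ^ a :=
      continuous_const.mul (continuous_id.rpow_const fun _ => Or.inr ha.le)
    have h3 := (this.tendsto 0).mono_left (nhdsWithin_le_nhds (s := Ioi 0))
    simpa [Real.zero_rpow ha.ne'] using h3
  have h2 := h1.eventually (gt_mem_nhds (show (0 : ℝ) < 1 / 2 by norm_num))
  obtain ⟨ε, hε, h3⟩ := (h2.and (Ioc_mem_nhdsGT (show (0 : ℝ) < 1 by norm_num))).exists
  exact ⟨ε, h3.1, h3.2, hε.le⟩

namespace Regular

variable {d k : ℕ} {T α β δ μ Λ C t r s S τ τ' ε : ℝ}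
  {b : ℝ → EuclideanSpace ℝ (Fin d) → EuclideanSpace ℝ (Fin d)}
  {σ : ℝ → EuclideanSpace ℝ (Fin d) → Matrix (Fin d) (Fin k) ℝ}
  {g : ℝ → EuclideanSpace ℝ (Fin k)} {X X' : ℝ → EuclideanSpace ℝ (Fin d)}
  {x x' : EuclideanSpace ℝ (Fin d)}

lemma isSolution_iff :
    IsSolution α S b σ g t x X ↔ (∃ C, HolderOn C (1 - α) t S X) ∧
      ∀ s ∈ Icc t S, X s = x + incr α b σ g X t s := by
  constructor
  · rintro ⟨h1, h2⟩
    exact ⟨h1, fun s hs => by rw [h2 s hs, incr, add_assoc]⟩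
  · rintro ⟨h1, h2⟩
    exact ⟨h1, fun s hs => by rw [h2 s hs, incr, add_assoc]⟩

lemma eq_start (hX : IsSolution α S b σ g t x X) (htS : t ≤ S) : X t = x := by
  rw [(isSolution_iff.1 hX).2 t ⟨le_rfl, htS⟩, incr_self, add_zero]

lemma sub_eq_incr (h : Regular T α β δ μ b σ) (hg : Driver α T Λ g)
    (hX : IsSolution α S b σ g t x X) (ht : 0 ≤ t) (hS : S ≤ T) (hr : t ≤ r) (hrs : r ≤ s)
    (hs : s ≤ S) : X s - X r = incr α b σ g X r s := by
  obtain ⟨⟨C, hC⟩, he⟩ := isSolution_iff.1 hX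
  rw [he s ⟨hr.trans hrs, hs⟩, he r ⟨hr, hrs.trans hs⟩,
    ← h.incr_add hg hC ht hS le_rfl hr hrs hs]
  abel

lemma restrict (h : Regular T α β δ μ b σ) (hg : Driver α T Λ g)
    (hX : IsSolution α S b σ g t x X) (ht : 0 ≤ t) (hS : S ≤ T) (hr : t ≤ r) (hs : s ≤ S) :
    IsSolution α s b σ g r (X r) X := by
  obtain ⟨⟨C, hC⟩, he⟩ := isSolution_iff.1 hX
  refine isSolution_iff.2 ⟨⟨C, hC.mono hr hs⟩, fun u hu => ?_⟩
  rw [← h.sub_eq_incr hg hX ht hS hr hu.1 (hu.2.trans hs)]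
  abel

/-- A priori estimate on small intervals. -/
lemma exists_local_bound (h : Regular T α β δ μ b σ) (Λ : ℝ) :
    ∃ D ≥ 0, ∃ ε > 0, ε ≤ 1 ∧ ∀ {g : ℝ → EuclideanSpace ℝ (Fin k)} {t S τ τ' : ℝ}
      {x : EuclideanSpace ℝ (Fin d)} {X : ℝ → EuclideanSpace ℝ (Fin d)}, Driver α T Λ g →
      IsSolution α S b σ g t x X → 0 ≤ t → S ≤ T → t ≤ τ → τ' ≤ S → τ' - τ ≤ ε →
      HolderOn (D * (1 + ‖X τ‖)) (1 - α) τ τ' X ∧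
      ∀ u ∈ Icc τ τ', 1 + ‖X u‖ ≤ 2 * (1 + ‖X τ‖) := by
  obtain ⟨D, hD, hinc⟩ := h.exists_incr_bound Λ
  obtain ⟨ε, hε, hε1, hDε⟩ := exists_small_rpow (2 * D) h.expo_pos
  refine ⟨2 * D, by positivity, ε, hε, hε1,
    fun {g t S τ τ' x X} hg hX ht hS htτ hτ' hττ => ?_⟩
  obtain ⟨⟨C₀, hC₀⟩, -⟩ := isSolution_iff.1 hX
  have hD' : D * ε ^ expo α β δ ≤ 1 / 2 := by
    have : 0 ≤ D * ε ^ expo α β δ := by positivity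
    linarith
  -- The equation turns a Hölder constant `C` into at most `C / 2 + D (1 + ‖X τ‖)`, so the unknown
  -- constant `C₀` of the solution disappears from the estimate.
  have key : HolderOn (2 * (D * (1 + ‖X τ‖))) (1 - α) τ τ' X := by
    refine HolderOn.absorb (by positivity) (hC₀.mono htτ hτ') fun C hC hXC => ?_
    refine holderOn_of_le fun r s hr hrs hs => ?_
    rw [h.sub_eq_incr hg hX ht hS (htτ.trans hr) hrs (hs.trans hτ')]
    refine (hinc hg hC hXC (ht.trans htτ) (hτ'.trans hS) hττ hε.le hε1 r s hr hrs hs).trans ?_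
    have h1 : 0 ≤ (s - r) ^ (1 - α) := Real.rpow_nonneg (sub_nonneg.2 hrs) _
    gcongr
    rw [mul_add, ← mul_assoc]
    have := mul_le_mul_of_nonneg_right hD' hC
    linarith
  rw [← mul_assoc] at key
  refine ⟨key, fun u hu => ?_⟩
  have h1 := key.norm_le (by positivity) h.one_sub_pos.le hττ hu
  have h2 : ε ^ (1 - α) ≤ ε ^ expo α β δ :=
    Real.rpow_le_rpow_of_exponent_ge hε hε1 h.expo_le
  have h3 : 2 * D * (1 + ‖X τ‖) * ε ^ (1 - α) ≤ 1 / 2 * (1 + ‖X τ‖) := by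
    calc _ = 2 * D * ε ^ (1 - α) * (1 + ‖X τ‖) := by ring
      _ ≤ 2 * D * ε ^ expo α β δ * (1 + ‖X τ‖) := by gcongr
      _ ≤ _ := by gcongr
  linarith [norm_nonneg (X τ)]

/-- A quantity that at most doubles over intervals of length `ε` is bounded on `[0,T]`. -/
lemma le_two_pow_mul {ε t S : ℝ} {f : ℝ → ℝ} (hε : 0 < ε) (hf : 0 ≤ f t)
    (hstep : ∀ τ τ', t ≤ τ → τ ≤ τ' → τ' ≤ S → τ' - τ ≤ ε → f τ' ≤ 2 * f τ) (n : ℕ) :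
    ∀ s ∈ Icc t S, s ≤ t + n * ε → f s ≤ 2 ^ n * f t := by
  induction n with
  | zero =>
    intro s hs hs'
    have : s = t := le_antisymm (by simpa using hs') hs.1
    simp [this]
  | succ n ih =>
    intro s hs hs'
    push_cast at hs'
    rcases le_total s (t + n * ε) with h1 | h1
    · refine (ih s hs h1).trans ?_
      rw [pow_succ]
      nlinarith [show 0 ≤ (2 : ℝ) ^ n * f t by positivity]
    · have h2 : t ≤ t + n * ε := by
        have : 0 ≤ n * ε := by positivity
        linarith
      have h3 := ih (t + n * ε) ⟨h2, h1.trans hs.2⟩ le_rfl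
      have h4 := hstep (t + n * ε) s h2 h1 hs.2 (by linarith)
      rw [pow_succ]
      linarith

/-- The number of doublings is about `T / ε` and does not depend on `t`, `S` or `f`, which makes the
resulting constants uniform over drivers and solutions. -/
lemma exists_le_two_pow (T : ℝ) {ε : ℝ} (hε : 0 < ε) : ∃ n : ℕ, ∀ {t S : ℝ} {f : ℝ → ℝ},
    0 ≤ t → S ≤ T → 0 ≤ f t →
    (∀ τ τ', t ≤ τ → τ ≤ τ' → τ' ≤ S → τ' - τ ≤ ε → f τ' ≤ 2 * f τ) →
    ∀ s ∈ Icc t S, f s ≤ 2 ^ n * f t := by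
  refine ⟨⌈T / ε⌉₊, fun {t S f} ht hS hf hstep s hs => ?_⟩
  refine le_two_pow_mul hε hf hstep _ s hs ?_
  have h1 := Nat.le_ceil (T / ε)
  rw [div_le_iff₀ hε] at h1
  linarith [hs.2]

/-- Global a priori estimate. -/
theorem exists_bound (h : Regular T α β δ μ b σ) (Λ R : ℝ) :
    ∃ C ≥ 0, ∀ {g : ℝ → EuclideanSpace ℝ (Fin k)} {t S : ℝ} {x : EuclideanSpace ℝ (Fin d)}
      {X : ℝ → EuclideanSpace ℝ (Fin d)}, Driver α T Λ g → IsSolution α S b σ g t x X →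
      0 ≤ t → t ≤ S → S ≤ T → ‖x‖ ≤ R →
      (∀ s ∈ Icc t S, ‖X s‖ ≤ C) ∧ HolderOn C (1 - α) t S X := by
  obtain ⟨D, hD, ε, hε, hε1, hloc⟩ := h.exists_local_bound Λ
  obtain ⟨n, hn⟩ := exists_le_two_pow T hε
  set B := 2 ^ n * (1 + |R|) with hB
  have hB0 : 0 ≤ B := by positivity
  refine ⟨B + D * (1 + B) + 2 * B / ε ^ (1 - α), by positivity,
    fun {g t S x X} hg hX ht htS hS hx => ?_⟩
  have hst := eq_start hX htS
  have h1 : ∀ s ∈ Icc t S, ‖X s‖ ≤ B := by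
    intro s hs
    have := hn (f := fun u => 1 + ‖X u‖) ht hS (by positivity)
      (fun τ τ' h1 h2 h3 h4 => (hloc hg hX ht hS h1 h3 h4).2 τ' ⟨h2, le_rfl⟩) s hs
    simp only [hst] at this
    have h2 : (2 : ℝ) ^ n * (1 + ‖x‖) ≤ B := by
      rw [hB]
      gcongr
      exact hx.trans (le_abs_self R)
    linarith
  have e1 : 0 ≤ D * (1 + B) := by positivity
  have e2 : 0 ≤ 2 * B / ε ^ (1 - α) := by positivity
  refine ⟨fun s hs => (h1 s hs).trans (by linarith), holderOn_of_le fun r s hr hrs hs => ?_⟩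
  have h0 : 0 ≤ (s - r) ^ (1 - α) := Real.rpow_nonneg (sub_nonneg.2 hrs) _
  rcases le_total (s - r) ε with hsr | hsr
  · have h2 := (hloc hg hX ht hS hr hs hsr).1 s ⟨hrs, le_rfl⟩ r ⟨le_rfl, hrs⟩
    rw [abs_of_nonneg (sub_nonneg.2 hrs)] at h2
    refine h2.trans ?_
    gcongr
    have h3 := h1 r ⟨hr, hrs.trans hs⟩
    have : D * (1 + ‖X r‖) ≤ D * (1 + B) := by gcongr
    linarith
  -- For `s - r ≥ ε` the sup bound suffices, since `(s - r) ^ (1 - α)` is bounded below. This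
  -- produces the term `2 * B / ε ^ (1 - α)`.
  · have h2 : ‖X s - X r‖ ≤ 2 * B := (norm_sub_le _ _).trans (by
      linarith [h1 s ⟨hr.trans hrs, hs⟩, h1 r ⟨hr, hrs.trans hs⟩])
    have h3 : ε ^ (1 - α) ≤ (s - r) ^ (1 - α) := Real.rpow_le_rpow hε.le hsr h.one_sub_pos.le
    have h4 : 0 < ε ^ (1 - α) := Real.rpow_pos_of_pos hε _
    calc _ ≤ 2 * B := h2
      _ = 2 * B / ε ^ (1 - α) * ε ^ (1 - α) := by field_simp
      _ ≤ 2 * B / ε ^ (1 - α) * (s - r) ^ (1 - α) := by gcongr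
      _ ≤ _ := by gcongr; linarith

/-- Lipschitz dependence of solutions on the initial value. -/
theorem exists_lipschitz (h : Regular T α β δ μ b σ) (Λ R : ℝ) :
    ∃ C ≥ 0, ∀ {g : ℝ → EuclideanSpace ℝ (Fin k)} {t S : ℝ} {x x' : EuclideanSpace ℝ (Fin d)}
      {X X' : ℝ → EuclideanSpace ℝ (Fin d)}, Driver α T Λ g → IsSolution α S b σ g t x X →
      IsSolution α S b σ g t x' X' → 0 ≤ t → t ≤ S → S ≤ T → ‖x‖ ≤ R → ‖x'‖ ≤ R →
      ∀ s ∈ Icc t S, ‖X s - X' s‖ ≤ C * ‖x - x'‖ := by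
  obtain ⟨A, hA, hbd⟩ := h.exists_bound Λ R
  -- The a priori constant `A` bounds both the size and the Hölder constant of every solution from
  -- the ball of radius `R`, so local estimates on `b` and `σ` apply.
  obtain ⟨D, hD, hinc⟩ := h.exists_incr_sub_bound Λ A A hA
  obtain ⟨ε, hε, hε1, hDε⟩ := exists_small_rpow (2 * D) h.expo_pos
  obtain ⟨n, hn⟩ := exists_le_two_pow T hε
  refine ⟨2 ^ n, by positivity, fun {g t S x x' X X'} hg hX hX' ht htS hS hx hx' s hs => ?_⟩
  rw [← eq_start hX htS, ← eq_start hX' htS]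
  refine hn (f := fun u => ‖X u - X' u‖) ht hS (norm_nonneg _) ?_ s hs
  intro τ τ' htτ hττ' hτ' hττ
  obtain ⟨hB, hH⟩ := hbd hg hX ht htS hS hx
  obtain ⟨hB', hH'⟩ := hbd hg hX' ht htS hS hx'
  have hD' : D * ε ^ expo α β δ ≤ 1 / 2 := by
    have : 0 ≤ D * ε ^ expo α β δ := by positivity
    linarith
  have hmem : ∀ u ∈ Icc τ τ', u ∈ Icc t S := fun u hu => ⟨htτ.trans hu.1, hu.2.trans hτ'⟩
  have key : HolderOn (2 * (D * ‖X τ - X' τ‖)) (1 - α) τ τ' (fun u => X u - X' u) := by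
    refine HolderOn.absorb (C₀ := A + A) (by positivity) (fun u hu v hv => ?_)
      fun C hC hXC => ?_
    · have e1 : X u - X' u - (X v - X' v) = (X u - X v) - (X' u - X' v) := by abel
      rw [e1, add_mul]
      exact (norm_sub_le _ _).trans (add_le_add (hH u (hmem u hu) v (hmem v hv))
        (hH' u (hmem u hu) v (hmem v hv)))
    refine holderOn_of_le fun r s hr hrs hs => ?_
    have e1 : X s - X' s - (X r - X' r) = (X s - X r) - (X' s - X' r) := by abel
    rw [e1, h.sub_eq_incr hg hX ht hS (htτ.trans hr) hrs (hs.trans hτ'),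
      h.sub_eq_incr hg hX' ht hS (htτ.trans hr) hrs (hs.trans hτ')]
    refine (hinc hg hC (hH.mono htτ hτ') (hH'.mono htτ hτ') (fun u hu => hB u (hmem u hu))
      (fun u hu => hB' u (hmem u hu)) hXC (ht.trans htτ) (hτ'.trans hS) hττ hε.le hε1 r s hr hrs
      hs).trans ?_
    have h1 : 0 ≤ (s - r) ^ (1 - α) := Real.rpow_nonneg (sub_nonneg.2 hrs) _
    gcongr
    rw [mul_add, ← mul_assoc]
    have := mul_le_mul_of_nonneg_right hD' hC
    linarith
  have h1 := key.norm_le (by positivity) h.one_sub_pos.le hττ (right_mem_Icc.2 hττ')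
  have h2 : ε ^ (1 - α) ≤ ε ^ expo α β δ :=
    Real.rpow_le_rpow_of_exponent_ge hε hε1 h.expo_le
  have h3 : 2 * (D * ‖X τ - X' τ‖) * ε ^ (1 - α) ≤ 1 / 2 * ‖X τ - X' τ‖ := by
    calc _ = 2 * D * ε ^ (1 - α) * ‖X τ - X' τ‖ := by ring
      _ ≤ 2 * D * ε ^ expo α β δ * ‖X τ - X' τ‖ := by gcongr
      _ ≤ _ := by gcongr
  linarith [norm_nonneg (X τ - X' τ)]

/-- Local existence by Picard iteration. -/
theorem exists_local_solution (h : Regular T α β δ μ b σ) (Λ R : ℝ) :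
    ∃ ε > 0, ∀ {g : ℝ → EuclideanSpace ℝ (Fin k)} {t S : ℝ} {x : EuclideanSpace ℝ (Fin d)},
      Driver α T Λ g → 0 ≤ t → t ≤ S → S ≤ T → S - t ≤ ε → ‖x‖ ≤ R →
      ∃ X, IsSolution α S b σ g t x X := by
  obtain ⟨D, hD, hinc⟩ := h.exists_incr_bound Λ
  -- With `D * ε ^ expo ≤ 1/2`, the bound `A / 2 + D * (1 + |R|)` for the next iterate equals `A`,
  -- so the Hölder ball of radius `A` is preserved.
  set A := 2 * (D * (1 + |R|)) with hA
  have hA0 : 0 ≤ A := by positivity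
  obtain ⟨D', hD'0, hinc'⟩ := h.exists_incr_sub_bound Λ (|R| + A) A hA0
  obtain ⟨ε, hε, hε1, hDε⟩ := exists_small_rpow (D + D') h.expo_pos
  refine ⟨ε, hε, fun {g t S x} hg ht htS hS hSt hx => ?_⟩
  have hx' : ‖x‖ ≤ |R| := hx.trans (le_abs_self R)
  have hεa : 0 ≤ ε ^ expo α β δ := by positivity
  have hDa : D * ε ^ expo α β δ ≤ 1 / 2 := by nlinarith
  have hDa' : D' * ε ^ expo α β δ ≤ 1 / 2 := by nlinarith
  set Y : ℕ → ℝ → EuclideanSpace ℝ (Fin d) := fun n =>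
    (fun X s => x + incr α b σ g X t s)^[n] (fun _ => x) with hY
  have hYs : ∀ n s, Y (n + 1) s = x + incr α b σ g (Y n) t s := fun n s => by
    simp only [hY, Function.iterate_succ', Function.comp]
  have hYt : ∀ n, Y n t = x := by
    intro n
    cases n with
    | zero => rfl
    | succ n => rw [hYs, incr_self, add_zero]
  have hYinc : ∀ n {C : ℝ}, HolderOn C (1 - α) t S (Y n) → ∀ r s, t ≤ r → r ≤ s → s ≤ S →
      Y (n + 1) s - Y (n + 1) r = incr α b σ g (Y n) r s := by
    intro n C hC r s hr hrs hs
    rw [hYs, hYs, ← h.incr_add hg hC ht hS le_rfl hr hrs hs]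
    abel
  have hYH : ∀ n, HolderOn A (1 - α) t S (Y n) := by
    intro n
    induction n with
    | zero =>
      intro u _ v _
      simp only [hY, Function.iterate_zero, id, sub_self, norm_zero]
      positivity
    | succ n ih =>
      refine holderOn_of_le fun r s hr hrs hs => ?_
      rw [hYinc n ih r s hr hrs hs]
      refine (hinc hg hA0 ih ht hS hSt hε.le hε1 r s hr hrs hs).trans ?_
      have h1 : 0 ≤ (s - r) ^ (1 - α) := Real.rpow_nonneg (sub_nonneg.2 hrs) _
      gcongr
      rw [hYt, mul_add, ← mul_assoc]
      have e1 := mul_le_mul_of_nonneg_right hDa hA0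
      have e2 : D * (1 + ‖x‖) ≤ D * (1 + |R|) := by gcongr
      linarith
  have hε1p : ε ^ (1 - α) ≤ 1 := Real.rpow_le_one hε.le hε1 h.one_sub_pos.le
  have hYB : ∀ n, ∀ u ∈ Icc t S, ‖Y n u‖ ≤ |R| + A := by
    intro n u hu
    refine ((hYH n).norm_le hA0 h.one_sub_pos.le hSt hu).trans ?_
    rw [hYt]
    exact add_le_add hx' (mul_le_of_le_one_right hA0 hε1p)
  -- Picard differences contract by `1/2` in the Hölder seminorm. All iterates start at `x`, so the
  -- initial value term of `hinc'` vanishes.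
  have hYd : ∀ n, HolderOn (2 * A * (1 / 2) ^ n) (1 - α) t S (fun u => Y (n + 1) u - Y n u) := by
    intro n
    induction n with
    | zero =>
      intro u hu v hv
      have e1 : Y (0 + 1) u - Y 0 u - (Y (0 + 1) v - Y 0 v) =
        (Y (0 + 1) u - Y (0 + 1) v) - (Y 0 u - Y 0 v) := by abel
      have e2 : 2 * A * (1 / 2) ^ 0 = A + A := by ring
      simp only at e1 ⊢
      rw [e1, e2, add_mul]
      exact (norm_sub_le _ _).trans (add_le_add (hYH _ u hu v hv) (hYH _ u hu v hv))
    | succ n ih =>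
      refine holderOn_of_le fun r s hr hrs hs => ?_
      have e1 : Y (n + 1 + 1) s - Y (n + 1) s - (Y (n + 1 + 1) r - Y (n + 1) r) =
        (Y (n + 1 + 1) s - Y (n + 1 + 1) r) - (Y (n + 1) s - Y (n + 1) r) := by abel
      rw [e1, hYinc _ (hYH _) r s hr hrs hs, hYinc _ (hYH _) r s hr hrs hs]
      refine (hinc' hg (by positivity) (hYH _) (hYH _) (hYB _) (hYB _) ih ht hS hSt hε.le hε1
        r s hr hrs hs).trans ?_
      have h1 : 0 ≤ (s - r) ^ (1 - α) := Real.rpow_nonneg (sub_nonneg.2 hrs) _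
      refine mul_le_mul_of_nonneg_right ?_ h1
      rw [hYt, hYt, sub_self, norm_zero, add_zero, ← mul_assoc, pow_succ]
      have e2 := mul_le_mul_of_nonneg_right hDa' (show 0 ≤ 2 * A * (1 / 2) ^ n by positivity)
      linarith
  have hgeo : ∀ u ∈ Icc t S, ∀ v ∈ Icc t S, ∀ n,
      dist (Y n u - Y n v) (Y (n + 1) u - Y (n + 1) v) ≤
        2 * A * |u - v| ^ (1 - α) * (1 / 2) ^ n := by
    intro u hu v hv n
    rw [dist_comm, dist_eq_norm]
    have e1 : Y (n + 1) u - Y (n + 1) v - (Y n u - Y n v) =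
      (Y (n + 1) u - Y n u) - (Y (n + 1) v - Y n v) := by abel
    rw [e1]
    refine (hYd n u hu v hv).trans (le_of_eq (by ring))
  have hlim : ∀ u ∈ Icc t S, ∃ L, Tendsto (fun n => Y n u) atTop (𝓝 L) := by
    intro u hu
    -- Only differences `Y n u - Y n v` are known to be Cauchy. Taking `v = t`, where every iterate
    -- equals `x`, gives convergence of the values.
    have h1 := cauchySeq_of_le_geometric (1 / 2) _ (by norm_num)
      (hgeo u hu t (left_mem_Icc.2 htS))
    obtain ⟨L, hL⟩ := cauchySeq_tendsto_of_complete h1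
    refine ⟨L + x, (hL.add_const x).congr fun n => ?_⟩
    rw [hYt]
    abel
  choose! X hX using hlim
  have hXd : ∀ n, HolderOn (4 * A * (1 / 2) ^ n) (1 - α) t S (fun u => Y n u - X u) := by
    intro n u hu v hv
    have h1 := dist_le_of_le_geometric_of_tendsto (1 / 2) _ (by norm_num)
      (hgeo u hu v hv) ((hX u hu).sub (hX v hv)) n
    rw [dist_eq_norm] at h1
    have e1 : Y n u - X u - (Y n v - X v) = Y n u - Y n v - (X u - X v) := by abel
    simp only at e1 ⊢
    rw [e1]
    refine h1.trans (le_of_eq ?_)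
    ring
  have hXH : HolderOn A (1 - α) t S X := fun u hu v hv =>
    le_of_tendsto ((hX u hu).sub (hX v hv)).norm
      (Eventually.of_forall fun n => hYH n u hu v hv)
  have hXB : ∀ u ∈ Icc t S, ‖X u‖ ≤ |R| + A := fun u hu =>
    le_of_tendsto (hX u hu).norm (Eventually.of_forall fun n => hYB n u hu)
  have hXt : X t = x := by
    refine tendsto_nhds_unique (hX t (left_mem_Icc.2 htS)) ?_
    simp only [hYt]
    exact tendsto_const_nhds
  refine ⟨X, isSolution_iff.2 ⟨⟨A, hXH⟩, fun s hs => ?_⟩⟩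
  have h1 : Tendsto (fun n => incr α b σ g (Y n) t s) atTop (𝓝 (incr α b σ g X t s)) := by
    rw [tendsto_iff_norm_sub_tendsto_zero]
    have h2 : Tendsto (fun n : ℕ => D' * (ε ^ expo α β δ * (4 * A * (1 / 2) ^ n) + 0) *
        (s - t) ^ (1 - α)) atTop
        (𝓝 (D' * (ε ^ expo α β δ * (4 * A * 0) + 0) * (s - t) ^ (1 - α))) :=
      (((((tendsto_pow_atTop_nhds_zero_of_lt_one (by norm_num) (by norm_num)).const_mul
        _).const_mul _).add_const _).const_mul _).mul_const _
    simp only [mul_zero, add_zero, zero_mul] at h2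
    refine squeeze_zero (fun _ => norm_nonneg _) (fun n => ?_) h2
    have h3 := hinc' hg (by positivity) (hYH n) hXH (hYB n) hXB (hXd n) ht hS hSt hε.le hε1
      t s le_rfl hs.1 hs.2
    rwa [hYt, hXt, sub_self, norm_zero, add_zero] at h3
  refine tendsto_nhds_unique ((tendsto_add_atTop_iff_nat 1).2 (hX s hs)) ?_
  simp only [hYs]
  exact h1.const_add x

/-- Concatenation of solutions. -/
lemma glue (h : Regular T α β δ μ b σ) (hg : Driver α T Λ g)
    (hX : IsSolution α r b σ g t x X) (hX' : IsSolution α S b σ g r (X r) X') (ht : 0 ≤ t)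
    (htr : t ≤ r) (hrS : r ≤ S) (hS : S ≤ T) :
    IsSolution α S b σ g t x (fun u => if u ≤ r then X u else X' u) := by
  obtain ⟨⟨C, hC⟩, he⟩ := isSolution_iff.1 hX
  obtain ⟨⟨C', hC'⟩, he'⟩ := isSolution_iff.1 hX'
  set W := fun u => if u ≤ r then X u else X' u with hW
  have hX'r : X' r = X r := eq_start hX' hrS
  have hW1 : ∀ u ≤ r, W u = X u := fun u hu => if_pos hu
  have hW2 : ∀ u, r ≤ u → W u = X' u := fun u hu => by
    rcases hu.eq_or_lt with rfl | hu
    · rw [hW1 _ le_rfl, hX'r]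
    · exact if_neg (not_le.2 hu)
  have hWH : HolderOn (|C| + |C'|) (1 - α) t S W := by
    refine holderOn_of_le fun u v hu huv hv => ?_
    have h0 : 0 ≤ (v - u) ^ (1 - α) := Real.rpow_nonneg (sub_nonneg.2 huv) _
    have hm := h.one_sub_pos
    rcases le_total v r with hvr | hvr
    · rw [hW1 v hvr, hW1 u (huv.trans hvr)]
      have := hC.abs_const v ⟨hu.trans huv, hvr⟩ u ⟨hu, huv.trans hvr⟩
      rw [abs_of_nonneg (sub_nonneg.2 huv)] at this
      refine this.trans ?_
      gcongr
      linarith [abs_nonneg C']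
    rcases le_total r u with hru | hru
    · rw [hW2 v hvr, hW2 u hru]
      have := hC'.abs_const v ⟨hvr, hv⟩ u ⟨hru, huv.trans hv⟩
      rw [abs_of_nonneg (sub_nonneg.2 huv)] at this
      refine this.trans ?_
      gcongr
      linarith [abs_nonneg C]
    · rw [hW2 v hvr, hW1 u hru]
      have e1 := hC'.abs_const v ⟨hvr, hv⟩ r ⟨le_rfl, hrS⟩
      have e2 := hC.abs_const r ⟨htr, le_rfl⟩ u ⟨hu, hru⟩
      rw [abs_of_nonneg (sub_nonneg.2 hvr), hX'r] at e1
      rw [abs_of_nonneg (sub_nonneg.2 hru)] at e2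
      have e3 : X' v - X u = (X r - X u) + (X' v - X r) := by abel
      have e4 : (v - r) ^ (1 - α) ≤ (v - u) ^ (1 - α) :=
        Real.rpow_le_rpow (sub_nonneg.2 hvr) (by linarith) hm.le
      have e5 : (r - u) ^ (1 - α) ≤ (v - u) ^ (1 - α) :=
        Real.rpow_le_rpow (sub_nonneg.2 hru) (by linarith) hm.le
      rw [e3, add_mul]
      refine (norm_add_le _ _).trans (add_le_add (e2.trans ?_) (e1.trans ?_))
      · gcongr
      · gcongr
  refine isSolution_iff.2 ⟨⟨_, hWH⟩, fun s hs => ?_⟩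
  rcases le_total s r with hsr | hsr
  · rw [hW1 s hsr, he s ⟨hs.1, hsr⟩,
      incr_congr hs.1 fun u hu => (hW1 u (hu.2.trans hsr)).symm]
  · rw [hW2 s hsr, he' s ⟨hsr, hs.2⟩, ← h.incr_add hg hWH ht hS le_rfl htr hsr hs.2,
      he r ⟨htr, le_rfl⟩, incr_congr htr fun u hu => (hW1 u hu.2).symm,
      incr_congr hsr fun u hu => (hW2 u hu.1).symm, add_assoc]

/-- Global existence. -/
theorem exists_solution (h : Regular T α β δ μ b σ) (hg : Driver α T Λ g) (ht : 0 ≤ t)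
    (htT : t ≤ T) (x : EuclideanSpace ℝ (Fin d)) : ∃ X, IsSolution α T b σ g t x X := by
  obtain ⟨C, hC, hbd⟩ := h.exists_bound Λ ‖x‖
  obtain ⟨ε, hε, hloc⟩ := h.exists_local_solution Λ C
  -- The a priori bound `C` holds at every intermediate time, so the same step length `ε` can be
  -- used for each extension.
  have key : ∀ n : ℕ, ∃ X, IsSolution α (min (t + n * ε) T) b σ g t x X := by
    intro n
    induction n with
    | zero =>
      refine ⟨fun _ => x, isSolution_iff.2 ⟨⟨0, fun u _ v _ => by simp⟩, fun s hs => ?_⟩⟩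
      have : s = t := le_antisymm (hs.2.trans (by simp)) hs.1
      rw [this, incr_self, add_zero]
    | succ n ih =>
      obtain ⟨X, hX⟩ := ih
      set r := min (t + n * ε) T with hr
      have hnε : 0 ≤ n * ε := by positivity
      have htr : t ≤ r := le_min (by linarith) htT
      have hrT : r ≤ T := min_le_right _ _
      have hrS : r ≤ min (t + (n + 1 : ℕ) * ε) T := by
        push_cast
        exact min_le_min (by linarith) le_rfl
      have hXr := (hbd hg hX ht htr hrT le_rfl).1 r ⟨htr, le_rfl⟩
      obtain ⟨X', hX'⟩ := hloc hg (ht.trans htr) hrS (min_le_right _ _) (by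
        push_cast
        rw [sub_le_iff_le_add', hr]
        rcases le_total (t + n * ε) T with h1 | h1
        · rw [min_eq_left h1]
          exact (min_le_left _ _).trans (by linarith)
        · rw [min_eq_right h1]
          exact (min_le_right _ _).trans (by linarith)) hXr
      exact ⟨_, h.glue hg hX hX' ht htr hrS (min_le_right _ _)⟩
  obtain ⟨n, hn⟩ := exists_nat_ge (T / ε)
  rw [div_le_iff₀ hε] at hn
  obtain ⟨X, hX⟩ := key n
  rw [min_eq_right (by linarith)] at hX
  exact ⟨X, hX⟩

end Regular

/-! ### The flow of the equation and its first order expansion -/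

/-- The first order expansion of the equation. -/
def eulerStep {d k : ℕ}
    (b : ℝ → EuclideanSpace ℝ (Fin d) → EuclideanSpace ℝ (Fin d))
    (σ : ℝ → EuclideanSpace ℝ (Fin d) → Matrix (Fin d) (Fin k) ℝ)
    (g : ℝ → EuclideanSpace ℝ (Fin k)) (t s : ℝ) (x : EuclideanSpace ℝ (Fin d)) :
    EuclideanSpace ℝ (Fin d) :=
  x + (s - t) • b t x + WithLp.toLp 2 (σ t x *ᵥ (g s - g t).ofLp)

/-- The gain `γ` in the first order expansion of the equation. -/
def gain (α β δ μ : ℝ) : ℝ := min (expo α β δ - α) μ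

open Classical in
/-- The solution on `[t,T]` started from `x` at time `t`. -/
def flow {d k : ℕ} (α T : ℝ)
    (b : ℝ → EuclideanSpace ℝ (Fin d) → EuclideanSpace ℝ (Fin d))
    (σ : ℝ → EuclideanSpace ℝ (Fin d) → Matrix (Fin d) (Fin k) ℝ)
    (g : ℝ → EuclideanSpace ℝ (Fin k)) (t : ℝ) (x : EuclideanSpace ℝ (Fin d)) :
    ℝ → EuclideanSpace ℝ (Fin d) :=
  if h : ∃ X, IsSolution α T b σ g t x X then h.choose else fun _ => 0

namespace Regular

variable {d k : ℕ} {T α β δ μ Λ C t r s S τ τ' ε : ℝ}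
  {b : ℝ → EuclideanSpace ℝ (Fin d) → EuclideanSpace ℝ (Fin d)}
  {σ : ℝ → EuclideanSpace ℝ (Fin d) → Matrix (Fin d) (Fin k) ℝ}
  {g : ℝ → EuclideanSpace ℝ (Fin k)} {X X' : ℝ → EuclideanSpace ℝ (Fin d)}
  {x x' : EuclideanSpace ℝ (Fin d)}

lemma gain_pos (h : Regular T α β δ μ b σ) : 0 < gain α β δ μ :=
  lt_min (sub_pos.2 h.α_lt_expo) h.μ_pos

lemma gain_lt_one (h : Regular T α β δ μ b σ) : gain α β δ μ < 1 :=
  (min_le_left _ _).trans_lt (by linarith [h.expo_le, h.α_pos])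

lemma rpow_le_rpow_gain {x q q' : ℝ} (hx : 0 ≤ x) (hx1 : x ≤ 1) (hq : 0 < q) (hqq : q ≤ q') :
    x ^ q' ≤ x ^ q := by
  rcases hx.eq_or_lt with rfl | hx
  · rw [Real.zero_rpow hq.ne', Real.zero_rpow (by linarith)]
  · exact Real.rpow_le_rpow_of_exponent_ge hx hx1 hqq

lemma isSolution_flow (h : Regular T α β δ μ b σ) (hg : Driver α T Λ g) (ht : t ∈ Icc 0 T)
    (x : EuclideanSpace ℝ (Fin d)) : IsSolution α T b σ g t x (flow α T b σ g t x) := by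
  have he := h.exists_solution hg ht.1 ht.2 x
  rw [flow, dif_pos he]
  exact he.choose_spec

/-- Uniqueness is the Lipschitz estimate with equal initial values. It makes the choice in `flow`
irrelevant on `[t,T]`. -/
lemma eq_flow (h : Regular T α β δ μ b σ) (hg : Driver α T Λ g) (ht : t ∈ Icc 0 T)
    (hX : IsSolution α T b σ g t x X) (hs : s ∈ Icc t T) : X s = flow α T b σ g t x s := by
  obtain ⟨C, -, hC⟩ := h.exists_lipschitz Λ ‖x‖
  have := hC hg hX (h.isSolution_flow hg ht x) ht.1 ht.2 le_rfl le_rfl le_rfl s hs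
  rw [sub_self, norm_zero, mul_zero] at this
  exact sub_eq_zero.1 (norm_le_zero_iff.1 this)

lemma flow_self (h : Regular T α β δ μ b σ) (hg : Driver α T Λ g) (ht : t ∈ Icc 0 T)
    (x : EuclideanSpace ℝ (Fin d)) : flow α T b σ g t x t = x :=
  eq_start (h.isSolution_flow hg ht x) ht.2

/-- The restriction of a solution solves the equation from its later value, and uniqueness
identifies it with the flow from there. -/
lemma flow_flow (h : Regular T α β δ μ b σ) (hg : Driver α T Λ g) (ht : t ∈ Icc 0 T)
    (x : EuclideanSpace ℝ (Fin d)) (hr : t ≤ r) (hrs : r ≤ s) (hs : s ≤ T) :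
    flow α T b σ g r (flow α T b σ g t x r) s = flow α T b σ g t x s :=
  (h.eq_flow hg ⟨ht.1.trans hr, hrs.trans hs⟩
    (h.restrict hg (h.isSolution_flow hg ht x) ht.1 le_rfl hr le_rfl) ⟨hrs, hs⟩).symm

lemma exists_flow_bound (h : Regular T α β δ μ b σ) (Λ R : ℝ) :
    ∃ C ≥ 0, ∀ {g : ℝ → EuclideanSpace ℝ (Fin k)} {t : ℝ} {x : EuclideanSpace ℝ (Fin d)},
      Driver α T Λ g → t ∈ Icc 0 T → ‖x‖ ≤ R →
      (∀ s ∈ Icc t T, ‖flow α T b σ g t x s‖ ≤ C) ∧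
        HolderOn C (1 - α) t T (flow α T b σ g t x) := by
  obtain ⟨C, hC, hb⟩ := h.exists_bound Λ R
  exact ⟨C, hC, fun hg ht hx => hb hg (h.isSolution_flow hg ht _) ht.1 ht.2 le_rfl hx⟩

/-- Lipschitz dependence of the flow on the initial value. -/
lemma exists_flow_lipschitz (h : Regular T α β δ μ b σ) (Λ R : ℝ) :
    ∃ C ≥ 0, ∀ {g : ℝ → EuclideanSpace ℝ (Fin k)} {t : ℝ} {x x' : EuclideanSpace ℝ (Fin d)},
      Driver α T Λ g → t ∈ Icc 0 T → ‖x‖ ≤ R → ‖x'‖ ≤ R → ∀ s ∈ Icc t T,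
      ‖flow α T b σ g t x s - flow α T b σ g t x' s‖ ≤ C * ‖x - x'‖ := by
  obtain ⟨C, hC, hb⟩ := h.exists_lipschitz Λ R
  exact ⟨C, hC, fun hg ht hx hx' s hs => hb hg (h.isSolution_flow hg ht _)
    (h.isSolution_flow hg ht _) ht.1 ht.2 le_rfl hx hx' s hs⟩

/-- Dependence of the flow on the initial time and the initial value. -/
lemma exists_flow_continuity (h : Regular T α β δ μ b σ) (Λ R : ℝ) :
    ∃ C ≥ 0, ∀ {g : ℝ → EuclideanSpace ℝ (Fin k)} {t t' : ℝ}
      {x x' : EuclideanSpace ℝ (Fin d)}, Driver α T Λ g → 0 ≤ t → t ≤ t' → t' ≤ T →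
      ‖x‖ ≤ R → ‖x'‖ ≤ R → ∀ s ∈ Icc t' T,
      ‖flow α T b σ g t x s - flow α T b σ g t' x' s‖ ≤
        C * (‖x - x'‖ + (t' - t) ^ (1 - α)) := by
  obtain ⟨A, hA, hb⟩ := h.exists_flow_bound Λ R
  obtain ⟨L, hL, hl⟩ := h.exists_flow_lipschitz Λ (max R A)
  refine ⟨L * (1 + A), by positivity, fun {g t t' x x'} hg ht htt ht' hx hx' s hs => ?_⟩
  have htm : t ∈ Icc 0 T := ⟨ht, htt.trans ht'⟩
  obtain ⟨hB, hH⟩ := hb hg htm hx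
  -- Both trajectories are restarted at `t'`. The first one has moved by at most `A (t' - t) ^ (1 -
  -- α)` by then.
  rw [← h.flow_flow hg htm x htt hs.1 hs.2]
  have h1 := hH t' ⟨htt, ht'⟩ t ⟨le_rfl, htt.trans ht'⟩
  rw [h.flow_self hg htm, abs_of_nonneg (sub_nonneg.2 htt)] at h1
  have h2 : 0 ≤ (t' - t) ^ (1 - α) := Real.rpow_nonneg (sub_nonneg.2 htt) _
  refine (hl hg ⟨ht.trans htt, ht'⟩ ((hB t' ⟨htt, ht'⟩).trans (le_max_right _ _))
    (hx'.trans (le_max_left _ _)) s hs).trans ?_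
  rw [mul_assoc]
  refine mul_le_mul_of_nonneg_left ?_ hL
  have h3 := norm_add_le (flow α T b σ g t x t' - x) (x - x')
  rw [sub_add_sub_cancel] at h3
  nlinarith [norm_nonneg (x - x'), mul_nonneg hA (norm_nonneg (x - x'))]

/-- First order expansion of the flow: size and regularity of the remainder. -/
theorem exists_remainder_bound (h : Regular T α β δ μ b σ) (Λ R : ℝ) :
    ∃ C > 0, ∀ {g : ℝ → EuclideanSpace ℝ (Fin k)} {t : ℝ} {x : EuclideanSpace ℝ (Fin d)},
      Driver α T Λ g → t ∈ Icc 0 T → ‖x‖ ≤ R →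
      HolderOn C (1 - α) t (min (t + 1) T)
        (fun s => flow α T b σ g t x s - eulerStep b σ g t s x) ∧
      ∀ s ∈ Icc t (min (t + 1) T), ‖flow α T b σ g t x s - eulerStep b σ g t s x‖ ≤
        C * (s - t) ^ (1 + gain α β δ μ) := by
  obtain ⟨A, hA, hb⟩ := h.exists_flow_bound Λ R
  obtain ⟨M, hM, hσ⟩ := h.entryHolder_sigma
  obtain ⟨S, hS, hσS⟩ := h.sigma_growth
  obtain ⟨L, hL, hbL⟩ := h.b_growth
  obtain ⟨L', hL', hbL'⟩ := h.b_holder A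
  set Y := youngConst d k α (expo α β δ)
  have hY : 0 ≤ Y := youngConst_nonneg d k h.α_pos h.α_lt_expo
  have hp := h.one_sub_pos
  have hγ := h.gain_pos
  set C₁ := A + L * (1 + |R|) + d * (k * (S * (1 + |R|) * (k * (1 / (1 - α) * |Λ|))))
  set C₂ := L' * (1 + A) + Y * M * (1 + A) * |Λ|
  have hC₁ : 0 ≤ C₁ := by positivity
  have hC₂ : 0 ≤ C₂ := by positivity
  refine ⟨C₁ + C₂ + 1, by positivity, fun {g t x} hg ht hx => ?_⟩
  have hΛ := hg.nonneg h.α_lt_one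
  have hx' : ‖x‖ ≤ |R| := hx.trans (le_abs_self R)
  obtain ⟨hB, hH⟩ := hb hg ht hx
  have hT' : min (t + 1) T ≤ T := min_le_right _ _
  constructor
  · refine holderOn_of_le fun r s hr hrs hs => ?_
    have hs1 : s ≤ t + 1 := hs.trans (min_le_left _ _)
    have hsT : s ≤ T := hs.trans hT'
    have h0 : 0 ≤ s - r := sub_nonneg.2 hrs
    have h01 : 0 ≤ (s - r) ^ (1 - α) := Real.rpow_nonneg h0 _
    have e1 : flow α T b σ g t x s - eulerStep b σ g t s x -
        (flow α T b σ g t x r - eulerStep b σ g t r x) =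
        (flow α T b σ g t x s - flow α T b σ g t x r) - (s - r) • b t x -
          WithLp.toLp 2 (σ t x *ᵥ (g s - g r).ofLp) := by
      have e2 : σ t x *ᵥ (g s - g r).ofLp =
          σ t x *ᵥ (g s - g t).ofLp - σ t x *ᵥ (g r - g t).ofLp := by
        rw [← Matrix.mulVec_sub]
        congr 1
        ext i
        simp
      rw [e2, WithLp.toLp_sub]
      simp only [eulerStep, sub_smul]
      abel
    have e2 := hH s ⟨hr.trans hrs, hsT⟩ r ⟨hr, hrs.trans hsT⟩
    rw [abs_of_nonneg h0] at e2
    have e3 : ‖(s - r) • b t x‖ ≤ L * (1 + |R|) * (s - r) ^ (1 - α) := by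
      rw [norm_smul, Real.norm_of_nonneg h0, mul_comm]
      have e4 := rpow_le_rpow_gain h0 (by linarith) hp (show 1 - α ≤ 1 by linarith [h.α_pos])
      rw [Real.rpow_one] at e4
      have e5 := hbL t ht x
      refine mul_le_mul (e5.trans (by gcongr)) e4 h0 (by positivity)
    have e4 : ‖WithLp.toLp 2 (σ t x *ᵥ (g s - g r).ofLp)‖ ≤
        d * (k * (S * (1 + |R|) * (k * (1 / (1 - α) * |Λ|)))) * (s - r) ^ (1 - α) := by
      have e5 := norm_toLp_mulVec_le (A := σ t x) (c := S * (1 + |R|)) (fun i j =>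
        (hσS t ht x i j).trans (by gcongr)) (g s - g r)
      refine e5.trans ?_
      have e6 := hg.norm_sub_le h.α_pos h.α_lt_one (ht.1.trans hr) hrs hsT
      rw [abs_of_nonneg hΛ]
      calc _ ≤ (d : ℝ) * (k * (S * (1 + |R|) * (k * (1 / (1 - α) * Λ) * (s - r) ^ (1 - α)))) := by
            gcongr
        _ = _ := by ring
    rw [e1]
    have e5 := norm_sub_le (flow α T b σ g t x s - flow α T b σ g t x r - (s - r) • b t x)
      (WithLp.toLp 2 (σ t x *ᵥ (g s - g r).ofLp))
    have e6 := norm_sub_le (flow α T b σ g t x s - flow α T b σ g t x r) ((s - r) • b t x)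
    calc _ ≤ C₁ * (s - r) ^ (1 - α) := by
          simp only [C₁, add_mul] at *
          linarith
      _ ≤ _ := by gcongr; linarith
  · intro s hs
    have hs1 : s ≤ t + 1 := hs.2.trans (min_le_left _ _)
    have hsT : s ≤ T := hs.2.trans hT'
    have h0 : 0 ≤ s - t := sub_nonneg.2 hs.1
    have hst1 : s - t ≤ 1 := by linarith
    have hXt := h.flow_self hg ht x
    have e1 : flow α T b σ g t x s - eulerStep b σ g t s x =
        (∫ u in t..s, (b u (flow α T b σ g t x u) - b t x)) +
        (vecStieltjes α t s (fun u => σ u (flow α T b σ g t x u)) g -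
          WithLp.toLp 2 (σ t (flow α T b σ g t x t) *ᵥ (g s - g t).ofLp)) := by
      rw [intervalIntegral.integral_sub (h.intervalIntegrable_b hH ht.1 le_rfl le_rfl hs.1 hsT)
        intervalIntegrable_const, hXt,
        (h.isSolution_flow hg ht x).equation s ⟨hs.1, hsT⟩, eulerStep,
        intervalIntegral.integral_const]
      abel
    have e2 : ‖∫ u in t..s, (b u (flow α T b σ g t x u) - b t x)‖ ≤
        L' * (1 + A) * (s - t) ^ (1 + gain α β δ μ) := by
      have e3 := intervalIntegral.norm_integral_le_of_norm_le_const (a := t) (b := s)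
        (f := fun u => b u (flow α T b σ g t x u) - b t x)
        (C := L' * (1 + A) * (s - t) ^ gain α β δ μ) (fun u hu => by
          rw [uIoc_of_le hs.1] at hu
          have hu' : u ∈ Icc t T := ⟨hu.1.le, hu.2.trans hsT⟩
          have hut : 0 ≤ u - t := sub_nonneg.2 hu.1.le
          have hut1 : u - t ≤ 1 := by linarith [hu.2]
          have e4 := hbL' u ⟨ht.1.trans hu'.1, hu'.2⟩ t ht _ x (hB u hu') (by
            have := hB t ⟨le_rfl, ht.2⟩
            rwa [hXt] at this)
          refine e4.trans ?_
          have e5 := hH u hu' t ⟨le_rfl, ht.2⟩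
          rw [hXt, abs_of_nonneg hut] at e5
          rw [abs_of_nonneg hut]
          have e6 := rpow_le_rpow_gain hut hut1 hγ (min_le_right (expo α β δ - α) μ)
          have e7 := rpow_le_rpow_gain hut hut1 hγ (show gain α β δ μ ≤ 1 - α from
            (min_le_left _ _).trans (by linarith [h.expo_le, h.α_pos]))
          have e8 : (u - t) ^ gain α β δ μ ≤ (s - t) ^ gain α β δ μ :=
            Real.rpow_le_rpow hut (by linarith [hu.2]) hγ.le
          rw [mul_assoc]
          refine mul_le_mul_of_nonneg_left ?_ hL'
          have e9 := mul_le_mul_of_nonneg_left (e7.trans e8) hA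
          have e10 := e6.trans e8
          linarith)
      refine e3.trans (le_of_eq ?_)
      rw [abs_of_nonneg h0, Real.rpow_add_of_nonneg h0 zero_le_one hγ.le, Real.rpow_one]
      ring
    have e3 : ‖vecStieltjes α t s (fun u => σ u (flow α T b σ g t x u)) g -
          WithLp.toLp 2 (σ t (flow α T b σ g t x t) *ᵥ (g s - g t).ofLp)‖ ≤
        Y * M * (1 + A) * |Λ| * (s - t) ^ (1 + gain α β δ μ) := by
      have e4 := hg.norm_vecStieltjes_sub_le (hσ hA (hH.mono le_rfl hsT) ht.1 hsT le_rfl hst1)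
        (by positivity) h.α_pos h.α_lt_one h.α_lt_expo ht.1 hs.1 hsT
      refine e4.trans ?_
      -- The exponent `expo + (1 - α)` equals `1 + (expo - α)`, which is why `gain` contains `expo -
      -- α`; its other entry `μ` comes from the drift.
      have e5 := rpow_le_rpow_gain (q := 1 + gain α β δ μ) (q' := expo α β δ + (1 - α)) h0 hst1
        (by linarith) (by linarith [show gain α β δ μ ≤ expo α β δ - α from min_le_left _ _])
      rw [abs_of_nonneg hΛ]
      calc _ = Y * M * (1 + A) * Λ * (s - t) ^ (expo α β δ + (1 - α)) := by ring
        _ ≤ _ := by gcongr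
    rw [e1]
    have e4 : 0 ≤ (s - t) ^ (1 + gain α β δ μ) := Real.rpow_nonneg h0 _
    calc _ ≤ C₂ * (s - t) ^ (1 + gain α β δ μ) := by
          refine (norm_add_le _ _).trans ((add_le_add e2 e3).trans (le_of_eq ?_))
          simp only [C₂]
          ring
      _ ≤ _ := by gcongr; linarith

/-! ### Pathwise viability -/

/-- Pathwise viability: the flow stays in a left-closed tube that approximately contains the
first order expansion of the equation. -/
theorem flow_mem (h : Regular T α β δ μ b σ) (hg : Driver α T Λ g)
    {K : ℝ → Set (EuclideanSpace ℝ (Fin d))} (hK : ∀ t ∈ Icc 0 T, IsClosed (K t))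
    (hKl : LeftClosed T K)
    (hc : ∀ t ∈ Icc 0 T, ∀ y ∈ K t, ∃ e > 0, ∃ c γ : ℝ, 0 < γ ∧ ∀ s ∈ Icc t (min (t + e) T),
      ∃ z ∈ K s, ‖z - eulerStep b σ g t s y‖ ≤ c * (s - t) ^ (1 + γ))
    (ht : t ∈ Icc 0 T) (hx : x ∈ K t) (hs : s ∈ Icc t T) :
    flow α T b σ g t x s ∈ K s := by
  have hsT : s ∈ Icc 0 T := ⟨ht.1.trans hs.1, hs.2⟩
  obtain ⟨B, hB0, hB⟩ : ∃ B ≥ 0, ∀ u ∈ Icc t T, ‖flow α T b σ g t x u‖ ≤ B := by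
    obtain ⟨B, hB0, hB⟩ := h.exists_flow_bound Λ ‖x‖
    exact ⟨B, hB0, (hB hg ht le_rfl).1⟩
  -- approximation of the flow by points of the tube
  suffices key : ∀ η > 0, ∃ y ∈ K s, ‖flow α T b σ g t x s - y‖ ≤ η * (s - t) by
    rw [← (hK s hsT).closure_eq, Metric.mem_closure_iff]
    intro ε hε
    have hpos : 0 < s - t + 1 := by linarith [hs.1]
    obtain ⟨y, hy, hyd⟩ := key (ε / (s - t + 1)) (by positivity)
    refine ⟨y, hy, ?_⟩
    rw [dist_eq_norm]
    refine hyd.trans_lt ?_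
    rw [div_mul_eq_mul_div, div_lt_iff₀ hpos]
    nlinarith
  intro η hη
  -- Times reached by a point of the tube whose forward trajectory stays within `η * (τ - t)` of the
  -- given one. Measuring the error along the trajectories up to `s` lets the errors of successive
  -- steps simply add up.
  set A := {τ | τ ∈ Icc t s ∧ ∃ y ∈ K τ, ∀ u ∈ Icc τ s,
    ‖flow α T b σ g t x u - flow α T b σ g τ y u‖ ≤ η * (τ - t)} with hA
  have htA : t ∈ A := ⟨⟨le_rfl, hs.1⟩, x, hx, fun u _ => by simp⟩
  have hAb : BddAbove A := ⟨s, fun τ hτ => hτ.1.2⟩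
  set m := sSup A with hm
  have htm : t ≤ m := le_csSup hAb htA
  have hms : m ≤ s := csSup_le ⟨t, htA⟩ fun τ hτ => hτ.1.2
  have hmT : m ∈ Icc 0 T := ⟨ht.1.trans htm, hms.trans hs.2⟩
  -- The supremum is attained: otherwise it is approached by times `u n < m` in `A`, whose bounded
  -- points `y n` have a convergent subsequence.
  have hmA : m ∈ A := by
    by_contra hmA
    obtain ⟨u, -, hu, huA⟩ := exists_seq_tendsto_sSup ⟨t, htA⟩ hAb
    have hum : ∀ n, u n < m := fun n =>
      lt_of_le_of_ne (le_csSup hAb (huA n)) fun he => hmA (he ▸ huA n)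
    choose hut y hyK hy using huA
    have huT : ∀ n, u n ∈ Icc 0 T := fun n => ⟨ht.1.trans (hut n).1, (hut n).2.trans hs.2⟩
    have hyB : ∀ n, ‖y n‖ ≤ B + η * (s - t) := by
      intro n
      have h1 := hy n (u n) ⟨le_rfl, (hut n).2⟩
      rw [h.flow_self hg (huT n)] at h1
      have h2 := hB (u n) ⟨(hut n).1, (huT n).2⟩
      have h3 := norm_sub_norm_le (y n) (flow α T b σ g t x (u n))
      rw [norm_sub_rev] at h3
      have h4 : η * (u n - t) ≤ η * (s - t) := by
        have := (hut n).2
        gcongr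
      linarith
    obtain ⟨y₀, hy₀, φ, hφ, hlim⟩ := (isCompact_closedBall (0 : EuclideanSpace ℝ (Fin d))
      (B + η * (s - t))).tendsto_subseq (x := y) fun n => by simpa using hyB n
    have huφ := hu.comp hφ.tendsto_atTop
    -- The only use of left-closedness. The remaining condition on `y₀` follows from continuity of
    -- the flow in its starting time and point.
    have hy₀K : y₀ ∈ K m := hKl m hmT y₀ (u ∘ φ) (y ∘ φ)
      (fun n => ⟨(huT _).1, hum _⟩) (fun n => hyK _) huφ hlim
    obtain ⟨C, hC, hcont⟩ := h.exists_flow_continuity Λ (B + η * (s - t))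
    refine hmA ⟨⟨htm, hms⟩, y₀, hy₀K, fun v hv => ?_⟩
    have hle : ∀ n, ‖flow α T b σ g t x v - flow α T b σ g m y₀ v‖ ≤
        η * (u (φ n) - t) + C * (‖y (φ n) - y₀‖ + (m - u (φ n)) ^ (1 - α)) := by
      intro n
      have h1 := hy (φ n) v ⟨(hum _).le.trans hv.1, hv.2⟩
      have h2 := hcont hg (huT (φ n)).1 (hum (φ n)).le hmT.2 (hyB (φ n))
        (show ‖y₀‖ ≤ _ by simpa using hy₀) v ⟨hv.1, hv.2.trans hs.2⟩
      have h3 := norm_add_le (flow α T b σ g t x v - flow α T b σ g (u (φ n)) (y (φ n)) v)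
        (flow α T b σ g (u (φ n)) (y (φ n)) v - flow α T b σ g m y₀ v)
      rw [sub_add_sub_cancel] at h3
      linarith
    have hlim2 : Tendsto (fun n => η * (u (φ n) - t) +
        C * (‖y (φ n) - y₀‖ + (m - u (φ n)) ^ (1 - α))) atTop
        (𝓝 (η * (m - t) + C * (0 + (m - m) ^ (1 - α)))) := by
      refine ((huφ.sub_const t).const_mul η).add (((tendsto_iff_norm_sub_tendsto_zero.1
        hlim).add ?_).const_mul C)
      exact (huφ.const_sub m).rpow_const (Or.inr h.one_sub_pos.le)
    rw [sub_self, Real.zero_rpow h.one_sub_pos.ne', add_zero, mul_zero, add_zero] at hlim2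
    exact ge_of_tendsto' hlim2 hle
  rcases hms.eq_or_lt with hmeq | hmlt
  · rw [hmeq] at hmA
    obtain ⟨-, y, hyK, hy⟩ := hmA
    refine ⟨y, hyK, ?_⟩
    have := hy s ⟨le_rfl, le_rfl⟩
    rwa [h.flow_self hg hsT] at this
  -- If `m < s`, one contingent step of small length `e` from `y` lands in `K (m + e)` with error
  -- `o(e)`, hence within the additional budget `η * e`, and `m + e` contradicts maximality.
  exfalso
  obtain ⟨-, y, hyK, hy⟩ := hmA
  obtain ⟨e₀, he₀, c, γ, hγ, hstep⟩ := hc m hmT y hyK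
  obtain ⟨By, hBy0, hBy⟩ := h.exists_flow_bound Λ ‖y‖
  obtain ⟨C₁, hC₁, hrem⟩ := h.exists_remainder_bound Λ ‖y‖
  -- For `e ≤ 1` this ball contains both the flow from `y` at time `m + e` and the nearby tube point
  -- `z`.
  obtain ⟨C₂, hC₂, hlip⟩ := h.exists_flow_lipschitz Λ (By + |c| + C₁)
  have hsmall : Tendsto (fun e : ℝ => C₂ * (|c| * e ^ γ + C₁ * e ^ gain α β δ μ)) (𝓝[>] 0)
      (𝓝 0) := by
    have hc1 : Continuous fun e : ℝ => e ^ γ := continuous_id.rpow_const fun _ => Or.inr hγ.le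
    have hc2 : Continuous fun e : ℝ => e ^ gain α β δ μ :=
      continuous_id.rpow_const fun _ => Or.inr h.gain_pos.le
    have : Continuous fun e : ℝ => C₂ * (|c| * e ^ γ + C₁ * e ^ gain α β δ μ) := by fun_prop
    have h3 := (this.tendsto 0).mono_left (nhdsWithin_le_nhds (s := Ioi 0))
    simpa [Real.zero_rpow hγ.ne', Real.zero_rpow h.gain_pos.ne'] using h3
  have hpos : 0 < min (min e₀ 1) (s - m) :=
    lt_min (lt_min he₀ one_pos) (sub_pos.2 hmlt)
  obtain ⟨e, he1, he2⟩ := ((hsmall.eventually (gt_mem_nhds hη)).and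
    (Ioc_mem_nhdsGT hpos)).exists
  have he0 : 0 < e := he2.1
  have hee₀ : e ≤ e₀ := he2.2.trans ((min_le_left _ _).trans (min_le_left _ _))
  have hee1 : e ≤ 1 := he2.2.trans ((min_le_left _ _).trans (min_le_right _ _))
  have hes : m + e ≤ s := by linarith [he2.2.trans (min_le_right _ _)]
  have heT : m + e ≤ T := hes.trans hs.2
  obtain ⟨z, hzK, hz⟩ := hstep (m + e) ⟨by linarith, le_min (by linarith) heT⟩
  obtain ⟨-, hrem'⟩ := hrem hg hmT (le_refl ‖y‖)
  have hr := hrem' (m + e) ⟨by linarith, le_min (by linarith) heT⟩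
  rw [add_sub_cancel_left] at hz hr
  have hz' : ‖z - eulerStep b σ g m (m + e) y‖ ≤ |c| * e ^ (1 + γ) :=
    hz.trans (by gcongr; exact le_abs_self c)
  have hd : ‖flow α T b σ g m y (m + e) - z‖ ≤
      C₁ * e ^ (1 + gain α β δ μ) + |c| * e ^ (1 + γ) := by
    have h1 := norm_sub_le (flow α T b σ g m y (m + e) - eulerStep b σ g m (m + e) y)
      (z - eulerStep b σ g m (m + e) y)
    rw [sub_sub_sub_cancel_right] at h1
    linarith
  have hf := (hBy hg hmT le_rfl).1 (m + e) ⟨by linarith, heT⟩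
  have hzB : ‖z‖ ≤ By + |c| + C₁ := by
    have h1 : e ^ (1 + γ) ≤ 1 := Real.rpow_le_one he0.le hee1 (by linarith)
    have h2 : e ^ (1 + gain α β δ μ) ≤ 1 :=
      Real.rpow_le_one he0.le hee1 (by linarith [h.gain_pos])
    have h3 := norm_sub_norm_le z (flow α T b σ g m y (m + e))
    rw [norm_sub_rev] at h3
    have h4 := mul_le_of_le_one_right hC₁.le h2
    have h5 := mul_le_of_le_one_right (abs_nonneg c) h1
    linarith
  have hmem : m + e ∈ A := by
    refine ⟨⟨by linarith, hes⟩, z, hzK, fun u hu => ?_⟩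
    have h1 := hy u ⟨by linarith [hu.1], hu.2⟩
    have h2 := hlip hg (t := m + e) ⟨by linarith [hmT.1], heT⟩
      (hf.trans (by linarith [abs_nonneg c])) hzB u ⟨hu.1, hu.2.trans hs.2⟩
    rw [h.flow_flow hg hmT y (by linarith) hu.1 (hu.2.trans hs.2)] at h2
    have h3 := norm_add_le (flow α T b σ g t x u - flow α T b σ g m y u)
      (flow α T b σ g m y u - flow α T b σ g (m + e) z u)
    rw [sub_add_sub_cancel] at h3
    have h4 : C₂ * ‖flow α T b σ g m y (m + e) - z‖ ≤ η * e := by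
      calc _ ≤ C₂ * (C₁ * e ^ (1 + gain α β δ μ) + |c| * e ^ (1 + γ)) := by gcongr
        _ = C₂ * (|c| * e ^ γ + C₁ * e ^ gain α β δ μ) * e := by
          rw [Real.rpow_add he0, Real.rpow_add he0, Real.rpow_one]; ring
        _ ≤ _ := by gcongr
    linarith
  linarith [le_csSup hAb hmem]

/-! ### The Euler scheme -/

/-- The Euler scheme with step `e` started from `x` at time `t`. -/
def _root_.FracViability.euler {d k : ℕ}
    (b : ℝ → EuclideanSpace ℝ (Fin d) → EuclideanSpace ℝ (Fin d))
    (σ : ℝ → EuclideanSpace ℝ (Fin d) → Matrix (Fin d) (Fin k) ℝ)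
    (g : ℝ → EuclideanSpace ℝ (Fin k)) (t e : ℝ) (x : EuclideanSpace ℝ (Fin d)) :
    ℕ → EuclideanSpace ℝ (Fin d)
  | 0 => x
  | i + 1 => eulerStep b σ g (t + i * e) (t + (i + 1 : ℕ) * e) (euler b σ g t e x i)

/-- Convergence of the Euler scheme to the flow. -/
theorem tendsto_euler (h : Regular T α β δ μ b σ) (hg : Driver α T Λ g) (ht : t ∈ Icc 0 T)
    (x : EuclideanSpace ℝ (Fin d)) (hs : s ∈ Icc t T) :
    Tendsto (fun n : ℕ => euler b σ g t ((s - t) / (n + 1)) x (n + 1)) atTop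
      (𝓝 (flow α T b σ g t x s)) := by
  obtain ⟨B, hB0, hB⟩ := h.exists_flow_bound Λ ‖x‖
  obtain ⟨C₁, hC₁, hrem⟩ := h.exists_remainder_bound Λ (B + 1)
  obtain ⟨B', hB'0, hB'⟩ := h.exists_flow_bound Λ (B + 1)
  obtain ⟨C₂, hC₂, hlip⟩ := h.exists_flow_lipschitz Λ (B' + C₁)
  set γ := gain α β δ μ with hγdef
  have hγ : 0 < γ := h.gain_pos
  have hst : 0 ≤ s - t := sub_nonneg.2 hs.1
  have hB1 := (hB hg ht le_rfl).1
  -- The scheme is compared with the flow by restarting the exact flow at each Euler point. A step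
  -- creates an error `C₁ * e ^ (1 + γ)`, transported with factor `C₂`. The smallness condition on
  -- `e` keeps all Euler points in the ball of radius `B + 1`, where `C₁` is valid.
  have key : ∀ e : ℝ, 0 ≤ e → e ≤ 1 → C₂ * C₁ * ((s - t) * e ^ γ) ≤ 1 → ∀ i : ℕ,
      i * e ≤ s - t → ∀ u ∈ Icc (t + i * e) T,
      ‖flow α T b σ g (t + i * e) (euler b σ g t e x i) u - flow α T b σ g t x u‖ ≤
        C₂ * C₁ * (i * e * e ^ γ) := by
    intro e he he1 hsm i
    induction i with
    | zero =>
      intro _ u _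
      simp [euler]
    | succ i ih =>
      intro hi u hu
      have hie : (i : ℝ) * e ≤ s - t := by
        push_cast at hi
        linarith
      have hie0 : (0 : ℝ) ≤ i * e := by positivity
      have htiT : t + i * e ∈ Icc 0 T := ⟨by linarith [ht.1], by linarith [hs.2]⟩
      have hcast : t + (i + 1 : ℕ) * e = t + i * e + e := by push_cast; ring
      have hti1T : t + (i + 1 : ℕ) * e ≤ T := by linarith [hs.2]
      set y := euler b σ g t e x i with hy
      have ih' := ih hie
      have hyB : ‖y‖ ≤ B + 1 := by
        have h1 := ih' (t + i * e) ⟨le_rfl, htiT.2⟩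
        rw [h.flow_self hg htiT] at h1
        have h2 := hB1 (t + i * e) ⟨by linarith, htiT.2⟩
        have h3 : C₂ * C₁ * (i * e * e ^ γ) ≤ C₂ * C₁ * ((s - t) * e ^ γ) := by gcongr
        have h4 := norm_sub_norm_le y (flow α T b σ g t x (t + i * e))
        linarith
      have h1 := (hrem hg htiT hyB).2 (t + (i + 1 : ℕ) * e)
        ⟨by linarith, le_min (by linarith) hti1T⟩
      have h2 := (hB' hg htiT hyB).1 (t + (i + 1 : ℕ) * e) ⟨by linarith, hti1T⟩
      have hes : t + (i + 1 : ℕ) * e - (t + i * e) = e := by rw [hcast]; ring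
      rw [hes] at h1
      have h3 : euler b σ g t e x (i + 1) =
        eulerStep b σ g (t + i * e) (t + (i + 1 : ℕ) * e) y := rfl
      rw [← h3] at h1
      have h4 : ‖euler b σ g t e x (i + 1)‖ ≤ B' + C₁ := by
        have h5 : e ^ (1 + γ) ≤ 1 := Real.rpow_le_one he he1 (by linarith)
        have h6 := norm_sub_norm_le (euler b σ g t e x (i + 1))
          (flow α T b σ g (t + i * e) y (t + (i + 1 : ℕ) * e))
        rw [norm_sub_rev] at h6
        have h7 := mul_le_of_le_one_right hC₁.le h5
        linarith
      have h5 := hlip hg (t := t + (i + 1 : ℕ) * e) ⟨by linarith [htiT.1], hti1T⟩ h4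
        (h2.trans (by linarith)) u hu
      rw [h.flow_flow hg htiT y (by linarith) hu.1 hu.2, norm_sub_rev
        (euler b σ g t e x (i + 1))] at h5
      have h6 := ih' u ⟨by linarith [hu.1], hu.2⟩
      have h7 := norm_add_le (flow α T b σ g (t + (i + 1 : ℕ) * e) (euler b σ g t e x (i + 1)) u -
        flow α T b σ g (t + i * e) y u)
        (flow α T b σ g (t + i * e) y u - flow α T b σ g t x u)
      rw [sub_add_sub_cancel] at h7
      have h8 : C₂ * ‖flow α T b σ g (t + i * e) y (t + (i + 1 : ℕ) * e) -
          euler b σ g t e x (i + 1)‖ ≤ C₂ * (C₁ * (e * e ^ γ)) := by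
        rw [Real.rpow_add_of_nonneg he zero_le_one hγ.le, Real.rpow_one] at h1
        gcongr
      have h9 : C₂ * C₁ * (((i + 1 : ℕ) : ℝ) * e * e ^ γ) =
          C₂ * C₁ * (i * e * e ^ γ) + C₂ * (C₁ * (e * e ^ γ)) := by
        push_cast
        ring
      linarith
  have hlim0 : Tendsto (fun n : ℕ => (s - t) / ((n : ℝ) + 1)) atTop (𝓝 0) := by
    have := (tendsto_one_div_add_atTop_nhds_zero_nat (𝕜 := ℝ)).const_mul (s - t)
    simpa [div_eq_mul_inv] using this
  have hlim : Tendsto (fun n : ℕ => C₂ * C₁ * ((s - t) * ((s - t) / ((n : ℝ) + 1)) ^ γ)) atTop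
      (𝓝 0) := by
    have := ((hlim0.rpow_const (p := γ) (Or.inr hγ.le)).const_mul (s - t)).const_mul (C₂ * C₁)
    simpa [Real.zero_rpow hγ.ne'] using this
  rw [tendsto_iff_norm_sub_tendsto_zero]
  refine squeeze_zero' (Eventually.of_forall fun _ => norm_nonneg _) ?_ hlim
  filter_upwards [hlim.eventually (gt_mem_nhds one_pos), hlim0.eventually (gt_mem_nhds one_pos)]
    with n hn1 hn2
  have hn : ((n + 1 : ℕ) : ℝ) * ((s - t) / (n + 1)) = s - t := by
    push_cast
    field_simp
  have hts : t + ((n + 1 : ℕ) : ℝ) * ((s - t) / (n + 1)) = s := by rw [hn]; ring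
  have h1 := key ((s - t) / (n + 1)) (by positivity) hn2.le hn1.le (n + 1) hn.le s
    ⟨hts.le, hs.2⟩
  rw [hts, h.flow_self hg ⟨ht.1.trans hs.1, hs.2⟩, hn] at h1
  exact h1

end Regular

/-! ### The coefficients are regular -/

lemma abs_apply_le_frob {d k : ℕ} (A : Matrix (Fin d) (Fin k) ℝ) (i : Fin d) (j : Fin k) :
    |A i j| ≤ frob A := by
  rw [frob]
  apply Real.abs_le_sqrt
  calc A i j ^ 2 ≤ ∑ j, A i j ^ 2 :=
        Finset.single_le_sum (f := fun j => A i j ^ 2) (fun _ _ => sq_nonneg _) (Finset.mem_univ j)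
    _ ≤ _ := Finset.single_le_sum (f := fun i => ∑ j, A i j ^ 2)
        (fun _ _ => Finset.sum_nonneg fun _ _ => sq_nonneg _) (Finset.mem_univ i)

lemma norm_dual_le {d : ℕ} (L : EuclideanSpace ℝ (Fin d) →L[ℝ] ℝ) {c : ℝ}
    (h : ∀ l, |L (EuclideanSpace.single l 1)| ≤ c) : ∀ v, |L v| ≤ d * c * ‖v‖ := by
  intro v
  have h1 : v = ∑ l, v l • EuclideanSpace.single l (1 : ℝ) := by
    have := (EuclideanSpace.basisFun (Fin d) ℝ).sum_repr v
    simpa using this.symm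
  have h2 : L v = ∑ l, v l * L (EuclideanSpace.single l 1) := by
    conv_lhs => rw [h1]
    simp
  rw [h2]
  refine (Finset.abs_sum_le_sum_abs _ _).trans ?_
  have h3 : ∀ l ∈ (Finset.univ : Finset (Fin d)),
      |v l * L (EuclideanSpace.single l 1)| ≤ ‖v‖ * c := fun l _ => by
    rw [abs_mul]
    exact mul_le_mul (abs_apply_le_norm v l) (h l) (abs_nonneg _) (norm_nonneg _)
  refine (Finset.sum_le_sum h3).trans (le_of_eq ?_)
  simp only [Finset.sum_const, Finset.card_univ, Fintype.card_fin, nsmul_eq_mul]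
  ring

/-- The difference of two increments of functions with comparable derivatives. -/
lemma abs_sub_sub_sub_le {E : Type*} [NormedAddCommGroup E] [NormedSpace ℝ E] {φ ψ : E → ℝ}
    (hφ : Differentiable ℝ φ) (hψ : Differentiable ℝ ψ) {M B : ℝ} (x y x' y' : E)
    (h1 : ∀ z v, |fderiv ℝ φ z v| ≤ M * ‖v‖)
    (h2 : ∀ θ ∈ Icc (0 : ℝ) 1, ∀ v, |fderiv ℝ φ (y + θ • (x - y)) v -
      fderiv ℝ ψ (y' + θ • (x' - y')) v| ≤ B * ‖v‖) :
    |φ x - φ y - (ψ x' - ψ y')| ≤ M * ‖x - y - (x' - y')‖ + B * ‖x' - y'‖ := by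
  -- Both segments are parametrized together. The derivative splits as `Dφ` applied to the
  -- difference of the increments plus `Dφ - Dψ` applied to `x' - y'`, which gives the two terms of
  -- the bound.
  set f : ℝ → ℝ := fun θ => φ (y + θ • (x - y)) - ψ (y' + θ • (x' - y'))
  have hd : ∀ θ : ℝ, HasDerivAt f (fderiv ℝ φ (y + θ • (x - y)) (x - y) -
      fderiv ℝ ψ (y' + θ • (x' - y')) (x' - y')) θ := by
    intro θ
    have e1 : ∀ a b : E, HasDerivAt (fun θ : ℝ => a + θ • b) b θ := fun a b => by
      simpa using ((hasDerivAt_id θ).smul_const b).const_add a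
    exact ((hφ _).hasFDerivAt.comp_hasDerivAt θ (e1 y (x - y))).sub
      ((hψ _).hasFDerivAt.comp_hasDerivAt θ (e1 y' (x' - y')))
  have hb := norm_image_sub_le_of_norm_deriv_le_segment_01' (f := f)
    (C := M * ‖x - y - (x' - y')‖ + B * ‖x' - y'‖)
    (fun θ _ => (hd θ).hasDerivWithinAt) (fun θ hθ => by
      have e1 := h1 (y + θ • (x - y)) (x - y - (x' - y'))
      have e2 := h2 θ ⟨hθ.1, hθ.2.le⟩ (x' - y')
      have e3 := abs_add_le (fderiv ℝ φ (y + θ • (x - y)) (x - y - (x' - y')))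
        (fderiv ℝ φ (y + θ • (x - y)) (x' - y') - fderiv ℝ ψ (y' + θ • (x' - y')) (x' - y'))
      rw [map_sub, sub_add_sub_cancel] at e3
      rw [map_sub] at e1
      rw [Real.norm_eq_abs]
      linarith)
  have e : f 1 - f 0 = φ x - φ y - (ψ x' - ψ y') := by
    simp only [f, one_smul, zero_smul, add_zero, add_sub_cancel]
    ring
  rwa [e, Real.norm_eq_abs] at hb

section

variable {d k : ℕ} {T H β δ α : ℝ}
  {b : ℝ → EuclideanSpace ℝ (Fin d) → EuclideanSpace ℝ (Fin d)}
  {σ : ℝ → EuclideanSpace ℝ (Fin d) → Matrix (Fin d) (Fin k) ℝ}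

lemma H1.exists_entry_lipschitz (hσ : H1 T β δ σ) : ∃ M ≥ 0, ∀ t ∈ Icc 0 T, ∀ s ∈ Icc 0 T,
    ∀ x y, ∀ i j, |σ t x i j - σ s y i j| ≤ M * (|t - s| ^ β + ‖x - y‖) := by
  obtain ⟨M, hM, h⟩ := hσ.lipschitz
  exact ⟨M, hM.le, fun t ht s hs x y i j =>
    (abs_apply_le_frob (σ t x - σ s y) i j).trans (h t ht s hs x y)⟩

lemma H1.exists_growth (hσ : H1 T β δ σ) (hT : 0 < T) :
    ∃ S ≥ 0, ∀ t ∈ Icc 0 T, ∀ x, ∀ i j, |σ t x i j| ≤ S * (1 + ‖x‖) := by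
  obtain ⟨M, hM, h⟩ := hσ.exists_entry_lipschitz
  have hf : 0 ≤ frob (σ 0 0) := Real.sqrt_nonneg _
  refine ⟨M * (T ^ β + 1) + frob (σ 0 0), by positivity, fun t ht x i j => ?_⟩
  have h1 := h t ht 0 ⟨le_rfl, hT.le⟩ x 0 i j
  rw [sub_zero, sub_zero, abs_of_nonneg ht.1] at h1
  have h2 := abs_apply_le_frob (σ 0 0) i j
  have h3 : |σ t x i j| ≤ |σ t x i j - σ 0 0 i j| + |σ 0 0 i j| := by
    have := abs_add_le (σ t x i j - σ 0 0 i j) (σ 0 0 i j)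
    rwa [sub_add_cancel] at this
  have h4 : t ^ β ≤ T ^ β := Real.rpow_le_rpow ht.1 ht.2 hσ.beta_pos.le
  have h5 : 0 ≤ T ^ β := by positivity
  have h6 : M * (t ^ β + ‖x‖) ≤ M * (T ^ β + ‖x‖) := by gcongr
  have h7 := norm_nonneg x
  nlinarith [mul_nonneg hM h7, mul_nonneg (mul_nonneg hM h5) h7, mul_nonneg hf h7]

/-- The gradient is bounded by the global Lipschitz constant and Hölder on the ball of radius `R`,
which is convex and so contains both segments. Corresponding points of the segments are no farther
apart than the worse pair of endpoints. -/
lemma H1.exists_four_point (hσ : H1 T β δ σ) (R : ℝ) :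
    ∃ M ≥ 0, ∀ t ∈ Icc 0 T, ∀ s ∈ Icc 0 T, ∀ x y x' y',
    ‖x‖ ≤ R → ‖y‖ ≤ R → ‖x'‖ ≤ R → ‖y'‖ ≤ R → ∀ i j,
    |σ t x i j - σ t y i j - (σ s x' i j - σ s y' i j)| ≤
      M * ‖x - y - (x' - y')‖ + M * (|t - s| ^ β + ‖x - x'‖ ^ δ + ‖y - y'‖ ^ δ) * ‖x' - y'‖ := by
  obtain ⟨M, hM, hlip⟩ := hσ.exists_entry_lipschitz
  rcases lt_or_ge R 0 with hR | hR
  · exact ⟨0, le_rfl, fun t _ s _ x y x' y' hx => absurd (hx.trans_lt hR)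
      (not_lt.2 (norm_nonneg x))⟩
  obtain ⟨G, hG, hgrad⟩ := hσ.gradient R hR
  have hδ := hσ.delta_pos
  refine ⟨M + d * G, by positivity, fun t ht s hs x y x' y' hx hy hx' hy' i j => ?_⟩
  have hseg : ∀ {u v : EuclideanSpace ℝ (Fin d)} {θ : ℝ}, θ ∈ Icc (0 : ℝ) 1 → ‖u‖ ≤ R →
      ‖v‖ ≤ R → ‖v + θ • (u - v)‖ ≤ R := by
    intro u v θ hθ hu hv
    have e : v + θ • (u - v) = (1 - θ) • v + θ • u := by
      rw [smul_sub, sub_smul, one_smul]; abel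
    rw [e]
    refine (norm_add_le _ _).trans ?_
    rw [norm_smul, norm_smul, Real.norm_of_nonneg hθ.1,
      Real.norm_of_nonneg (sub_nonneg.2 hθ.2)]
    have e1 := mul_le_mul_of_nonneg_left hu hθ.1
    have e2 := mul_le_mul_of_nonneg_left hv (sub_nonneg.2 hθ.2)
    linarith
  have h0 : 0 ≤ |t - s| ^ β + ‖x - x'‖ ^ δ + ‖y - y'‖ ^ δ := by positivity
  have h1 := abs_sub_sub_sub_le (hσ.differentiable t ht i j) (hσ.differentiable s hs i j)
    (M := M) (B := d * (G * (|t - s| ^ β + ‖x - x'‖ ^ δ + ‖y - y'‖ ^ δ))) x y x' y' ?_ ?_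
  · refine h1.trans ?_
    have e1 : M * ‖x - y - (x' - y')‖ ≤ (M + d * G) * ‖x - y - (x' - y')‖ := by
      gcongr
      linarith [show 0 ≤ d * G by positivity]
    have e2 : d * (G * (|t - s| ^ β + ‖x - x'‖ ^ δ + ‖y - y'‖ ^ δ)) * ‖x' - y'‖ ≤
        (M + d * G) * (|t - s| ^ β + ‖x - x'‖ ^ δ + ‖y - y'‖ ^ δ) * ‖x' - y'‖ := by
      rw [← mul_assoc]
      gcongr
      linarith
    linarith
  · intro z v
    have e1 : ‖fderiv ℝ (fun y => σ t y i j) z‖ ≤ M := by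
      refine norm_fderiv_le_of_lip' ℝ hM (Eventually.of_forall fun w => ?_)
      have := hlip t ht t ht w z i j
      rwa [sub_self, abs_zero, Real.zero_rpow hσ.beta_pos.ne', zero_add] at this
    exact ((fderiv ℝ (fun y => σ t y i j) z).le_opNorm v).trans (by gcongr)
  · intro θ hθ v
    set z := y + θ • (x - y)
    set z' := y' + θ • (x' - y')
    have e1 := hgrad t ht s hs z z' (hseg hθ hx hy) (hseg hθ hx' hy')
    have e2 : ‖z - z'‖ ^ δ ≤ ‖x - x'‖ ^ δ + ‖y - y'‖ ^ δ := by
      have e3 : z - z' = (1 - θ) • (y - y') + θ • (x - x') := by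
        simp only [z, z', smul_sub, sub_smul, one_smul]; abel
      have e4 : ‖z - z'‖ ≤ max ‖x - x'‖ ‖y - y'‖ := by
        rw [e3]
        refine (norm_add_le _ _).trans ?_
        rw [norm_smul, norm_smul, Real.norm_of_nonneg hθ.1,
          Real.norm_of_nonneg (sub_nonneg.2 hθ.2)]
        have e5 := mul_le_mul_of_nonneg_left (le_max_left ‖x - x'‖ ‖y - y'‖) hθ.1
        have e6 := mul_le_mul_of_nonneg_left (le_max_right ‖x - x'‖ ‖y - y'‖)
          (sub_nonneg.2 hθ.2)
        linarith
      refine (Real.rpow_le_rpow (norm_nonneg _) e4 hδ.le).trans ?_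
      rcases max_cases ‖x - x'‖ ‖y - y'‖ with ⟨h, -⟩ | ⟨h, -⟩ <;> rw [h]
      · linarith [Real.rpow_nonneg (norm_nonneg (y - y')) δ]
      · linarith [Real.rpow_nonneg (norm_nonneg (x - x')) δ]
    have e3 : ∀ l, |(fderiv ℝ (fun y => σ t y i j) z - fderiv ℝ (fun y => σ s y i j) z')
        (EuclideanSpace.single l 1)| ≤
        G * (|t - s| ^ β + ‖x - x'‖ ^ δ + ‖y - y'‖ ^ δ) := by
      intro l
      have e4 : |partialSigma σ t z l i j - partialSigma σ s z' l i j| ≤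
          Real.sqrt (∑ l, ∑ i, ∑ j,
            (partialSigma σ t z l i j - partialSigma σ s z' l i j) ^ 2) := by
        apply Real.abs_le_sqrt
        refine le_trans (Finset.single_le_sum (f := fun j =>
          (partialSigma σ t z l i j - partialSigma σ s z' l i j) ^ 2)
          (fun _ _ => sq_nonneg _) (Finset.mem_univ j)) ?_
        refine le_trans (Finset.single_le_sum (f := fun i => ∑ j,
          (partialSigma σ t z l i j - partialSigma σ s z' l i j) ^ 2)
          (fun _ _ => Finset.sum_nonneg fun _ _ => sq_nonneg _) (Finset.mem_univ i)) ?_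
        exact Finset.single_le_sum (f := fun l => ∑ i, ∑ j,
          (partialSigma σ t z l i j - partialSigma σ s z' l i j) ^ 2)
          (fun _ _ => Finset.sum_nonneg fun _ _ => Finset.sum_nonneg fun _ _ => sq_nonneg _)
          (Finset.mem_univ l)
      refine e4.trans (e1.trans ?_)
      refine mul_le_mul_of_nonneg_left ?_ hG.le
      linarith
    exact norm_dual_le _ e3 v

/-- The hypotheses on the coefficients provide the estimates of the pathwise theory. -/
theorem exists_regular (hT : 0 < T) (hH1 : H < 1) (hσ : H1 T β δ σ) (hb : H2 T β δ b)
    (hα : 1 - H < α) (hα₀ : α < alpha₀ β δ) : ∃ μ, Regular T α β δ μ b σ := by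
  obtain ⟨μ, hμ, -, hbh⟩ := hb.holder
  obtain ⟨L, hL, hbL⟩ := hb.growth
  have h1 : α < 1 / 2 := hα₀.trans_le (min_le_left _ _)
  have h2 : α < β := hα₀.trans_le ((min_le_right _ _).trans (min_le_left _ _))
  have h3 : α < δ / (1 + δ) := hα₀.trans_le ((min_le_right _ _).trans (min_le_right _ _))
  have hδ := hσ.delta_pos
  refine ⟨μ, hT, by linarith, h1, hσ.beta_pos, hσ.beta_le, hσ.delta_pos, hσ.delta_le, ?_, ?_,
    hσ.exists_entry_lipschitz, hσ.exists_growth hT, hσ.exists_four_point, ⟨L, hL.le, hbL⟩, ?_⟩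
  · have : alpha₀ β δ ≤ 1 / 2 := min_le_left _ _
    linarith
  -- The condition `α < δ / (1 + δ)` is `α < δ * (1 - α)` rearranged.
  · rw [lt_div_iff₀ (by linarith)] at h3
    exact lt_min h2 (by linarith)
  · intro R
    obtain ⟨L, hL, h⟩ := hbh |R| (abs_nonneg R)
    exact ⟨L, hL.le, fun t ht s hs x y hx hy =>
      h t ht s hs x y (hx.trans (le_abs_self R)) (hy.trans (le_abs_self R))⟩

end

/-! ### Hölder continuity of the paths -/

/-- Approximate `u` from below by the grid points `p n`. Passing to the next level either stays at
the same point or moves to the next neighbour, so the increments are dominated by a geometric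
series, and continuity identifies the limit. -/
theorem abs_sub_dyadic_le {F : ℝ → ℝ} {A q : ℝ} (hA : 0 ≤ A) (hq : 0 < q) (hq1 : q < 1)
    (hF : ContinuousOn F (Icc 0 1))
    (hd : ∀ n j : ℕ, j < 2 ^ n → |F (((j + 1 : ℕ) : ℝ) / 2 ^ n) - F ((j : ℝ) / 2 ^ n)| ≤ A * q ^ n)
    {u : ℝ} (hu : u ∈ Icc (0 : ℝ) 1) (n : ℕ) :
    |F u - F ((⌊2 ^ n * u⌋₊ : ℝ) / 2 ^ n)| ≤ A / (1 - q) * q ^ n := by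
  set p : ℕ → ℝ := fun n => (⌊2 ^ n * u⌋₊ : ℝ) / 2 ^ n with hp
  have hu0 := hu.1
  have hle : ∀ m, p m ≤ u := fun m => by
    rw [hp]
    simp only
    rw [div_le_iff₀ (by positivity), mul_comm]
    exact Nat.floor_le (by positivity)
  have hge : ∀ m, u - 1 / 2 ^ m ≤ p m := fun m => by
    have := Nat.lt_floor_add_one (2 ^ m * u)
    simp only [hp]
    rw [le_div_iff₀ (by positivity), sub_mul, div_mul_cancel₀ _ (by positivity)]
    linarith
  have hp0 : ∀ m, 0 ≤ p m := fun m => by positivity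
  have hstep : ∀ m, |F (p (m + 1)) - F (p m)| ≤ A * q ^ (m + 1) := by
    intro m
    have h2 : ⌊2 ^ (m + 1) * u⌋₊ / 2 = ⌊2 ^ m * u⌋₊ := by
      rw [← Nat.floor_div_natCast]
      congr 1
      push_cast
      ring
    have hpm : p m = ((2 * ⌊2 ^ m * u⌋₊ : ℕ) : ℝ) / 2 ^ (m + 1) := by
      simp only [hp]
      push_cast
      rw [pow_succ]
      field_simp
    have hle' : ⌊2 ^ (m + 1) * u⌋₊ ≤ 2 ^ (m + 1) := by
      refine Nat.floor_le_of_le ?_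
      push_cast
      exact mul_le_of_le_one_right (by positivity) hu.2
    rcases (by lia : ⌊2 ^ (m + 1) * u⌋₊ = 2 * ⌊2 ^ m * u⌋₊ ∨
      ⌊2 ^ (m + 1) * u⌋₊ = 2 * ⌊2 ^ m * u⌋₊ + 1) with h | h
    · rw [hpm]
      simp only [hp]
      rw [h, sub_self, abs_zero]
      positivity
    · rw [hpm]
      simp only [hp]
      rw [h]
      exact hd _ _ (by lia)
  have hsum : ∀ i, |F (p (n + i)) - F (p n)| ≤ A / (1 - q) * (q ^ n - q ^ (n + i)) := by
    intro i
    induction i with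
    | zero => simp
    | succ i ih =>
      have h1 := hstep (n + i)
      have h2 : A * q ^ (n + i + 1) ≤ A * q ^ (n + i) := by
        refine mul_le_mul_of_nonneg_left ?_ hA
        exact pow_le_pow_of_le_one hq.le hq1.le (Nat.le_succ _)
      have h3 : A * q ^ (n + i) = A / (1 - q) * (q ^ (n + i) - q ^ (n + i + 1)) := by
        have : 1 - q ≠ 0 := by linarith
        field_simp
        ring
      calc |F (p (n + (i + 1))) - F (p n)|
          ≤ |F (p (n + i + 1)) - F (p (n + i))| + |F (p (n + i)) - F (p n)| := abs_sub_le _ _ _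
        _ ≤ A / (1 - q) * (q ^ n - q ^ (n + (i + 1))) := by
          rw [← add_assoc]
          linarith
  have hlim : Tendsto p atTop (𝓝 u) := by
    refine tendsto_of_tendsto_of_tendsto_of_le_of_le ?_ tendsto_const_nhds hge hle
    have : Tendsto (fun m : ℕ => u - (1 / 2 : ℝ) ^ m) atTop (𝓝 (u - 0)) :=
      tendsto_const_nhds.sub (tendsto_pow_atTop_nhds_zero_of_lt_one (by norm_num) (by norm_num))
    simpa using this
  have hFlim : Tendsto (fun i => F (p (n + i))) atTop (𝓝 (F u)) := by
    have h1 : Tendsto p atTop (𝓝[Icc 0 1] u) := tendsto_nhdsWithin_iff.2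
      ⟨hlim, Eventually.of_forall fun m => ⟨hp0 m, (hle m).trans hu.2⟩⟩
    exact ((hF u hu).tendsto.comp h1).comp (tendsto_add_atTop_nat n |>.congr fun i => add_comm _ _)
  refine le_of_tendsto ((hFlim.sub_const _).abs) (Eventually.of_forall fun i => (hsum i).trans ?_)
  refine mul_le_mul_of_nonneg_left ?_ (div_nonneg hA (by linarith))
  linarith [pow_pos hq (n + i)]

/-- A continuous function whose dyadic increments of order `n` are `O(2^{-nl})` is `l`-Hölder. -/
theorem exists_holder_of_dyadic {F : ℝ → ℝ} {A l : ℝ} (hA : 0 ≤ A) (hl : 0 < l)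
    (hF : ContinuousOn F (Icc 0 1))
    (hd : ∀ n j : ℕ, j < 2 ^ n →
      |F (((j + 1 : ℕ) : ℝ) / 2 ^ n) - F ((j : ℝ) / 2 ^ n)| ≤ A * ((2 : ℝ)⁻¹ ^ l) ^ n) :
    ∃ C, ∀ u ∈ Icc (0 : ℝ) 1, ∀ v ∈ Icc (0 : ℝ) 1, |F u - F v| ≤ C * |u - v| ^ l := by
  set q : ℝ := (2 : ℝ)⁻¹ ^ l with hqdef
  have hq : 0 < q := by positivity
  have hq1 : q < 1 := Real.rpow_lt_one (by norm_num) (by norm_num) hl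
  set D := (2 * (A / (1 - q)) + A) / q with hD
  have hD0 : 0 ≤ D := by
    have : 0 ≤ A / (1 - q) := div_nonneg hA (by linarith)
    positivity
  have key : ∀ u ∈ Icc (0 : ℝ) 1, ∀ v ∈ Icc (0 : ℝ) 1, u < v → |F u - F v| ≤ D * |u - v| ^ l := by
    intro u hu v hv huv
    -- Choose `n` with `2^{-(n+1)} < v - u ≤ 2^{-n}`: the grid points below `u` and `v` at level `n`
    -- are then equal or adjacent. The division by `q` in `D` pays for the shift from `n` to `n +
    -- 1`.
    obtain ⟨n, hn, hn'⟩ := exists_nat_pow_near_of_lt_one (x := v - u) (y := (2 : ℝ)⁻¹)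
      (by linarith) (by linarith [hu.1, hv.2]) (by norm_num) (by norm_num)
    have hmid : |F ((⌊2 ^ n * u⌋₊ : ℝ) / 2 ^ n) - F ((⌊2 ^ n * v⌋₊ : ℝ) / 2 ^ n)| ≤ A * q ^ n := by
      have h1 : ⌊2 ^ n * u⌋₊ ≤ ⌊2 ^ n * v⌋₊ := Nat.floor_le_floor (by gcongr)
      have h2 : ⌊2 ^ n * v⌋₊ ≤ ⌊2 ^ n * u⌋₊ + 1 := by
        have : 2 ^ n * v ≤ 2 ^ n * u + 1 := by
          have := mul_le_mul_of_nonneg_left hn' (by positivity : (0:ℝ) ≤ 2 ^ n)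
          rw [inv_pow, mul_inv_cancel₀ (by positivity)] at this
          linarith
        calc ⌊2 ^ n * v⌋₊ ≤ ⌊2 ^ n * u + 1⌋₊ := Nat.floor_le_floor this
          _ = _ := Nat.floor_add_one (mul_nonneg (by positivity) hu.1)
      have h3 : ⌊2 ^ n * v⌋₊ ≤ 2 ^ n := by
        refine Nat.floor_le_of_le ?_
        push_cast
        exact mul_le_of_le_one_right (by positivity) hv.2
      rcases (by lia : ⌊2 ^ n * v⌋₊ = ⌊2 ^ n * u⌋₊ ∨ ⌊2 ^ n * v⌋₊ = ⌊2 ^ n * u⌋₊ + 1) with h | h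
      · rw [h, sub_self, abs_zero]
        positivity
      · rw [h, abs_sub_comm]
        exact hd _ _ (by lia)
    have e1 := abs_sub_dyadic_le hA hq hq1 hF hd hu n
    have e2 := abs_sub_dyadic_le hA hq hq1 hF hd hv n
    have e3 : q ^ (n + 1) ≤ |u - v| ^ l := by
      rw [abs_sub_comm, abs_of_pos (by linarith : 0 < v - u), hqdef, ← Real.rpow_natCast,
        ← Real.rpow_mul (by norm_num), mul_comm, Real.rpow_mul (by norm_num), Real.rpow_natCast]
      exact Real.rpow_le_rpow (by positivity) hn.le hl.le
    calc |F u - F v| ≤ (2 * (A / (1 - q)) + A) * q ^ n := by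
          rw [abs_le] at *
          constructor <;> linarith [e1.1, e1.2, e2.1, e2.2, hmid.1, hmid.2]
      _ = D * q ^ (n + 1) := by
          rw [hD, pow_succ]
          field_simp
      _ ≤ D * |u - v| ^ l := by gcongr
  refine ⟨D, fun u hu v hv => ?_⟩
  rcases lt_trichotomy u v with h | h | h
  · exact key u hu v hv h
  · subst h
    simp [Real.zero_rpow hl.ne']
  · rw [abs_sub_comm, abs_sub_comm u]
    exact key v hv u hu h

/-! ### Gaussian moments and Hölder paths by Kolmogorov's argument -/

section Gaussian

variable {Ω : Type*} [MeasurableSpace Ω] {P : Measure Ω}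

/-- The moments of a centred Gaussian variable scale with its standard deviation. -/
theorem lintegral_pow_of_hasGaussianLaw {X : Ω → ℝ} (hX : HasGaussianLaw X P)
    (h0 : ∫ ω, X ω ∂P = 0) {c : ℝ} (hv : ∫ ω, X ω ^ 2 ∂P = c ^ 2) (p : ℕ) :
    ∫⁻ ω, ‖X ω‖ₑ ^ p ∂P = ‖c‖ₑ ^ p * ∫⁻ x, ‖x‖ₑ ^ p ∂gaussianReal 0 1 := by
  have hm := hX.map_eq_gaussianReal
  have hvar : Var[X; P] = c ^ 2 := by
    rw [variance_of_integral_eq_zero hX.aemeasurable h0, hv]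
  rw [h0, hvar] at hm
  have hs : gaussianReal 0 (Real.toNNReal (c ^ 2)) = (gaussianReal 0 1).map (c * ·) := by
    rw [gaussianReal_map_const_mul, mul_zero, mul_one]
    congr 1
    ext
    simp [sq_nonneg]
  calc ∫⁻ ω, ‖X ω‖ₑ ^ p ∂P = ∫⁻ x, ‖x‖ₑ ^ p ∂(P.map X) :=
        (lintegral_map' (f := fun x : ℝ => ‖x‖ₑ ^ p) (by fun_prop) hX.aemeasurable).symm
    _ = ∫⁻ x, ‖c * x‖ₑ ^ p ∂gaussianReal 0 1 := by
        rw [hm, hs, lintegral_map (by fun_prop) (by fun_prop)]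
    _ = _ := by
        simp_rw [enorm_mul, mul_pow]
        rw [lintegral_const_mul _ (by fun_prop)]

theorem lintegral_pow_gaussianReal_lt_top (p : ℕ) :
    ∫⁻ x, ‖x‖ₑ ^ p ∂gaussianReal 0 1 < ⊤ := by
  rcases eq_or_ne p 0 with rfl | hp
  · simp
  have := (memLp_id_gaussianReal (μ := 0) (v := 1) p)
  have h2 := lintegral_rpow_enorm_lt_top_of_eLpNorm_lt_top (by simpa using hp) (by simp) this.2
  simpa using h2

variable {T H : ℝ} {B : ℝ → Ω → ℝ}

theorem IsFBM.lintegral_pow_sub (hB : IsFBM P T H B) (hH : 0 < H) {s t : ℝ} (hs : s ∈ Icc 0 T)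
    (ht : t ∈ Icc 0 T) (p : ℕ) :
    ∫⁻ ω, ‖B t ω - B s ω‖ₑ ^ p ∂P =
      ‖|t - s| ^ H‖ₑ ^ p * ∫⁻ x, ‖x‖ₑ ^ p ∂gaussianReal 0 1 := by
  have hg : HasGaussianLaw (fun ω => B t ω - B s ω) P :=
    hB.gaussian.hasGaussianLaw_fun_sub (s := ⟨t, ht⟩) (t := ⟨s, hs⟩)
  have hL : ∀ r ∈ Icc 0 T, MemLp (B r) 2 P := fun r hr =>
    (hB.gaussian.hasGaussianLaw_eval ⟨r, hr⟩).memLp_two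
  have := hB.gaussian.isProbabilityMeasure
  refine lintegral_pow_of_hasGaussianLaw hg ?_ ?_ p
  · rw [integral_sub ((hL t ht).integrable (by norm_num)) ((hL s hs).integrable (by norm_num)),
      hB.centered t ht, hB.centered s hs, sub_self]
  · have e : (fun ω => (B t ω - B s ω) ^ 2) =
        fun ω => B t ω * B t ω - 2 * (B s ω * B t ω) + B s ω * B s ω := by
      funext ω
      ring
    have i1 : Integrable (fun ω => B t ω * B t ω) P := (hL t ht).integrable_mul (hL t ht)
    have i2 : Integrable (fun ω => B s ω * B t ω) P := (hL s hs).integrable_mul (hL t ht)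
    have i3 : Integrable (fun ω => B s ω * B s ω) P := (hL s hs).integrable_mul (hL s hs)
    rw [e, integral_add (f := fun ω => B t ω * B t ω - 2 * (B s ω * B t ω))
        (i1.sub (i2.const_mul 2)) i3, integral_sub i1 (i2.const_mul 2),
      integral_const_mul, hB.covariance t ht t ht, hB.covariance s hs s hs,
      hB.covariance s hs t ht, ← Real.rpow_natCast, ← Real.rpow_mul (abs_nonneg _), sub_self,
      sub_self, abs_zero, Real.zero_rpow (by positivity), mul_comm H]
    push_cast
    ring

/-- The paths of fractional Brownian motion are Hölder continuous of every order below `H`. -/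
theorem IsFBM.exists_holderOn (hB : IsFBM P T H B) (hT : 0 < T) {l : ℝ} (hl : 0 < l)
    (hlH : l < H) : ∀ᵐ ω ∂P, ∃ D, HolderOn D l 0 T (fun t => B t ω) := by
  -- The moment order satisfies `p * (H - l) > 1`, so the decay of the moments beats the `2 ^ n`
  -- increments at level `n`.
  obtain ⟨p, hp⟩ := exists_nat_gt (1 / (H - l))
  have hHl : 0 < H - l := by linarith
  rw [div_lt_iff₀ hHl] at hp
  have hp0 : p ≠ 0 := by
    rintro rfl
    norm_num at hp
  set q : ℝ := (2 : ℝ)⁻¹ ^ l with hq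
  have hqpos : 0 < q := by positivity
  have hgrid : ∀ n j : ℕ, j ≤ 2 ^ n → T * ((j : ℝ) / 2 ^ n) ∈ Icc 0 T := by
    intro n j hj
    refine ⟨by positivity, mul_le_of_le_one_right hT.le ?_⟩
    rw [div_le_one (by positivity)]
    exact_mod_cast hj
  set Δ : ℕ → ℕ → Ω → ℝ := fun n j ω =>
    B (T * (((j + 1 : ℕ) : ℝ) / 2 ^ n)) ω - B (T * ((j : ℝ) / 2 ^ n)) ω with hΔ
  have hΔm : ∀ n, ∀ j ∈ Finset.range (2 ^ n), Measurable (Δ n j) := by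
    intro n j hj
    have hj := Finset.mem_range.1 hj
    exact (hB.measurable _ (hgrid n _ hj)).sub (hB.measurable _ (hgrid n _ hj.le))
  set M := ∫⁻ x, ‖x‖ₑ ^ p ∂gaussianReal 0 1 with hM
  -- Ratio of the geometric series formed by the expected sums of normalized increments over the
  -- levels.
  set r : ℝ := 2 * (q⁻¹ * 2⁻¹ ^ H) ^ p with hr
  have hr1 : r < 1 := by
    have : q⁻¹ * (2 : ℝ)⁻¹ ^ H = 2⁻¹ ^ (H - l) := by
      rw [Real.rpow_sub (by norm_num), hq]
      field_simp
    rw [hr, this, ← Real.rpow_natCast, ← Real.rpow_mul (by norm_num)]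
    calc 2 * (2 : ℝ)⁻¹ ^ ((H - l) * p) < 2 * (2 : ℝ)⁻¹ ^ (1 : ℝ) := by
          refine mul_lt_mul_of_pos_left ?_ (by norm_num)
          refine Real.rpow_lt_rpow_of_exponent_gt (by norm_num) (by norm_num) ?_
          rwa [mul_comm]
      _ = 1 := by norm_num
  have hmom : ∀ n, ∀ j ∈ Finset.range (2 ^ n),
      ∫⁻ ω, ‖(q⁻¹) ^ n * Δ n j ω‖ₑ ^ p ∂P =
        ENNReal.ofReal (((q⁻¹ * 2⁻¹ ^ H) ^ p) ^ n * (T ^ H) ^ p) * M := by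
    intro n j hj
    have hj' := Finset.mem_range.1 hj
    simp_rw [enorm_mul, mul_pow]
    rw [lintegral_const_mul _ (by have := hΔm n j hj; fun_prop),
      hB.lintegral_pow_sub (hl.trans hlH) (hgrid n j hj'.le) (hgrid n (j + 1) hj'), ← mul_assoc]
    congr 1
    rw [← mul_pow, ← enorm_mul, Real.enorm_of_nonneg (by positivity),
      ← ENNReal.ofReal_pow (by positivity)]
    congr 1
    have e : |T * (((j + 1 : ℕ) : ℝ) / 2 ^ n) - T * ((j : ℝ) / 2 ^ n)| = T * 2⁻¹ ^ n := by
      rw [← mul_sub, ← sub_div, Nat.cast_succ, add_sub_cancel_left, abs_of_pos (by positivity),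
        one_div, inv_pow]
    rw [e, Real.mul_rpow hT.le (by positivity), ← Real.rpow_pow_comm (by norm_num)]
    ring
  have hint : ∫⁻ ω, ∑' n, ∑ j ∈ Finset.range (2 ^ n), ‖(q⁻¹) ^ n * Δ n j ω‖ₑ ^ p ∂P ≠ ⊤ := by
    rw [lintegral_tsum fun n => (Finset.measurable_fun_sum _ fun j hj => by
      have := hΔm n j hj
      fun_prop).aemeasurable]
    have e : ∀ n, ∫⁻ ω, ∑ j ∈ Finset.range (2 ^ n), ‖(q⁻¹) ^ n * Δ n j ω‖ₑ ^ p ∂P =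
        ENNReal.ofReal (r ^ n * (T ^ H) ^ p) * M := by
      intro n
      rw [lintegral_finsetSum' _ fun j hj => by
          have := hΔm n j hj
          fun_prop,
        Finset.sum_congr rfl (hmom n), Finset.sum_const, Finset.card_range, nsmul_eq_mul,
        ← mul_assoc, ← ENNReal.ofReal_natCast, ← ENNReal.ofReal_mul (by positivity), hr, mul_pow]
      congr 2
      push_cast
      ring
    simp_rw [e]
    rw [ENNReal.tsum_mul_right]
    refine ENNReal.mul_ne_top ?_ (lintegral_pow_gaussianReal_lt_top p).ne
    exact ((summable_geometric_of_lt_one (by positivity) hr1).mul_right _).tsum_ofReal_ne_top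
  have hae := ae_lt_top' (AEMeasurable.tsum fun n =>
    (Finset.measurable_fun_sum _ fun j hj => by
      have := hΔm n j hj
      fun_prop).aemeasurable) hint
  filter_upwards [hae, hB.continuous] with ω hω hc
  set S := ∑' n, ∑ j ∈ Finset.range (2 ^ n), ‖(q⁻¹) ^ n * Δ n j ω‖ₑ ^ p with hS
  have hdy : ∀ n j : ℕ, j < 2 ^ n →
      |B (T * (((j + 1 : ℕ) : ℝ) / 2 ^ n)) ω - B (T * ((j : ℝ) / 2 ^ n)) ω| ≤
        (S.toReal + 1) * q ^ n := by
    intro n j hj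
    have h1 : ‖(q⁻¹) ^ n * Δ n j ω‖ₑ ^ p ≤ S :=
      (Finset.single_le_sum (f := fun j => ‖(q⁻¹) ^ n * Δ n j ω‖ₑ ^ p)
        (fun _ _ => zero_le) (Finset.mem_range.2 hj)).trans
        (ENNReal.le_tsum (f := fun n => ∑ j ∈ Finset.range (2 ^ n),
          ‖(q⁻¹) ^ n * Δ n j ω‖ₑ ^ p) n)
    have h2 : |(q⁻¹) ^ n * Δ n j ω| ^ p ≤ S.toReal := by
      have := ENNReal.toReal_mono hω.ne h1
      simpa using this
    -- From `z ^ p ≤ S`: either `z ≤ 1`, or `z ≤ z ^ p`. Adding 1 avoids a `p`-th root.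
    have h3 : |(q⁻¹) ^ n * Δ n j ω| ≤ S.toReal + 1 := by
      rcases le_total |(q⁻¹) ^ n * Δ n j ω| 1 with h | h
      · linarith [ENNReal.toReal_nonneg (a := S)]
      · linarith [le_self_pow₀ h hp0]
    rw [abs_mul, abs_of_pos (by positivity), inv_pow, inv_mul_le_iff₀ (by positivity)] at h3
    linarith
  obtain ⟨C, hC⟩ := exists_holder_of_dyadic (F := fun u => B (T * u) ω)
    (add_nonneg ENNReal.toReal_nonneg zero_le_one) hl
    (hc.comp (by fun_prop) fun u hu =>
      ⟨mul_nonneg hT.le hu.1, mul_le_of_le_one_right hT.le hu.2⟩) hdy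
  refine ⟨C * (T⁻¹) ^ l, fun x hx y hy => ?_⟩
  have hdiv : ∀ z ∈ Icc 0 T, z / T ∈ Icc (0 : ℝ) 1 := fun z hz =>
    ⟨div_nonneg hz.1 hT.le, (div_le_one hT).2 hz.2⟩
  have := hC _ (hdiv x hx) _ (hdiv y hy)
  rw [mul_div_cancel₀ _ hT.ne', mul_div_cancel₀ _ hT.ne', ← sub_div, abs_div, abs_of_pos hT,
    div_eq_inv_mul, Real.mul_rpow (by positivity) (abs_nonneg _)] at this
  rw [Real.norm_eq_abs, mul_assoc]
  exact this

end Gaussian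

/-! ### The paths of vector fractional Brownian motion as drivers -/

section Vector

variable {Ω : Type*} [MeasurableSpace Ω] {P : Measure Ω} {T H α : ℝ} {k : ℕ}
  {B : ℝ → Ω → EuclideanSpace ℝ (Fin k)}

theorem IsVectorFBM.ae_driver (hB : IsVectorFBM P T H B) (hT : 0 < T) (hα : 1 - H < α)
    (hα1 : α < 1) :
    ∀ᵐ ω ∂P, ∀ Λ, Lam α T (fun r => B r ω) ≤ Λ → Driver α T Λ (fun r => B r ω) := by
  -- The midpoint of `1 - α` and `H`: low enough for the paths to be Hölder of this order, high
  -- enough for the integral.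
  set l := (1 - α + H) / 2 with hl
  have h := ae_all_iff.2 fun j => (hB.component j).exists_holderOn hT (l := l) (by linarith)
    (by linarith)
  filter_upwards [h] with ω hω Λ hΛ
  choose D hD using hω
  refine ⟨⟨l, ∑ j, |D j|, by linarith, fun x hx y hy => ?_⟩, hΛ⟩
  refine (norm_le_sum_abs _).trans ?_
  rw [Finset.sum_mul]
  refine Finset.sum_le_sum fun j _ => ?_
  have := hD j x hx y hy
  rw [Real.norm_eq_abs] at this
  refine this.trans ?_
  gcongr
  exact le_abs_self _

theorem IsVectorFBM.measurable (hB : IsVectorFBM P T H B) {t : ℝ} (ht : t ∈ Icc 0 T) :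
    Measurable (B t) := by
  have : Measurable fun ω => (B t ω).ofLp := measurable_pi_iff.2 fun j =>
    (hB.component j).measurable t ht
  exact (WithLp.measurable_toLp 2 _).comp this

end Vector

namespace Driver

lemma mono {k : ℕ} {α T Λ Λ' : ℝ} {g : ℝ → EuclideanSpace ℝ (Fin k)} (hg : Driver α T Λ g)
    (h : Λ ≤ Λ') : Driver α T Λ' g :=
  ⟨hg.holder, hg.lam.trans h⟩

end Driver

/-! ### Viability and contingency -/

variable {Ω : Type*} [MeasurableSpace Ω] {P : Measure Ω} {d k : ℕ} {T α β δ μ H t s : ℝ}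
  {b : ℝ → EuclideanSpace ℝ (Fin d) → EuclideanSpace ℝ (Fin d)}
  {σ : ℝ → EuclideanSpace ℝ (Fin d) → Matrix (Fin d) (Fin k) ℝ}
  {B : ℝ → Ω → EuclideanSpace ℝ (Fin k)} {K : ℝ → Set (EuclideanSpace ℝ (Fin d))}

namespace Regular

lemma continuous_b (h : Regular T α β δ μ b σ) (ht : t ∈ Icc 0 T) : Continuous (b t) := by
  refine continuous_iff_continuousAt.2 fun x => ?_
  obtain ⟨L, hL, hb⟩ := h.b_holder (‖x‖ + 1)
  have hl : LipschitzOnWith L.toNNReal (b t) (Metric.ball 0 (‖x‖ + 1)) := by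
    refine LipschitzOnWith.of_dist_le_mul fun y hy z hz => ?_
    have := hb t ht t ht y z (mem_ball_zero_iff.1 hy).le (mem_ball_zero_iff.1 hz).le
    rw [sub_self, abs_zero, Real.zero_rpow h.μ_pos.ne', zero_add] at this
    rwa [dist_eq_norm, dist_eq_norm, Real.coe_toNNReal _ hL]
  exact hl.continuousOn.continuousAt (Metric.isOpen_ball.mem_nhds (by simp))

lemma continuous_sigma (h : Regular T α β δ μ b σ) (ht : t ∈ Icc 0 T) : Continuous (σ t) := by
  obtain ⟨M, hM, hσ⟩ := h.sigma_lip
  refine continuous_matrix fun i j => ?_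
  refine (LipschitzWith.of_dist_le_mul (K := M.toNNReal) fun y z => ?_).continuous
  have := hσ t ht t ht y z i j
  rw [sub_self, abs_zero, Real.zero_rpow h.β_pos.ne', zero_add] at this
  rwa [Real.dist_eq, dist_eq_norm, Real.coe_toNNReal _ hM]

lemma measurable_eulerStep (h : Regular T α β δ μ b σ) (hB : ∀ t ∈ Icc 0 T, Measurable (B t))
    (ht : t ∈ Icc 0 T) (hs : s ∈ Icc 0 T) {X : Ω → EuclideanSpace ℝ (Fin d)}
    (hX : Measurable X) :
    Measurable fun ω => eulerStep b σ (fun r => B r ω) t s (X ω) := by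
  have hbt := (h.continuous_b ht).measurable.comp hX
  have hmul : Continuous fun p : EuclideanSpace ℝ (Fin d) × EuclideanSpace ℝ (Fin k) =>
      WithLp.toLp 2 (σ t p.1 *ᵥ p.2.ofLp) := by
    have := h.continuous_sigma ht
    refine (PiLp.continuous_toLp 2 _).comp (Continuous.matrix_mulVec (this.comp continuous_fst) ?_)
    exact (PiLp.continuous_ofLp 2 _).comp continuous_snd
  exact (hX.add (hbt.const_smul (s - t))).add
    (hmul.measurable.comp (hX.prodMk ((hB s hs).sub (hB t ht))))

lemma measurable_euler (h : Regular T α β δ μ b σ) (hB : ∀ t ∈ Icc 0 T, Measurable (B t))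
    {e : ℝ} (he : 0 ≤ e) (ht : 0 ≤ t) (x : EuclideanSpace ℝ (Fin d)) :
    ∀ i : ℕ, t + i * e ≤ T → Measurable fun ω => euler b σ (fun r => B r ω) t e x i
  | 0, _ => measurable_const
  | i + 1, hi => by
    have hle : t + i * e ≤ t + (i + 1 : ℕ) * e := by
      push_cast
      nlinarith
    exact h.measurable_eulerStep hB ⟨by positivity, hle.trans hi⟩ ⟨by positivity, hi⟩
      (h.measurable_euler hB he ht x i (hle.trans hi))

/-- The flow is defined by choice for each path, so measurability is recovered as an almost sure
limit of Euler schemes. Completeness turns almost everywhere measurability into measurability. -/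
lemma measurable_flow [P.IsComplete] (h : Regular T α β δ μ b σ)
    (hB : ∀ t ∈ Icc 0 T, Measurable (B t))
    (hd : ∀ᵐ ω ∂P, ∃ Λ, Driver α T Λ (fun r => B r ω)) (ht : t ∈ Icc 0 T)
    (x : EuclideanSpace ℝ (Fin d)) (hs : s ∈ Icc t T) :
    Measurable fun ω => flow α T b σ (fun r => B r ω) t x s := by
  refine aemeasurable_iff_measurable (μ := P).1 (aemeasurable_of_tendsto_metrizable_ae atTop
    (f := fun (n : ℕ) ω => euler b σ (fun r => B r ω) t ((s - t) / (n + 1)) x (n + 1)) ?_ ?_)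
  · intro n
    refine (h.measurable_euler hB (div_nonneg (sub_nonneg.2 hs.1) (by positivity)) ht.1 x _
      ?_).aemeasurable
    push_cast
    rw [mul_div_cancel₀ _ (by positivity)]
    linarith [hs.2]
  · filter_upwards [hd] with ω ⟨Λ, hω⟩
    exact h.tendsto_euler hω ht x hs

/-- The process is the flow itself. On almost every path contingency supplies the approximate
tangency that `flow_mem` asks for. -/
theorem viable (h : Regular T α β δ μ b σ) [P.IsComplete]
    (hB : ∀ t ∈ Icc 0 T, Measurable (B t))
    (hd : ∀ᵐ ω ∂P, ∃ Λ, Driver α T Λ (fun r => B r ω)) (hK : ∀ t ∈ Icc 0 T, IsClosed (K t))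
    (hl : LeftClosed T K) (hc : Contingent P α T b σ B K) : Viable P α T b σ B K := by
  obtain ⟨Ω₀, c, c', γ, hΩ₀, hcγ, hc⟩ := hc
  intro t ht x hx
  refine ⟨fun s ω => flow α T b σ (fun r => B r ω) t x s,
    fun s hs => h.measurable_flow hB hd ht x hs, ?_⟩
  filter_upwards [hd, hΩ₀] with ω ⟨Λ, hg⟩ hω
  refine ⟨h.isSolution_flow hg ht x, fun s hs => h.flow_mem hg hK hl (fun u hu y hy => ?_) ht hx hs⟩
  obtain ⟨e, Q, -, he, -, hQ⟩ := hc u hu y hy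
  obtain ⟨hQ1, hQ2⟩ := hQ ω hω
  -- The contingency constants are available only for positive radii, and `y` may be 0.
  have hR : 0 < ‖y‖ + 1 := by positivity
  refine ⟨e ω, he ω, c' (‖y‖ + 1) (Lam α T fun r => B r ω), γ (‖y‖ + 1), (hcγ _ hR).2.2.2.1,
    fun r hr => ⟨_, hQ2 r hr, ?_⟩⟩
  have := (hQ1 _ hR (by linarith) r hr).2
  rw [abs_of_nonneg (sub_nonneg.2 hr.1)] at this
  rwa [eulerStep, add_sub_cancel_left]

/-- Solutions from `(u n, v n)` stay in the tube and at time `t` are within `C |t - u n| ^ (1 - α)`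
of `v n`, with one constant for all `n`; closedness of `K t` finishes. A nonzero measure provides
one path that works for the whole sequence. -/
theorem leftClosed_of_viable [NeZero P] (h : Regular T α β δ μ b σ)
    (hd : ∀ᵐ ω ∂P, ∃ Λ, Driver α T Λ (fun r => B r ω)) (hK : ∀ t ∈ Icc 0 T, IsClosed (K t))
    (hv : Viable P α T b σ B K) : LeftClosed T K := by
  intro t ht y u v hu hvK hut hvy
  have hu' : ∀ n, u n ∈ Icc 0 T := fun n => ⟨(hu n).1, (hu n).2.le.trans ht.2⟩
  choose X _ hX using fun n => hv (u n) (hu' n) (v n) (hvK n)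
  obtain ⟨ω, ⟨Λ, hg⟩, hω⟩ := (hd.and (ae_all_iff.2 hX)).exists
  obtain ⟨R, hR⟩ := hvy.norm.bddAbove_range
  obtain ⟨C, hC, hflow⟩ := h.exists_flow_bound Λ R
  have htu : ∀ n, t ∈ Icc (u n) T := fun n => ⟨(hu n).2.le, ht.2⟩
  have hle : ∀ n, ‖X n t ω - v n‖ ≤ C * |t - u n| ^ (1 - α) := fun n => by
    have h1 := (hflow hg (hu' n) (hR (mem_range_self n))).2 t (htu n) (u n)
      ⟨le_rfl, (hu' n).2⟩
    rwa [h.flow_self hg (hu' n), ← h.eq_flow hg (hu' n) (hω n).1 (htu n)] at h1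
  have hz : Tendsto (fun n => C * |t - u n| ^ (1 - α)) atTop (𝓝 0) := by
    have h1 : Tendsto (fun n => |t - u n|) atTop (𝓝 0) := by
      simpa using (tendsto_const_nhds.sub hut).abs (a := t - t)
    have h2 := (h1.rpow_const (p := 1 - α) (Or.inr h.one_sub_pos.le)).const_mul C
    rwa [Real.zero_rpow h.one_sub_pos.ne', mul_zero] at h2
  have hlim : Tendsto (fun n => X n t ω) atTop (𝓝 y) := by
    have := (squeeze_zero_norm hle hz).add hvy
    simpa using this
  exact (hK t ht).mem_of_tendsto hlim (Eventually.of_forall fun n => (hω n).2 t (htu n))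

/-- Viability implies that almost surely the flow preserves the tube, for all starting points
simultaneously. -/
theorem ae_flow_mem_of_viable (h : Regular T α β δ μ b σ)
    (hd : ∀ᵐ ω ∂P, ∃ Λ, Driver α T Λ (fun r => B r ω)) (hK : ∀ t ∈ Icc 0 T, IsClosed (K t))
    (hv : Viable P α T b σ B K) :
    ∀ᵐ ω ∂P, ∀ t ∈ Icc 0 T, ∀ x ∈ K t, ∀ s ∈ Icc t T,
      flow α T b σ (fun r => B r ω) t x s ∈ K s := by
  -- Viability gives a null set for each starting point, and these may be uncountably many. A
  -- countable dense subset of the graph of `K` reduces them to a single null set.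
  obtain ⟨D, hDG, hDc, hGD⟩ := (TopologicalSpace.IsSeparable.of_separableSpace
    {p : ℝ × EuclideanSpace ℝ (Fin d) | p.1 ∈ Icc 0 T ∧ p.2 ∈ K p.1}).exists_countable_dense_subset
  have hD : ∀ᵐ ω ∂P, ∀ p ∈ D, ∀ s ∈ Icc p.1 T,
      flow α T b σ (fun r => B r ω) p.1 p.2 s ∈ K s := by
    refine (ae_ball_iff hDc).2 fun p hp => ?_
    obtain ⟨hp1, hp2⟩ := hDG hp
    obtain ⟨X, -, hX⟩ := hv p.1 hp1 p.2 hp2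
    filter_upwards [hd, hX] with ω ⟨Λ, hg⟩ hω s hs
    rw [← h.eq_flow hg hp1 hω.1 hs]
    exact hω.2 s hs
  filter_upwards [hd, hD] with ω ⟨Λ, hg⟩ hω t ht x hx s hs
  -- Approximating starting times may lie after `t`, but for `t < s` they are eventually below `s`,
  -- so the approximating flows are defined at `s`.
  rcases hs.1.eq_or_lt with rfl | hts
  · rwa [h.flow_self hg ht]
  obtain ⟨p, hpD, hp⟩ := mem_closure_iff_seq_limit.1 (hGD (show (t, x) ∈ _ from ⟨ht, hx⟩))
  have hp1 : Tendsto (fun n => (p n).1) atTop (𝓝 t) := (continuous_fst.tendsto _).comp hp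
  have hp2 : Tendsto (fun n => (p n).2) atTop (𝓝 x) := (continuous_snd.tendsto _).comp hp
  obtain ⟨R, hR⟩ := hp2.norm.bddAbove_range
  obtain ⟨C, hC, hcont⟩ := h.exists_flow_continuity Λ (max R ‖x‖)
  have hz : Tendsto (fun n => C * (‖(p n).2 - x‖ + |(p n).1 - t| ^ (1 - α))) atTop (𝓝 0) := by
    have h1 : Tendsto (fun n => |(p n).1 - t|) atTop (𝓝 0) := by
      simpa using (hp1.sub_const t).abs
    have h2 := h1.rpow_const (p := 1 - α) (Or.inr h.one_sub_pos.le)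
    have h3 : Tendsto (fun n => ‖(p n).2 - x‖) atTop (𝓝 0) := by
      simpa using (hp2.sub_const x).norm
    have h4 := (h3.add h2).const_mul C
    rwa [Real.zero_rpow h.one_sub_pos.ne', add_zero, mul_zero] at h4
  have hps : ∀ᶠ n in atTop, (p n).1 < s := hp1.eventually_lt_const hts
  have hlim : Tendsto (fun n => flow α T b σ (fun r => B r ω) (p n).1 (p n).2 s) atTop
      (𝓝 (flow α T b σ (fun r => B r ω) t x s)) := by
    refine tendsto_iff_norm_sub_tendsto_zero.2 (squeeze_zero' (Eventually.of_forall fun _ =>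
      norm_nonneg _) ?_ hz)
    filter_upwards [hps] with n hn
    have hRn : ‖(p n).2‖ ≤ max R ‖x‖ := (hR (mem_range_self n)).trans (le_max_left _ _)
    rcases le_total (p n).1 t with hle | hle
    · rw [abs_sub_comm, abs_of_nonneg (sub_nonneg.2 hle)]
      exact hcont hg (hDG (hpD n)).1.1 hle ht.2 hRn (le_max_right _ _) s hs
    · rw [abs_of_nonneg (sub_nonneg.2 hle), norm_sub_rev, norm_sub_rev (p n).2]
      exact hcont hg ht.1 hle (hDG (hpD n)).1.2 (le_max_right _ _) hRn s ⟨hn.le, hs.2⟩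
  refine (hK s ⟨ht.1.trans hs.1, hs.2⟩).mem_of_tendsto hlim ?_
  filter_upwards [hps] with n hn
  exact hω _ (hpD n) s ⟨hn.le, hs.2⟩

/-- `Q` is the remainder of the flow after one Euler step, so Euler step plus `Q` is the flow, which
stays in the tube. The remainder estimate supplies the bounds with `h = 1` and exponent `gain`. -/
theorem contingent_of_viable [P.IsComplete] (h : Regular T α β δ μ b σ)
    (hB : ∀ t ∈ Icc 0 T, Measurable (B t))
    (hd : ∀ᵐ ω ∂P, Driver α T (Lam α T fun r => B r ω) (fun r => B r ω))
    (hK : ∀ t ∈ Icc 0 T, IsClosed (K t)) (hv : Viable P α T b σ B K) :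
    Contingent P α T b σ B K := by
  have hd' : ∀ᵐ ω ∂P, ∃ Λ, Driver α T Λ (fun r => B r ω) := hd.mono fun ω hω => ⟨_, hω⟩
  -- The constants are chosen for integer bounds on `Λ_α` only. Composed with the ceiling of `|v|`,
  -- they become measurable functions of `v`.
  choose C hC0 hC using fun (R : ℝ) (n : ℕ) => h.exists_remainder_bound n R
  have hmeas : ∀ R, Measurable fun v : ℝ => C R ⌈|v|⌉₊ := fun R =>
    (measurable_from_nat (f := C R)).comp (Nat.measurable_ceil.comp continuous_abs.measurable)
  refine ⟨{ω | Driver α T (Lam α T fun r => B r ω) (fun r => B r ω) ∧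
      ∀ t ∈ Icc 0 T, ∀ x ∈ K t, ∀ s ∈ Icc t T, flow α T b σ (fun r => B r ω) t x s ∈ K s},
    fun R v => C R ⌈|v|⌉₊, fun R v => C R ⌈|v|⌉₊, fun _ => gain α β δ μ,
    hd.and (h.ae_flow_mem_of_viable hd' hK hv),
    fun R _ => ⟨hmeas R, hmeas R, fun v => ⟨hC0 _ _, hC0 _ _⟩, h.gain_pos, h.gain_lt_one⟩,
    fun t ht x hx => ⟨fun _ => 1, fun s ω => flow α T b σ (fun r => B r ω) t x s -
        eulerStep b σ (fun r => B r ω) t s x,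
      measurable_const, fun _ => one_pos, fun s hs => ?_, fun ω hω => ⟨fun R _ hxR s hs => ?_,
        fun s hs => ?_⟩⟩⟩
  · exact (h.measurable_flow hB hd' ht x hs).sub
      (h.measurable_eulerStep hB ht ⟨ht.1.trans hs.1, hs.2⟩ measurable_const)
  · obtain ⟨h1, h2⟩ := hC R ⌈|Lam α T fun r => B r ω|⌉₊
      (hω.1.mono ((le_abs_self _).trans (Nat.le_ceil _))) ht hxR
    refine ⟨fun τ hτ => h1 s hs τ hτ, ?_⟩
    rw [abs_of_nonneg (sub_nonneg.2 hs.1)]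
    exact h2 s hs
  · have := hω.2 t ht x hx s ⟨hs.1, hs.2.trans (min_le_right _ _)⟩
    convert! this using 1
    exact add_sub_cancel _ _

end Regular

end FracViability

end

theorem mainTheorem1 {Ω : Type*} [MeasurableSpace Ω] (P : Measure Ω) [IsProbabilityMeasure P]
    [P.IsComplete] {d k : ℕ} (T H β δ α : ℝ) (hT : 0 < T)
    (hH : 1 / 2 < H) (hH1 : H < 1)
    (B : ℝ → Ω → EuclideanSpace ℝ (Fin k)) (hB : FracViability.IsVectorFBM P T H B)
    (b : ℝ → EuclideanSpace ℝ (Fin d) → EuclideanSpace ℝ (Fin d))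
    (σ : ℝ → EuclideanSpace ℝ (Fin d) → Matrix (Fin d) (Fin k) ℝ)
    (hσ : FracViability.H1 T β δ σ) (hb : FracViability.H2 T β δ b)
    (hβ : 1 - H < β) (hδ : (1 - H) / H < δ)
    (hα : 1 - H < α) (hα₀ : α < FracViability.alpha₀ β δ)
    (K : ℝ → Set (EuclideanSpace ℝ (Fin d)))
    (hK : ∀ t ∈ Icc 0 T, (K t).Nonempty ∧ IsClosed (K t)) :
    FracViability.Viable P α T b σ B K ↔
      FracViability.LeftClosed T K ∧ FracViability.Contingent P α T b σ B K := by
  obtain ⟨μ, h⟩ := FracViability.exists_regular hT hH1 hσ hb hα hα₀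
  have hd : ∀ᵐ ω ∂P, FracViability.Driver α T (FracViability.Lam α T fun r => B r ω)
      (fun r => B r ω) :=
    (hB.ae_driver hT hα (by linarith [h.α_lt])).mono fun ω hω => hω _ le_rfl
  have hd' : ∀ᵐ ω ∂P, ∃ Λ, FracViability.Driver α T Λ (fun r => B r ω) :=
    hd.mono fun ω hω => ⟨_, hω⟩
  have hBm := fun t ht => hB.measurable (t := t) ht
  have hKc := fun t ht => (hK t ht).2
  exact ⟨fun hv => ⟨h.leftClosed_of_viable hd' hKc hv, h.contingent_of_viable hBm hd hKc hv⟩,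
    fun hlc => h.viable hBm hd' hKc hlc.1 hlc.2⟩
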